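/- Let $n,p,q$ be non-negative integers, $\theta\in\mathbb R^{p\times q}$, and let $\Sigma\in\mathbb R^{p\times p}$ be symmetric positive definite with symmetric positive definite square root $A$. Let $X$ be a Gaussian $p\times q$ random matrix with $\mathrm E X=\theta$ and $\mathrm{Cov}(X_{ij},X_{kl})=\Sigma_{ik}\delta_{jl}$, let $Y$ be a centred Gaussian $nq\times p$ random matrix with $\mathrm{Cov}(Y_{\alpha i},Y_{\beta k})=\delta_{\alpha\beta}\Sigma_{ik}/q$, and suppose that $X$ and $S=Y^\top Y$ are independent. Denote by $S^+$ the Moore–Penrose inverse of $S$, and put $F=\mathrm{tr}(X^\top S^+X)$, $R=\mathrm{rank}(S)$. Assume $\mathrm P(qR>2)=1$. Let $r:\mathbb R\to[0,c_1]$ be differentiable with $|r'|\le c_2$, and set $$G=\frac{r^2(F)}{F^2}\,S^+XX^\top S^+S,\qquad g(X,S)=\frac{r(F)}{F}\,SS^+X,\qquad H=AGA^{-1},\qquad \tilde Y=\sqrt q\,YA^{-1}.$$ Write $\mathrm{div}_{\mathrm{vec}(\tilde Y)}\mathrm{vec}(\tilde YH)=\sum_{\alpha,i}\partial(\tilde YH)_{\alpha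 i}/\partial\tilde Y_{\alpha i}$, where $X$ is held fixed and $S$, $F$, $H$ are regarded as functions of $\tilde Y$ through $Y=\tilde YA/\sqrt q$, and $(\nabla_Xg^\top)_{ij}=\sum_{\alpha}\partial (g^\top)_{\alpha j}/\partial X_{i\alpha}$, where $S$ is held fixed. Then the partial derivatives of the entries of $\tilde YH$ with respect to $\tilde Y$, and of $g$ with respect to $X$, that occur in (i) and (ii) exist almost surely, and (i) $\mathrm E\big[\,|\mathrm{div}_{\mathrm{vec}(\tilde Y)}\mathrm{vec}(\tilde YH)|\,\big]<\infty$; (ii) $\mathrm E\big[\,|\mathrm{tr}(\nabla_Xg(X,S)^\top)|\,\big]<\infty$; (iii) both expectations below are finite (the integrands are integrable) and $$\mathrm E\big[\mathrm{tr}\big(g^\top(X,S)\,\Sigma^{-1}g(X,S)\big)\big]=\frac1q\,\mathrm E\left[\frac{r^2(F)}{F}\left(nq+p-2\,\mathrm{tr}(SS^+)-1+\frac{4\,\mathrm{tr}\big((X^\top S^+X)^2\big)}{F^2}\right)-\frac{4\,r(F)\,r'(F)}{F^2}\,\mathrm{tr}\big((X^\top S^+X)^2\big)\right].$$ -/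

import Mathlib

open MeasureTheory ProbabilityTheory
open scoped Matrix Kronecker

namespace MatrixMean

section MoorePenrose

variable {m k : Type*} [Fintype m] [Fintype k]

/-- The four Penrose equations: `B` is a Moore-Penrose inverse of the real matrix `A`. -/
structure IsMoorePenrose (A : Matrix m k ℝ) (B : Matrix k m ℝ) : Prop where
  mul_mul_self : A * B * A = A
  mul_mul_inv : B * A * B = B
  left_symm : (A * B)ᵀ = A * B
  right_symm : (B * A)ᵀ = B * A

/-- The Moore-Penrose inverse is unique. -/
theorem IsMoorePenrose.unique {A : Matrix m k ℝ} {B C : Matrix k m ℝ}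
    (hB : IsMoorePenrose A B) (hC : IsMoorePenrose A C) : B = C := by
  have h1 : A * B = A * C := by
    calc A * B = (A * B)ᵀ := hB.left_symm.symm
      _ = ((A * C) * (A * B))ᵀ := by rw [← Matrix.mul_assoc (A * C), hC.mul_mul_self]
      _ = (A * B)ᵀ * (A * C)ᵀ := Matrix.transpose_mul _ _
      _ = (A * B) * (A * C) := by rw [hB.left_symm, hC.left_symm]
      _ = A * C := by rw [← Matrix.mul_assoc (A * B), hB.mul_mul_self]
  have h2 : B * A = C * A := by
    calc B * A = (B * A)ᵀ := hB.right_symm.symm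
      _ = ((B * A) * (C * A))ᵀ := by
          rw [Matrix.mul_assoc B A, ← Matrix.mul_assoc A C A, hC.mul_mul_self]
      _ = (C * A)ᵀ * (B * A)ᵀ := Matrix.transpose_mul _ _
      _ = (C * A) * (B * A) := by rw [hB.right_symm, hC.right_symm]
      _ = C * A := by rw [Matrix.mul_assoc C A, ← Matrix.mul_assoc A B A, hB.mul_mul_self]
  calc B = B * A * B := hB.mul_mul_inv.symm
    _ = C * (A * B) := by rw [h2, Matrix.mul_assoc]
    _ = C := by rw [h1, ← Matrix.mul_assoc, hC.mul_mul_inv]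

theorem IsMoorePenrose.exists_of_isSymm {A : Matrix m m ℝ} (hA : Aᵀ = A) :
    ∃ B, IsMoorePenrose A B := by
  classical
  have hH : A.IsHermitian := by rw [Matrix.IsHermitian, Matrix.conjTranspose_eq_transpose_of_trivial, hA]
  set U : Matrix m m ℝ := (hH.eigenvectorUnitary : Matrix m m ℝ) with hU
  have hUU : Uᵀ * U = 1 := by
    have := Unitary.coe_star_mul_self hH.eigenvectorUnitary
    rwa [Matrix.star_eq_conjTranspose, Matrix.conjTranspose_eq_transpose_of_trivial] at this
  have hsp : A = U * Matrix.diagonal hH.eigenvalues * Uᵀ := by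
    have := hH.spectral_theorem
    rw [Unitary.conjStarAlgAut_apply, Matrix.star_eq_conjTranspose,
      Matrix.conjTranspose_eq_transpose_of_trivial] at this
    exact this
  have key : ∀ v w : m → ℝ, (U * Matrix.diagonal v * Uᵀ) * (U * Matrix.diagonal w * Uᵀ)
      = U * Matrix.diagonal (fun i => v i * w i) * Uᵀ := by
    intro v w
    calc _ = U * Matrix.diagonal v * (Uᵀ * U) * Matrix.diagonal w * Uᵀ := by
          simp only [Matrix.mul_assoc]
      _ = _ := by rw [hUU, Matrix.mul_one, Matrix.mul_assoc U, Matrix.diagonal_mul_diagonal]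
  have hsymm : ∀ v : m → ℝ, (U * Matrix.diagonal v * Uᵀ)ᵀ = U * Matrix.diagonal v * Uᵀ := by
    intro v
    simp [Matrix.transpose_mul, Matrix.mul_assoc]
  generalize hH.eigenvalues = l at hsp
  refine ⟨U * Matrix.diagonal (fun i => (l i)⁻¹) * Uᵀ, ?_, ?_, ?_, ?_⟩
  · rw [hsp, key, key]; congr; ext i; by_cases h : l i = 0 <;> simp [h]
  · rw [hsp, key, key]; congr; ext i; by_cases h : l i = 0 <;> simp [h]
  · rw [hsp, key, hsymm]
  · rw [hsp, key, hsymm]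

/-- Every real matrix has a Moore-Penrose inverse. -/
theorem IsMoorePenrose.exists (A : Matrix m k ℝ) : ∃ B, IsMoorePenrose A B := by
  classical
  have hs : (Aᵀ * A)ᵀ = Aᵀ * A := by rw [Matrix.transpose_mul, Matrix.transpose_transpose]
  obtain ⟨C, hC⟩ := IsMoorePenrose.exists_of_isSymm hs
  have hCA : A * (C * (Aᵀ * A)) = A := by
    have h : Aᵀ * A * (C * (Aᵀ * A) - 1 : Matrix k k ℝ) = 0 := by
      rw [Matrix.mul_sub, ← Matrix.mul_assoc, hC.mul_mul_self]; simp
    have h2 : A * (C * (Aᵀ * A) - 1 : Matrix k k ℝ) = 0 := by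
      rw [← Matrix.conjTranspose_eq_transpose_of_trivial] at h
      exact (Matrix.conjTranspose_mul_self_mul_eq_zero A _).1 h
    rw [Matrix.mul_sub, sub_eq_zero] at h2
    simpa using h2
  have hCs : Cᵀ = C := by
    refine IsMoorePenrose.unique (A := Aᵀ * A) ⟨?_, ?_, ?_, ?_⟩ hC
    · have := congrArg Matrix.transpose hC.mul_mul_self
      simpa only [Matrix.transpose_mul, Matrix.transpose_transpose, Matrix.mul_assoc] using this
    · have := congrArg Matrix.transpose hC.mul_mul_inv
      simpa only [Matrix.transpose_mul, Matrix.transpose_transpose, Matrix.mul_assoc] using this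
    · have := hC.right_symm
      rw [Matrix.transpose_mul, hs] at this
      rw [this, Matrix.transpose_mul, hs, this]
    · have := hC.left_symm
      rw [Matrix.transpose_mul, hs] at this
      rw [this, Matrix.transpose_mul, hs, this]
  refine ⟨C * Aᵀ, ?_, ?_, ?_, ?_⟩
  · simpa only [Matrix.mul_assoc] using hCA
  · have := congrArg (· * Aᵀ) hC.mul_mul_inv
    simpa only [Matrix.mul_assoc] using this
  · simp only [Matrix.transpose_mul, Matrix.transpose_transpose, hCs, Matrix.mul_assoc]
  · have := hC.right_symm
    simpa only [Matrix.mul_assoc] using this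

/-- The Moore-Penrose inverse `A⁺` of a real matrix `A`. -/
noncomputable def pinv (A : Matrix m k ℝ) : Matrix k m ℝ :=
  Classical.choose (IsMoorePenrose.exists A)

theorem pinv_spec (A : Matrix m k ℝ) : IsMoorePenrose A (pinv A) :=
  Classical.choose_spec (IsMoorePenrose.exists A)

end MoorePenrose

section Model

/-- The law of `vec Z` (columns stacked, indexed by (column, row)) for a Gaussian matrix `Z` with
mean `M` and `Cov (Z i j, Z k l) = U i k * V j l`: `U` is the covariance between rows and `V` the
covariance between columns, i.e. `Z ~ N(M, U ⊗ V)`. -/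
noncomputable def gaussianMatrixLaw {m k : Type*} [Fintype m] [DecidableEq m] [Fintype k]
    [DecidableEq k] (M : Matrix m k ℝ) (U : Matrix m m ℝ) (V : Matrix k k ℝ) :
    Measure (EuclideanSpace ℝ (k × m)) :=
  multivariateGaussian (WithLp.toLp 2 M.vec) (V ⊗ₖ U)

/-- The random matrix `Z` is Gaussian, `Z ~ N(M, U ⊗ V)`. -/
def IsGaussianMatrix {Ω : Type*} [MeasurableSpace Ω] {m k : Type*} [Fintype m] [DecidableEq m]
    [Fintype k] [DecidableEq k] (Z : Ω → Matrix m k ℝ) (M : Matrix m k ℝ) (U : Matrix m m ℝ)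
    (V : Matrix k k ℝ) (P : Measure Ω) : Prop :=
  HasLaw (fun ω => (WithLp.toLp 2 (Z ω).vec : EuclideanSpace ℝ (k × m)))
    (gaussianMatrixLaw M U V) P

/-- The statistical model: `X ~ N(θ, Σ ⊗ I_q)` of size `p × q`, `Y ~ N(0, I_{nq} ⊗ (Σ/q))` of size
`nq × p`, and `X` is independent of `S = Yᵀ Y`. -/
structure Model {Ω : Type*} [MeasurableSpace Ω] (n p q : ℕ) (θ : Matrix (Fin p) (Fin q) ℝ)
    (Sig : Matrix (Fin p) (Fin p) ℝ) (X : Ω → Matrix (Fin p) (Fin q) ℝ)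
    (Y : Ω → Matrix (Fin (n * q)) (Fin p) ℝ) (P : Measure Ω) : Prop where
  posDef : Sig.PosDef
  law_X : IsGaussianMatrix X θ Sig 1 P
  law_Y : IsGaussianMatrix Y 0 1 ((q : ℝ)⁻¹ • Sig) P
  indep : IndepFun (fun ω => (X ω).vec) (fun ω => ((Y ω)ᵀ * Y ω).vec) P

end Model

section Calculus

variable {m k l : Type*} [DecidableEq m] [DecidableEq k]

/-- The partial derivative `∂f/∂Z_{ij}` of a real function of a matrix. -/
noncomputable def partialDeriv (f : Matrix m k ℝ → ℝ) (Z : Matrix m k ℝ) (i : m) (j : k) : ℝ :=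
  lineDeriv ℝ f Z (Matrix.single i j 1)

/-- The partial derivative `∂f/∂Z_{ij}` exists at `Z`. -/
def HasPartial (f : Matrix m k ℝ → ℝ) (Z : Matrix m k ℝ) (i : m) (j : k) : Prop :=
  LineDifferentiableAt ℝ f Z (Matrix.single i j 1)

variable [Fintype m] [Fintype k]

/-- `div_{vec Z} vec (B(Z)) = ∑_{i,j} ∂B_{ij}/∂Z_{ij}`. -/
noncomputable def matDiv (B : Matrix m k ℝ → Matrix m k ℝ) (Z : Matrix m k ℝ) : ℝ :=
  ∑ i, ∑ j, partialDeriv (fun W => B W i j) Z i j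

/-- `(∇_Z B)_{ij} = ∑_α ∂B_{αj}/∂Z_{iα}`. -/
noncomputable def matNabla (B : Matrix m k ℝ → Matrix k l ℝ) (Z : Matrix m k ℝ) : Matrix m l ℝ :=
  Matrix.of fun i j => ∑ a, partialDeriv (fun W => B W a j) Z i a

end Calculus

section Statistics

variable {n p q : ℕ}

/-- `F = tr (Xᵀ S⁺ X)`. -/
noncomputable def statF (X : Matrix (Fin p) (Fin q) ℝ) (S : Matrix (Fin p) (Fin p) ℝ) : ℝ :=
  (Xᵀ * pinv S * X).trace

/-- `G = (r(F)² / F²) S⁺ X Xᵀ S⁺ S`. -/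
noncomputable def matG (r : ℝ → ℝ) (X : Matrix (Fin p) (Fin q) ℝ)
    (S : Matrix (Fin p) (Fin p) ℝ) : Matrix (Fin p) (Fin p) ℝ :=
  (r (statF X S) ^ 2 / statF X S ^ 2) • (pinv S * X * Xᵀ * pinv S * S)

/-- `g(X, S) = (r(F) / F) S S⁺ X`. -/
noncomputable def shrink (r : ℝ → ℝ) (X : Matrix (Fin p) (Fin q) ℝ)
    (S : Matrix (Fin p) (Fin p) ℝ) : Matrix (Fin p) (Fin q) ℝ :=
  (r (statF X S) / statF X S) • (S * pinv S * X)

/-- `Ỹ = √q Y A⁻¹`. -/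
noncomputable def tildeY (A : Matrix (Fin p) (Fin p) ℝ) (Y : Matrix (Fin (n * q)) (Fin p) ℝ) :
    Matrix (Fin (n * q)) (Fin p) ℝ :=
  Real.sqrt q • (Y * A⁻¹)

/-- `Y` recovered from `Ỹ`: `Y = Ỹ A / √q`. -/
noncomputable def untildeY (A : Matrix (Fin p) (Fin p) ℝ) (Z : Matrix (Fin (n * q)) (Fin p) ℝ) :
    Matrix (Fin (n * q)) (Fin p) ℝ :=
  (Real.sqrt q)⁻¹ • (Z * A)

/-- The matrix `Ỹ H`, with `H = A G A⁻¹`, as a function of `Z = Ỹ` for fixed `X`; here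
`S = Yᵀ Y` with `Y = Ỹ A / √q`. -/
noncomputable def fieldYH (r : ℝ → ℝ) (A : Matrix (Fin p) (Fin p) ℝ)
    (X : Matrix (Fin p) (Fin q) ℝ) (Z : Matrix (Fin (n * q)) (Fin p) ℝ) :
    Matrix (Fin (n * q)) (Fin p) ℝ :=
  Z * (A * matG r X ((untildeY A Z)ᵀ * untildeY A Z) * A⁻¹)

end Statistics

end MatrixMean

open MatrixMean

/-!
The identity is Stein's identity in the standardized variable `Ỹ`, for fixed `X`. Put
`M = (Y⁺)ᵀ X Xᵀ Y⁺`, so that `F = tr M`. The field `Ỹ H` equals `(r(F)² / F²) M Ỹ` (`fieldYH_eq`),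
its inner product with `Ỹ` is `q` times the integrand of the risk (`trace_transpose_mul_fieldYH`),
and its divergence is the integrand of the right-hand side (`matDiv_fieldYH`). It remains to compute
this divergence, to justify the integration by parts, and to check integrability.

*Divergence.* A Gaussian `Y` has full rank almost surely. On the open set of matrices of full rank
`Y ↦ Y⁺` is smooth, and its derivative is found by differentiating the Penrose equations
(`hasEntryDeriv_pinv`); the same formula serves for full row rank and for full column rank, so that
`nq ≤ p` and `nq ≥ p` need no separate treatment. The divergence is then a sum over the unit
matrices (`sum_fieldMatrixDeriv`, `sum_trace_fieldMatrixDeriv`).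

*Integration by parts.* The field is singular where `Y` loses rank or `F = 0`. These singularities
are cut off by means of `τ = |Ỹ|² + |Y⁺|² + 1 / F`, whose sublevel sets are compact subsets of the
regular set (`isCompact_sublevel_exhaustion`). In the direction `M Y` the Moore-Penrose inverse
moves only by `-Y⁺ M`; hence along the field `τ` changes at a rate of at most `2 |⟨Ỹ, Ỹ H⟩|` plus
`2 (r(F)² / F) τ` (`abs_lineDeriv_exhaustion_le`). This makes the error of the truncation vanish in
the limit by dominated convergence (`integral_divergence_stdGauss`), although the individual partial
derivatives of the field need not be integrable.

*Integrability.* All integrands are bounded by linear combinations of `1`, `1 / F` and `tr S / F`.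
In the eigenbasis of `S` the statistic `F` dominates `(tr S)⁻¹` times the sum of the squares of
`q * rank S ≥ 3` coordinates of `X`, and in three coordinates the inverse of the sum of squares is
integrable against a Gaussian density (`exists_lintegral_inv_statF_le`). This bounds the expectation
of `1 / F` over `X` by a multiple of `tr S`, whose second moment is finite (`integrable_inv_statF`).

Finally, `X` is independent of `S` but not necessarily of `Y`. Since every integrand in the
theorem is almost surely equal to a function of `(X, S)`, its expectation may be computed for
independent standardized variables (`Model.identDistrib_comp`).
-/

namespace MatrixMean

/-! ### Algebra of the Moore-Penrose inverse -/

section PinvAlgebra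

variable {m k : Type*} [Fintype m] [Fintype k]

theorem IsMoorePenrose.pinv_eq {A : Matrix m k ℝ} {B : Matrix k m ℝ} (h : IsMoorePenrose A B) :
    pinv A = B :=
  (pinv_spec A).unique h

theorem mul_pinv_mul (A : Matrix m k ℝ) : A * pinv A * A = A := (pinv_spec A).mul_mul_self

theorem pinv_mul_mul_pinv (A : Matrix m k ℝ) : pinv A * A * pinv A = pinv A :=
  (pinv_spec A).mul_mul_inv

theorem transpose_mul_pinv (A : Matrix m k ℝ) : (A * pinv A)ᵀ = A * pinv A :=
  (pinv_spec A).left_symm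

theorem transpose_pinv_mul (A : Matrix m k ℝ) : (pinv A * A)ᵀ = pinv A * A :=
  (pinv_spec A).right_symm

theorem pinv_transpose (A : Matrix m k ℝ) : pinv Aᵀ = (pinv A)ᵀ := by
  refine IsMoorePenrose.pinv_eq ⟨?_, ?_, ?_, ?_⟩
  · rw [← Matrix.transpose_mul, ← Matrix.transpose_mul, ← Matrix.mul_assoc, mul_pinv_mul]
  · rw [← Matrix.transpose_mul, ← Matrix.transpose_mul, ← Matrix.mul_assoc, pinv_mul_mul_pinv]
  · rw [← Matrix.transpose_mul, transpose_pinv_mul, transpose_pinv_mul]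
  · rw [← Matrix.transpose_mul, transpose_mul_pinv, transpose_mul_pinv]

theorem transpose_mul_transpose_pinv (Y : Matrix m k ℝ) : Yᵀ * (pinv Y)ᵀ = pinv Y * Y := by
  rw [← Matrix.transpose_mul, transpose_pinv_mul]

theorem transpose_mul_mul_pinv (Y : Matrix m k ℝ) : Yᵀ * (Y * pinv Y) = Yᵀ := by
  have := congrArg Matrix.transpose (mul_pinv_mul Y)
  rwa [Matrix.transpose_mul, transpose_mul_pinv] at this

theorem gram_mul_pinv_mul_transpose (Y : Matrix m k ℝ) :
    Yᵀ * Y * (pinv Y * (pinv Y)ᵀ) = pinv Y * Y := by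
  rw [← Matrix.mul_assoc, Matrix.mul_assoc Yᵀ, transpose_mul_mul_pinv,
    transpose_mul_transpose_pinv]

/-- The Moore-Penrose inverse of a Gram matrix. -/
theorem pinv_gram (Y : Matrix m k ℝ) : pinv (Yᵀ * Y) = pinv Y * (pinv Y)ᵀ := by
  have h1 := gram_mul_pinv_mul_transpose Y
  have h2 : pinv Y * (pinv Y)ᵀ * (Yᵀ * Y) = pinv Y * Y := by
    have := congrArg Matrix.transpose h1
    simpa only [Matrix.transpose_mul, Matrix.transpose_transpose, Matrix.mul_assoc,
      transpose_mul_transpose_pinv] using this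
  refine IsMoorePenrose.pinv_eq ⟨?_, ?_, ?_, ?_⟩
  · rw [h1, ← transpose_pinv_mul, ← Matrix.mul_assoc, ← Matrix.transpose_mul, ← Matrix.mul_assoc,
      mul_pinv_mul]
  · rw [h2, ← Matrix.mul_assoc, pinv_mul_mul_pinv]
  · rw [h1, transpose_pinv_mul]
  · rw [h2, transpose_pinv_mul]

theorem gram_mul_pinv_gram (Y : Matrix m k ℝ) : Yᵀ * Y * pinv (Yᵀ * Y) = pinv Y * Y := by
  rw [pinv_gram, gram_mul_pinv_mul_transpose]

theorem pinv_gram_mul_gram (Y : Matrix m k ℝ) : pinv (Yᵀ * Y) * (Yᵀ * Y) = pinv Y * Y := by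
  rw [← transpose_pinv_mul (Yᵀ * Y), Matrix.transpose_mul, ← pinv_transpose, Matrix.transpose_mul,
    Matrix.transpose_transpose, gram_mul_pinv_gram]

variable [DecidableEq m] [DecidableEq k]

/-- The matrix `Y` has full (row or column) rank, expressed through its Moore-Penrose inverse. -/
def FullRank (Y : Matrix m k ℝ) : Prop := Y * pinv Y = 1 ∨ pinv Y * Y = 1

omit [DecidableEq k] in
theorem pinv_eq_of_isUnit_det {Y : Matrix m k ℝ} (h : IsUnit (Y * Yᵀ).det) :
    pinv Y = Yᵀ * (Y * Yᵀ)⁻¹ := by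
  have h1 : Y * (Yᵀ * (Y * Yᵀ)⁻¹) = 1 := by
    rw [← Matrix.mul_assoc, Matrix.mul_nonsing_inv _ h]
  refine IsMoorePenrose.pinv_eq ⟨?_, ?_, ?_, ?_⟩
  · rw [h1, Matrix.one_mul]
  · rw [Matrix.mul_assoc (Yᵀ * (Y * Yᵀ)⁻¹), h1, Matrix.mul_one]
  · rw [h1, Matrix.transpose_one]
  · simp only [Matrix.transpose_mul, Matrix.transpose_nonsing_inv, Matrix.transpose_transpose,
      Matrix.mul_assoc]

omit [DecidableEq k] in
theorem mul_pinv_eq_one_iff {Y : Matrix m k ℝ} : Y * pinv Y = 1 ↔ (Y * Yᵀ).det ≠ 0 := by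
  rw [← isUnit_iff_ne_zero]
  constructor
  · intro h
    have : Y * Yᵀ * ((pinv Y)ᵀ * pinv Y) = 1 := by
      rw [Matrix.mul_assoc, ← Matrix.mul_assoc Yᵀ, transpose_mul_transpose_pinv,
        pinv_mul_mul_pinv, h]
    exact (Matrix.isUnit_iff_isUnit_det _).1 (IsUnit.of_mul_eq_one _ this)
  · intro h
    rw [pinv_eq_of_isUnit_det h, ← Matrix.mul_assoc, Matrix.mul_nonsing_inv _ h]

omit [DecidableEq m] in
theorem pinv_mul_eq_one_iff {Y : Matrix m k ℝ} : pinv Y * Y = 1 ↔ (Yᵀ * Y).det ≠ 0 := by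
  have := mul_pinv_eq_one_iff (Y := Yᵀ)
  rw [pinv_transpose, transpose_mul_transpose_pinv, Matrix.transpose_transpose] at this
  exact this

theorem fullRank_iff {Y : Matrix m k ℝ} :
    FullRank Y ↔ (Y * Yᵀ).det ≠ 0 ∨ (Yᵀ * Y).det ≠ 0 :=
  or_congr mul_pinv_eq_one_iff pinv_mul_eq_one_iff

end PinvAlgebra

/-! ### Continuity, differentiability and measurability of the Moore-Penrose inverse -/

section PinvTopology

variable {m k : Type*} [Fintype m] [Fintype k]

theorem isClosed_isMoorePenrose :
    IsClosed {x : Matrix m k ℝ × Matrix k m ℝ | IsMoorePenrose x.1 x.2} := by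
  have : {x : Matrix m k ℝ × Matrix k m ℝ | IsMoorePenrose x.1 x.2} =
      {x | x.1 * x.2 * x.1 = x.1} ∩ {x | x.2 * x.1 * x.2 = x.2} ∩
        {x | (x.1 * x.2)ᵀ = x.1 * x.2} ∩ {x | (x.2 * x.1)ᵀ = x.2 * x.1} := by
    ext x
    exact ⟨fun h => ⟨⟨⟨h.1, h.2⟩, h.3⟩, h.4⟩, fun h => ⟨h.1.1.1, h.1.1.2, h.1.2, h.2⟩⟩
  rw [this]
  refine (((isClosed_eq ?_ ?_).inter (isClosed_eq ?_ ?_)).inter (isClosed_eq ?_ ?_)).inter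
    (isClosed_eq ?_ ?_) <;> fun_prop

/-- The matrix whose vectorization (columns stacked) is `z`. -/
def unvec {m k : Type*} (z : k × m → ℝ) : Matrix m k ℝ := Matrix.of fun i j => z (j, i)

@[simp] theorem unvec_apply {m k : Type*} (z : k × m → ℝ) (i : m) (j : k) :
    unvec z i j = z (j, i) := rfl

@[simp] theorem vec_unvec {m k : Type*} (z : k × m → ℝ) : (unvec z).vec = z := rfl

@[simp] theorem unvec_vec {m k : Type*} (Z : Matrix m k ℝ) : unvec Z.vec = Z := rfl

@[fun_prop] theorem continuous_unvec {m k : Type*} :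
    Continuous (unvec : (k × m → ℝ) → Matrix m k ℝ) :=
  continuous_matrix fun _ _ => continuous_apply _

theorem continuous_vec {m k : Type*} : Continuous (Matrix.vec : Matrix m k ℝ → k × m → ℝ) :=
  continuous_pi fun _ => continuous_id.matrix_elem _ _

/-- The Moore-Penrose inverse is Borel: its graph is closed and projects injectively. -/
theorem measurable_vec_pinv_unvec :
    Measurable fun z : k × m → ℝ => (pinv (unvec z : Matrix m k ℝ)).vec := by
  intro s hs
  have himg : (fun z : k × m → ℝ => (pinv (unvec z : Matrix m k ℝ)).vec) ⁻¹' s =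
      Prod.fst '' ({x : (k × m → ℝ) × (m × k → ℝ) | IsMoorePenrose (unvec x.1) (unvec x.2)} ∩
        Prod.snd ⁻¹' s) := by
    ext z
    constructor
    · intro hz
      exact ⟨(z, (pinv (unvec z)).vec), ⟨by simpa using pinv_spec (unvec z), hz⟩, rfl⟩
    · rintro ⟨⟨z', b⟩, ⟨h1, h2⟩, rfl⟩
      have h1 : IsMoorePenrose (unvec z') (unvec b) := h1
      simpa [h1.pinv_eq] using h2
  rw [himg]
  have hcl : IsClosed
      {x : (k × m → ℝ) × (m × k → ℝ) | IsMoorePenrose (unvec x.1) (unvec x.2)} :=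
    isClosed_isMoorePenrose.preimage
      (f := fun x : (k × m → ℝ) × (m × k → ℝ) => (unvec x.1, unvec x.2)) (by fun_prop)
  refine (hcl.measurableSet.inter (measurable_snd hs)).image_of_continuousOn_injOn
    continuous_fst.continuousOn ?_
  rintro ⟨z, b⟩ ⟨h, -⟩ ⟨z', b'⟩ ⟨h', -⟩ (rfl : z = z')
  have : unvec b = unvec b' := IsMoorePenrose.unique h h'
  rw [← vec_unvec b, this, vec_unvec]

theorem measurable_pinv_apply {α : Type*} [MeasurableSpace α] {f : α → Matrix m k ℝ}
    (hf : ∀ i j, Measurable fun a => f a i j) (i : k) (j : m) :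
    Measurable fun a => pinv (f a) i j := by
  have h1 : Measurable fun a => (f a).vec := measurable_pi_iff.2 fun x => hf _ _
  exact (measurable_pi_apply (j, i)).comp (measurable_vec_pinv_unvec.comp h1)

omit [Fintype k] in
theorem measurable_mul_apply {α l : Type*} [MeasurableSpace α] {f : α → Matrix l m ℝ}
    {g : α → Matrix m k ℝ} (hf : ∀ i j, Measurable fun a => f a i j)
    (hg : ∀ i j, Measurable fun a => g a i j) (i : l) (j : k) :
    Measurable fun a => (f a * g a) i j := by
  simp only [Matrix.mul_apply]
  exact Finset.measurable_sum _ fun x _ => (hf _ _).mul (hg _ _)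

variable [DecidableEq m] [DecidableEq k]

theorem isOpen_fullRank : IsOpen {Y : Matrix m k ℝ | FullRank Y} := by
  simp only [fullRank_iff]
  exact (isOpen_ne_fun (by fun_prop) (by fun_prop)).union
    (isOpen_ne_fun (by fun_prop) (by fun_prop))

end PinvTopology

section EntryDeriv

variable {l m k : Type*}

/-- Every entry of the matrix-valued curve `f` has the corresponding entry of `f'` as derivative
at `0`. -/
def HasEntryDeriv (f : ℝ → Matrix m k ℝ) (f' : Matrix m k ℝ) : Prop :=
  ∀ i j, HasDerivAt (fun t => f t i j) (f' i j) 0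

theorem HasEntryDeriv.unique {f : ℝ → Matrix m k ℝ} {f' g' : Matrix m k ℝ}
    (h : HasEntryDeriv f f') (h' : HasEntryDeriv f g') : f' = g' := by
  ext i j
  exact (h i j).unique (h' i j)

theorem HasEntryDeriv.mul [Fintype m] {f : ℝ → Matrix l m ℝ} {g : ℝ → Matrix m k ℝ}
    {f' : Matrix l m ℝ} {g' : Matrix m k ℝ} (hf : HasEntryDeriv f f') (hg : HasEntryDeriv g g') :
    HasEntryDeriv (fun t => f t * g t) (f' * g 0 + f 0 * g') := by
  intro i j
  simp only [Matrix.mul_apply, Matrix.add_apply, ← Finset.sum_add_distrib]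
  exact HasDerivAt.fun_sum fun x _ => (hf i x).mul (hg x j)

theorem HasEntryDeriv.transpose {f : ℝ → Matrix m k ℝ} {f' : Matrix m k ℝ}
    (hf : HasEntryDeriv f f') : HasEntryDeriv (fun t => (f t)ᵀ) f'ᵀ :=
  fun i j => hf j i

theorem hasEntryDeriv_const (C : Matrix m k ℝ) : HasEntryDeriv (fun _ => C) 0 :=
  fun _ _ => hasDerivAt_const _ _

theorem hasEntryDeriv_line (Y E : Matrix m k ℝ) : HasEntryDeriv (fun t => Y + t • E) E := by
  intro i j
  simpa using ((hasDerivAt_id (0 : ℝ)).mul_const (E i j)).const_add (Y i j)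

theorem HasEntryDeriv.congr {f : ℝ → Matrix m k ℝ} {f' g' : Matrix m k ℝ}
    (h : HasEntryDeriv f f') (h' : f' = g') : HasEntryDeriv f g' := h' ▸ h

theorem HasEntryDeriv.trace [Fintype m] {f : ℝ → Matrix m m ℝ} {f' : Matrix m m ℝ}
    (h : HasEntryDeriv f f') : HasDerivAt (fun t => (f t).trace) f'.trace 0 :=
  HasDerivAt.fun_sum fun i _ => h i i

end EntryDeriv

section PinvSmooth

variable {m k : Type*} [Fintype m] [Fintype k] [DecidableEq m] [DecidableEq k]
  {V : Type*} [NormedAddCommGroup V] [NormedSpace ℝ V] {x : V} {N : WithTop ℕ∞}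

omit [Fintype k] [DecidableEq m] [DecidableEq k] in
theorem contDiffAt_mul_apply {l : Type*} {f : V → Matrix l m ℝ} {g : V → Matrix m k ℝ}
    (hf : ∀ i j, ContDiffAt ℝ N (fun v => f v i j) x)
    (hg : ∀ i j, ContDiffAt ℝ N (fun v => g v i j) x) (i : l) (j : k) :
    ContDiffAt ℝ N (fun v => (f v * g v) i j) x := by
  simp only [Matrix.mul_apply]
  exact ContDiffAt.sum fun a _ => (hf i a).mul (hg a j)

theorem contDiffAt_det {f : V → Matrix m m ℝ} (hf : ∀ i j, ContDiffAt ℝ N (fun v => f v i j) x) :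
    ContDiffAt ℝ N (fun v => (f v).det) x := by
  simp only [Matrix.det_apply]
  exact ContDiffAt.sum fun σ _ => (contDiffAt_prod fun i _ => hf _ _).const_smul _

theorem contDiffAt_nonsing_inv_apply {f : V → Matrix m m ℝ}
    (hf : ∀ i j, ContDiffAt ℝ N (fun v => f v i j) x) (h : (f x).det ≠ 0) (i j : m) :
    ContDiffAt ℝ N (fun v => (f v)⁻¹ i j) x := by
  simp only [Matrix.inv_def, Matrix.smul_apply, Ring.inverse_eq_inv', Matrix.adjugate_apply,
    smul_eq_mul]
  refine ((contDiffAt_det hf).inv h).mul (contDiffAt_det fun a b => ?_)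
  simp only [Matrix.updateRow_apply]
  split_ifs
  · exact contDiffAt_const
  · exact hf a b

omit [DecidableEq k] in
theorem contDiffAt_pinv_apply_of_det_ne_zero {f : V → Matrix m k ℝ}
    (hf : ∀ i j, ContDiffAt ℝ N (fun v => f v i j) x) (h : (f x * (f x)ᵀ).det ≠ 0) (i : k) (j : m) :
    ContDiffAt ℝ N (fun v => pinv (f v) i j) x := by
  have hg : ∀ i j, ContDiffAt ℝ N (fun v => (f v * (f v)ᵀ) i j) x :=
    contDiffAt_mul_apply hf fun i j => hf j i
  have hev : ∀ᶠ v in nhds x, (f v * (f v)ᵀ).det ≠ 0 :=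
    (contDiffAt_det hg).continuousAt.eventually_ne h
  refine (contDiffAt_mul_apply (f := fun v => (f v)ᵀ) (g := fun v => (f v * (f v)ᵀ)⁻¹)
    (fun i j => hf j i) (contDiffAt_nonsing_inv_apply hg h) i j).congr_of_eventuallyEq ?_
  exact hev.mono fun v hv => by
    simp only [pinv_eq_of_isUnit_det (isUnit_iff_ne_zero.2 hv)]

/-- The Moore-Penrose inverse is smooth on the open set of matrices of full rank. -/
theorem contDiffAt_pinv_apply {f : V → Matrix m k ℝ}
    (hf : ∀ i j, ContDiffAt ℝ N (fun v => f v i j) x) (h : FullRank (f x)) (i : k) (j : m) :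
    ContDiffAt ℝ N (fun v => pinv (f v) i j) x := by
  rcases fullRank_iff.1 h with h | h
  · exact contDiffAt_pinv_apply_of_det_ne_zero hf h i j
  · have := contDiffAt_pinv_apply_of_det_ne_zero (f := fun v => (f v)ᵀ) (x := x)
      (fun i j => hf j i) (by simpa using h) j i
    simpa only [pinv_transpose, Matrix.transpose_apply] using this

/-- The derivative of the Moore-Penrose inverse `B = Y⁺` in the direction `E`. -/
noncomputable def pinvDeriv (Y E : Matrix m k ℝ) : Matrix k m ℝ :=
  -(pinv Y * E * pinv Y) + (1 - pinv Y * Y) * Eᵀ * ((pinv Y)ᵀ * pinv Y)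
    + pinv Y * (pinv Y)ᵀ * Eᵀ * (1 - Y * pinv Y)

/-- Once `Y⁺` is known to be differentiable along the line `Y + t E`, its derivative is found by
differentiating the Penrose equations, which hold along the whole line. -/
theorem hasEntryDeriv_pinv {Y : Matrix m k ℝ} (h : FullRank Y) (E : Matrix m k ℝ) :
    HasEntryDeriv (fun t => pinv (Y + t • E)) (pinvDeriv Y E) := by
  have hY := hasEntryDeriv_line Y E
  have hdiff : ∀ i j, DifferentiableAt ℝ (fun t : ℝ => pinv (Y + t • E) i j) 0 := fun i j =>
    (contDiffAt_pinv_apply (N := 1) (f := fun t : ℝ => Y + t • E) (x := 0)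
      (fun i j => by
        simp only [Matrix.add_apply, Matrix.smul_apply, smul_eq_mul]; fun_prop)
      (by simpa using h) i j).differentiableAt one_ne_zero
  obtain ⟨D, hD⟩ : ∃ D, HasEntryDeriv (fun t => pinv (Y + t • E)) D :=
    ⟨Matrix.of fun i j => deriv (fun t : ℝ => pinv (Y + t • E) i j) 0,
      fun i j => (hdiff i j).hasDerivAt⟩
  set B := pinv Y with hB
  have hL : HasEntryDeriv (fun t => (Y + t • E) * pinv (Y + t • E)) (E * B + Y * D) := by
    simpa using hY.mul hD
  have hR : HasEntryDeriv (fun t => pinv (Y + t • E) * (Y + t • E)) (D * Y + B * E) := by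
    simpa using hD.mul hY
  -- the projections `Y B` and `B Y` stay symmetric
  have s1 : (E * B + Y * D)ᵀ = E * B + Y * D := by
    refine HasEntryDeriv.unique ?_ hL
    simpa only [transpose_mul_pinv] using hL.transpose
  have s2 : (D * Y + B * E)ᵀ = D * Y + B * E := by
    refine HasEntryDeriv.unique ?_ hR
    simpa only [transpose_pinv_mul] using hR.transpose
  -- the derivatives of `Y B Y = Y` and of `B Y B = B`
  have e1 : (E * B + Y * D) * Y + Y * B * E = E := by
    refine HasEntryDeriv.unique ?_ hY
    simpa [mul_pinv_mul] using hL.mul hY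
  have e2 : (D * Y + B * E) * B + B * Y * D = D := by
    refine HasEntryDeriv.unique ?_ hD
    simpa [pinv_mul_mul_pinv] using hR.mul hD
  have hYB : (Y * B)ᵀ = Y * B := transpose_mul_pinv Y
  have hBY : (B * Y)ᵀ = B * Y := transpose_pinv_mul Y
  have hBYB : B * Y * B = B := pinv_mul_mul_pinv Y
  -- `Y D (Y B) = (1 - Y B) E B - E B (Y B)`, and its transpose gives the remaining part of `B Y D`
  have e3 : (E * B + Y * D) * (Y * B) = (1 - Y * B) * (E * B) := by
    rw [← Matrix.mul_assoc, eq_sub_of_add_eq e1, Matrix.sub_mul, Matrix.sub_mul, Matrix.one_mul,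
      Matrix.mul_assoc (Y * B)]
  have e4 : (Y * B) * (E * B + Y * D) = Bᵀ * Eᵀ * (1 - Y * B) := by
    have := congrArg Matrix.transpose e3
    rw [Matrix.transpose_mul, s1, hYB, Matrix.transpose_mul, Matrix.transpose_sub, hYB,
      Matrix.transpose_one, Matrix.transpose_mul] at this
    exact this
  have e5 : Y * (D * Y + B * E) = E * (1 - B * Y) := by
    have h := e1
    rw [Matrix.add_mul] at h
    rw [Matrix.mul_add, Matrix.mul_sub, Matrix.mul_one, eq_sub_iff_add_eq]
    refine Eq.trans ?_ h
    simp only [Matrix.mul_assoc]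
    abel
  have e6 : (D * Y + B * E) * (B * Y) = (1 - B * Y) * Eᵀ * Bᵀ := by
    have h1 : (B * Y) * (D * Y + B * E) = B * (E * (1 - B * Y)) := by
      rw [Matrix.mul_assoc B, e5]
    have := congrArg Matrix.transpose h1
    rw [Matrix.transpose_mul, s2, hBY, Matrix.transpose_mul, Matrix.transpose_mul,
      Matrix.transpose_sub, hBY, Matrix.transpose_one] at this
    exact this
  refine hD.congr ?_
  rw [← e2, pinvDeriv, ← hB]
  have t1 : (D * Y + B * E) * B = (1 - B * Y) * Eᵀ * (Bᵀ * B) := by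
    calc (D * Y + B * E) * B = (D * Y + B * E) * (B * Y) * B := by
          rw [Matrix.mul_assoc _ (B * Y), hBYB]
      _ = _ := by rw [e6]; simp only [Matrix.mul_assoc]
  have t2 : B * Y * D = -(B * E * B) + B * Bᵀ * Eᵀ * (1 - Y * B) := by
    have : B * ((Y * B) * (E * B + Y * D)) = B * E * B + B * Y * D := by
      rw [← Matrix.mul_assoc, ← Matrix.mul_assoc, hBYB, Matrix.mul_add]
      simp only [Matrix.mul_assoc]
    rw [e4] at this
    rw [eq_neg_add_iff_add_eq, ← this]
    simp only [Matrix.mul_assoc]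
  rw [t1, t2]
  abel

end PinvSmooth

/-! ### The divergence of the shrinkage field -/

section Sums

variable {m k l : Type*} [Fintype m] [Fintype k] [DecidableEq m] [DecidableEq k]

theorem sum_mul_single_mul (U : Matrix m m ℝ) (W : Matrix k k ℝ) :
    ∑ i : m, ∑ j : k, (U * Matrix.single i j (1 : ℝ) * W) i j = U.trace * W.trace := by
  simp [Matrix.mul_apply, Matrix.single_apply, Matrix.trace, Finset.sum_mul_sum, ite_and,
    Finset.sum_ite_eq]

theorem sum_mul_single_transpose_mul (U W : Matrix m k ℝ) :
    ∑ i : m, ∑ j : k, (U * (Matrix.single i j (1 : ℝ))ᵀ * W) i j = (Uᵀ * W).trace := by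
  rw [Finset.sum_comm]
  simp [Matrix.mul_apply, Matrix.single_apply, Matrix.trace, ite_and, Finset.sum_ite_eq]

theorem pinvDeriv_add (Y E E' : Matrix m k ℝ) :
    pinvDeriv Y (E + E') = pinvDeriv Y E + pinvDeriv Y E' := by
  simp only [pinvDeriv, Matrix.transpose_add, Matrix.mul_add, Matrix.add_mul]
  abel

theorem pinvDeriv_smul (Y E : Matrix m k ℝ) (c : ℝ) :
    pinvDeriv Y (c • E) = c • pinvDeriv Y E := by
  simp only [pinvDeriv, Matrix.transpose_smul, Matrix.mul_smul, Matrix.smul_mul, smul_add, smul_neg]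

end Sums

section Field

variable {m k l : Type*} [Fintype m] [Fintype k] [Fintype l]

/-- The matrix `N = (Y⁺)ᵀ X`; the statistic `F` is its squared Frobenius norm. -/
noncomputable def pinvMul (X : Matrix k l ℝ) (Y : Matrix m k ℝ) : Matrix m l ℝ := (pinv Y)ᵀ * X

/-- The matrix `M = (Y⁺)ᵀ X Xᵀ Y⁺`, with `tr M = F`. -/
noncomputable def fieldMatrix (X : Matrix k l ℝ) (Y : Matrix m k ℝ) : Matrix m m ℝ :=
  pinvMul X Y * (pinvMul X Y)ᵀ

theorem fieldMatrix_transpose (X : Matrix k l ℝ) (Y : Matrix m k ℝ) :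
    (fieldMatrix X Y)ᵀ = fieldMatrix X Y := by
  simp [fieldMatrix, Matrix.transpose_mul]

omit [Fintype l] in
theorem mul_pinv_mul_pinvMul (X : Matrix k l ℝ) (Y : Matrix m k ℝ) :
    Y * pinv Y * pinvMul X Y = pinvMul X Y := by
  rw [pinvMul, ← Matrix.mul_assoc, ← transpose_mul_pinv, ← Matrix.transpose_mul, ← Matrix.mul_assoc,
    pinv_mul_mul_pinv]

theorem mul_pinv_mul_fieldMatrix (X : Matrix k l ℝ) (Y : Matrix m k ℝ) :
    Y * pinv Y * fieldMatrix X Y = fieldMatrix X Y := by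
  rw [fieldMatrix, ← Matrix.mul_assoc, mul_pinv_mul_pinvMul]

theorem fieldMatrix_mul_mul_pinv (X : Matrix k l ℝ) (Y : Matrix m k ℝ) :
    fieldMatrix X Y * (Y * pinv Y) = fieldMatrix X Y := by
  have := congrArg Matrix.transpose (mul_pinv_mul_fieldMatrix X Y)
  rwa [Matrix.transpose_mul, transpose_mul_pinv, fieldMatrix_transpose] at this

theorem trace_fieldMatrix (X : Matrix k l ℝ) (Y : Matrix m k ℝ) :
    (fieldMatrix X Y).trace = ((pinvMul X Y)ᵀ * pinvMul X Y).trace := Matrix.trace_mul_comm _ _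

omit [Fintype l] in
theorem transpose_pinvMul_mul_pinvMul (X : Matrix k l ℝ) (Y : Matrix m k ℝ) :
    (pinvMul X Y)ᵀ * pinvMul X Y = Xᵀ * pinv (Yᵀ * Y) * X := by
  rw [pinv_gram, pinvMul, Matrix.transpose_mul, Matrix.transpose_transpose]
  simp only [Matrix.mul_assoc]

theorem trace_fieldMatrix_mul_self (X : Matrix k l ℝ) (Y : Matrix m k ℝ) :
    (fieldMatrix X Y * fieldMatrix X Y).trace =
      (Xᵀ * pinv (Yᵀ * Y) * X * (Xᵀ * pinv (Yᵀ * Y) * X)).trace := by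
  rw [← transpose_pinvMul_mul_pinvMul, fieldMatrix, Matrix.mul_assoc, Matrix.trace_mul_comm]
  simp only [Matrix.mul_assoc]

variable [DecidableEq m] [DecidableEq k]

/-- The derivative of `N = (Y⁺)ᵀ X` in the direction `E`. -/
noncomputable def pinvMulDeriv (X : Matrix k l ℝ) (Y E : Matrix m k ℝ) : Matrix m l ℝ :=
  (pinvDeriv Y E)ᵀ * X

/-- The derivative of `M = N Nᵀ` in the direction `E`. -/
noncomputable def fieldMatrixDeriv (X : Matrix k l ℝ) (Y E : Matrix m k ℝ) : Matrix m m ℝ :=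
  pinvMulDeriv X Y E * (pinvMul X Y)ᵀ + pinvMul X Y * (pinvMulDeriv X Y E)ᵀ

theorem hasEntryDeriv_fieldMatrix (X : Matrix k l ℝ) {Y : Matrix m k ℝ} (h : FullRank Y)
    (E : Matrix m k ℝ) :
    HasEntryDeriv (fun t => fieldMatrix X (Y + t • E)) (fieldMatrixDeriv X Y E) := by
  have h1 : HasEntryDeriv (fun t => pinvMul X (Y + t • E)) (pinvMulDeriv X Y E) := by
    simpa [pinvMul, pinvMulDeriv] using
      (hasEntryDeriv_pinv h E).transpose.mul (hasEntryDeriv_const X)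
  simpa [fieldMatrix, fieldMatrixDeriv] using h1.mul h1.transpose

theorem fieldMatrixDeriv_add (X : Matrix k l ℝ) (Y E E' : Matrix m k ℝ) :
    fieldMatrixDeriv X Y (E + E') = fieldMatrixDeriv X Y E + fieldMatrixDeriv X Y E' := by
  simp only [fieldMatrixDeriv, pinvMulDeriv, pinvDeriv_add, Matrix.transpose_add, Matrix.add_mul,
    Matrix.mul_add]
  abel

theorem fieldMatrixDeriv_smul (X : Matrix k l ℝ) (Y E : Matrix m k ℝ) (c : ℝ) :
    fieldMatrixDeriv X Y (c • E) = c • fieldMatrixDeriv X Y E := by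
  simp only [fieldMatrixDeriv, pinvMulDeriv, pinvDeriv_smul, Matrix.transpose_smul, Matrix.smul_mul,
    Matrix.mul_smul, smul_add]

/-- In the direction `M Y` of the shrinkage field, the Moore-Penrose inverse moves by `-Y⁺ M`. -/
theorem pinvDeriv_fieldMatrix_mul (X : Matrix k l ℝ) (Y : Matrix m k ℝ) :
    pinvDeriv Y (fieldMatrix X Y * Y) = -(pinv Y * fieldMatrix X Y) := by
  have h1 : fieldMatrix X Y * Y * pinv Y = fieldMatrix X Y := by
    rw [Matrix.mul_assoc, fieldMatrix_mul_mul_pinv]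
  have h2 : (1 - pinv Y * Y) * Yᵀ = 0 := by
    rw [Matrix.sub_mul, Matrix.one_mul, ← transpose_pinv_mul, ← Matrix.transpose_mul,
      ← Matrix.mul_assoc, mul_pinv_mul, sub_self]
  have h3 : fieldMatrix X Y * (1 - Y * pinv Y) = 0 := by
    rw [Matrix.mul_sub, Matrix.mul_one, fieldMatrix_mul_mul_pinv, sub_self]
  rw [pinvDeriv, Matrix.mul_assoc (pinv Y), h1, Matrix.transpose_mul, fieldMatrix_transpose,
    ← Matrix.mul_assoc (1 - pinv Y * Y), h2, Matrix.mul_assoc _ (Yᵀ * _), Matrix.mul_assoc Yᵀ, h3]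
  simp

/-- The derivative of `F` in the direction `M Y` is `-2 tr (M²)`. -/
theorem trace_fieldMatrixDeriv_fieldMatrix_mul (X : Matrix k l ℝ) (Y : Matrix m k ℝ) :
    (fieldMatrixDeriv X Y (fieldMatrix X Y * Y)).trace =
      -2 * (fieldMatrix X Y * fieldMatrix X Y).trace := by
  have h : pinvMulDeriv X Y (fieldMatrix X Y * Y) = -(fieldMatrix X Y * pinvMul X Y) := by
    rw [pinvMulDeriv, pinvDeriv_fieldMatrix_mul, pinvMul, Matrix.transpose_neg,
      Matrix.transpose_mul, fieldMatrix_transpose, Matrix.neg_mul, Matrix.mul_assoc]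
  rw [fieldMatrixDeriv, h, Matrix.transpose_neg, Matrix.transpose_mul, fieldMatrix_transpose,
    Matrix.neg_mul, Matrix.mul_neg, Matrix.mul_assoc, ← Matrix.mul_assoc (pinvMul X Y),
    ← fieldMatrix, Matrix.trace_add, Matrix.trace_neg]
  ring

variable {A : Matrix k k ℝ} {c : ℝ}

/-- The divergence of `Z ↦ M Z` where `M` is the field matrix of `Y = c Z A`: it equals
`(|m| + |k| - 2 tr (Y⁺ Y) - 1) F`. Every term of the derivative of `M` has the form `U E W` or
`U Eᵀ W`; summed over the unit matrices `E` it contributes `tr U * tr W` or `tr (Uᵀ W)`. -/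
theorem sum_fieldMatrixDeriv (X : Matrix k l ℝ) {Y Z : Matrix m k ℝ} (hY : Y = c • (Z * A)) :
    ∑ i : m, ∑ j : k, (fieldMatrixDeriv X Y (c • (Matrix.single i j (1 : ℝ) * A)) * Z
        + fieldMatrix X Y * Matrix.single i j (1 : ℝ)) i j =
      (Fintype.card m + Fintype.card k - 2 * (pinv Y * Y).trace - 1) *
        (fieldMatrix X Y).trace := by
  set B := pinv Y with hB
  set N := pinvMul X Y with hN
  set M := fieldMatrix X Y with hM
  have hMN : M = N * Nᵀ := rfl
  have hYBs : (Y * B)ᵀ = Y * B := transpose_mul_pinv Y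
  have hBYs : (B * Y)ᵀ = B * Y := transpose_pinv_mul Y
  have hMYB : M * (Y * B) = M := fieldMatrix_mul_mul_pinv X Y
  have hYBM : Y * B * M = M := mul_pinv_mul_fieldMatrix X Y
  -- expansion into terms of the form `U E W` and `U Eᵀ W`
  have key : ∀ E : Matrix m k ℝ,
      fieldMatrixDeriv X Y (c • (E * A)) * Z + M * E =
        -(c • (Bᵀ * Aᵀ * Eᵀ * (M * Z))) + c • (Bᵀ * B * E * (A * (1 - B * Y) * X * Nᵀ * Z))
        + c • ((1 - Y * B) * E * (A * B * M * Z)) - c • (M * E * (A * B * Z))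
        + c • (N * Xᵀ * (1 - B * Y) * Aᵀ * Eᵀ * (Bᵀ * B * Z))
        + c • (M * Bᵀ * Aᵀ * Eᵀ * ((1 - Y * B) * Z)) + M * E * (1 : Matrix k k ℝ) := by
    intro E
    have hd : pinvMulDeriv X Y (c • (E * A)) = -(c • (Bᵀ * Aᵀ * Eᵀ * N))
        + c • (Bᵀ * B * E * (A * (1 - B * Y) * X)) + c • ((1 - Y * B) * E * (A * B * N)) := by
      simp only [pinvMulDeriv, pinvDeriv, ← hB, Matrix.transpose_add, Matrix.transpose_neg,
        Matrix.transpose_mul, Matrix.transpose_smul, Matrix.transpose_transpose,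
        Matrix.transpose_sub, Matrix.transpose_one, Matrix.add_mul, Matrix.neg_mul,
        Matrix.smul_mul, Matrix.mul_smul, hN, pinvMul]
      rw [← Matrix.transpose_mul Y B, ← Matrix.transpose_mul B Y, hYBs, hBYs]
      simp only [Matrix.mul_assoc]
    have hdT : (pinvMulDeriv X Y (c • (E * A)))ᵀ = -(c • (Nᵀ * E * A * B))
        + c • (Xᵀ * (1 - B * Y) * Aᵀ * Eᵀ * (Bᵀ * B)) + c • (Nᵀ * Bᵀ * Aᵀ * Eᵀ * (1 - Y * B)) := by
      rw [hd]
      simp only [Matrix.transpose_add, Matrix.transpose_neg,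
        Matrix.transpose_mul, Matrix.transpose_smul, Matrix.transpose_transpose,
        Matrix.transpose_sub, Matrix.transpose_one]
      rw [← Matrix.transpose_mul Y B, ← Matrix.transpose_mul B Y, hYBs, hBYs]
      simp only [Matrix.mul_assoc]
    rw [fieldMatrixDeriv, ← hN, hdT, hd, hMN]
    simp only [Matrix.add_mul, Matrix.mul_add, Matrix.neg_mul, Matrix.mul_neg, Matrix.smul_mul,
      Matrix.mul_smul, Matrix.mul_one]
    simp only [Matrix.mul_assoc]
    abel
  have hZA : ∀ W : Matrix k m ℝ, c * (A * W * Z).trace = (W * Y).trace := by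
    intro W
    rw [hY, Matrix.mul_smul, Matrix.trace_smul, smul_eq_mul, Matrix.mul_assoc,
      Matrix.trace_mul_comm, Matrix.mul_assoc]
  simp only [key]
  simp only [Matrix.add_apply, Matrix.sub_apply, Matrix.neg_apply, Matrix.smul_apply,
    smul_eq_mul, Finset.sum_add_distrib, Finset.sum_sub_distrib, Finset.sum_neg_distrib,
    ← Finset.mul_sum, sum_mul_single_mul, sum_mul_single_transpose_mul]
  have r1 : c * ((Bᵀ * Aᵀ)ᵀ * (M * Z)).trace = M.trace := by
    rw [Matrix.transpose_mul, Matrix.transpose_transpose, Matrix.transpose_transpose,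
      ← Matrix.mul_assoc, Matrix.mul_assoc A, hZA, Matrix.mul_assoc, Matrix.trace_mul_comm,
      Matrix.mul_assoc, hMYB]
  have r2 : c * (A * (1 - B * Y) * X * Nᵀ * Z).trace = 0 := by
    rw [Matrix.mul_assoc A, Matrix.mul_assoc A, hZA, Matrix.trace_mul_comm, ← Matrix.mul_assoc,
      ← Matrix.mul_assoc, Matrix.mul_sub, ← Matrix.mul_assoc, mul_pinv_mul]
    simp
  have r3 : c * (A * B * M * Z).trace = M.trace := by
    rw [Matrix.mul_assoc A, hZA, Matrix.trace_mul_comm, ← Matrix.mul_assoc, hYBM]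
  have r4 : c * (A * B * Z).trace = (B * Y).trace := hZA B
  have r5 : c * ((N * Xᵀ * (1 - B * Y) * Aᵀ)ᵀ * (Bᵀ * B * Z)).trace = 0 := by
    have : (N * Xᵀ * (1 - B * Y) * Aᵀ)ᵀ * (Bᵀ * B * Z) =
        A * ((1 - B * Y) * (X * Nᵀ * Bᵀ * B)) * Z := by
      simp only [Matrix.transpose_mul, Matrix.transpose_transpose, Matrix.transpose_sub,
        Matrix.transpose_one]
      rw [← Matrix.transpose_mul B Y, hBYs]
      simp only [Matrix.mul_assoc]
    rw [this, hZA, Matrix.mul_assoc, Matrix.trace_mul_comm]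
    have h0 : B * Y * (1 - B * Y) = 0 := by
      rw [Matrix.mul_sub, Matrix.mul_one, ← Matrix.mul_assoc, pinv_mul_mul_pinv, sub_self]
    rw [Matrix.mul_assoc (X * Nᵀ * Bᵀ), Matrix.mul_assoc, h0]
    simp
  have r6 : c * ((M * Bᵀ * Aᵀ)ᵀ * ((1 - Y * B) * Z)).trace = 0 := by
    have : (M * Bᵀ * Aᵀ)ᵀ * ((1 - Y * B) * Z) = A * (B * M * (1 - Y * B)) * Z := by
      simp only [Matrix.transpose_mul, Matrix.transpose_transpose, hM, fieldMatrix_transpose,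
        Matrix.mul_assoc]
    rw [this, hZA, Matrix.mul_assoc (B * M), Matrix.sub_mul, Matrix.one_mul, mul_pinv_mul]
    simp
  have r7 : ((1 : Matrix m m ℝ) - Y * B).trace = Fintype.card m - (B * Y).trace := by
    rw [Matrix.trace_sub, Matrix.trace_one, Matrix.trace_mul_comm]
  have r8 : ((1 : Matrix k k ℝ)).trace = Fintype.card k := Matrix.trace_one
  rw [r1, r5, r6, r7, r8]
  linear_combination (Bᵀ * B).trace * r2 + (Fintype.card m - (B * Y).trace) * r3 - M.trace * r4

/-- The sum of the partial derivatives of `F`, weighted by the entries of `M Z`, is the derivative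
of `F` in the direction `M Y`. -/
theorem sum_trace_fieldMatrixDeriv (X : Matrix k l ℝ) {Y Z : Matrix m k ℝ} (hY : Y = c • (Z * A)) :
    ∑ i, ∑ j, (fieldMatrixDeriv X Y (c • (Matrix.single i j (1 : ℝ) * A))).trace *
        (fieldMatrix X Y * Z) i j = -2 * (fieldMatrix X Y * fieldMatrix X Y).trace := by
  let L : Matrix m k ℝ →ₗ[ℝ] ℝ :=
    { toFun := fun E => (fieldMatrixDeriv X Y (c • (E * A))).trace
      map_add' := fun E E' => by
        simp only [Matrix.add_mul, smul_add, fieldMatrixDeriv_add, Matrix.trace_add]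
      map_smul' := fun a E => by
        simp only [Matrix.smul_mul, fieldMatrixDeriv_smul, Matrix.trace_smul, smul_eq_mul,
          RingHom.id_apply]
        ring }
  have h1 : L (fieldMatrix X Y * Z) = -2 * (fieldMatrix X Y * fieldMatrix X Y).trace := by
    rw [← trace_fieldMatrixDeriv_fieldMatrix_mul]
    simp only [L, LinearMap.coe_mk, AddHom.coe_mk]
    rw [Matrix.mul_assoc, ← Matrix.mul_smul, ← hY]
  rw [← h1]
  conv_rhs => rw [Matrix.matrix_eq_sum_single (fieldMatrix X Y * Z)]
  simp only [map_sum]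
  refine Finset.sum_congr rfl fun i _ => Finset.sum_congr rfl fun j _ => ?_
  have hs : Matrix.single i j ((fieldMatrix X Y * Z) i j) =
      (fieldMatrix X Y * Z) i j • Matrix.single i j (1 : ℝ) := by
    rw [Matrix.smul_single, smul_eq_mul, mul_one]
  rw [hs, map_smul, smul_eq_mul, mul_comm]
  rfl

end Field

section Frobenius

variable {l m k : Type*} [Fintype l] [Fintype m] [Fintype k]

theorem trace_transpose_mul_self (A : Matrix m k ℝ) : (Aᵀ * A).trace = ∑ j, ∑ i, A i j ^ 2 := by
  simp [Matrix.trace, Matrix.mul_apply, sq]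

theorem trace_transpose_mul_self_nonneg (A : Matrix m k ℝ) : 0 ≤ (Aᵀ * A).trace := by
  rw [trace_transpose_mul_self]
  positivity

/-- Submultiplicativity of the Frobenius norm. -/
theorem trace_mul_transpose_mul_le (B : Matrix l m ℝ) (N : Matrix m k ℝ) :
    ((B * N)ᵀ * (B * N)).trace ≤ (Bᵀ * B).trace * (Nᵀ * N).trace := by
  simp only [trace_transpose_mul_self]
  calc ∑ j, ∑ i, (B * N) i j ^ 2
      ≤ ∑ j, ∑ i, (∑ x, B i x ^ 2) * ∑ x, N x j ^ 2 := by
        refine Finset.sum_le_sum fun j _ => Finset.sum_le_sum fun i _ => ?_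
        rw [Matrix.mul_apply]
        exact Finset.sum_mul_sq_le_sq_mul_sq _ _ _
    _ = (∑ x, ∑ i, B i x ^ 2) * ∑ j, ∑ x, N x j ^ 2 := by
        rw [Finset.sum_comm (f := fun x i => B i x ^ 2), Finset.sum_mul_sum, Finset.sum_comm]

end Frobenius

section FieldMatrixBounds

variable {m k l : Type*} [Fintype m] [Fintype k] [Fintype l]

theorem trace_fieldMatrix_nonneg (X : Matrix k l ℝ) (Y : Matrix m k ℝ) :
    0 ≤ (fieldMatrix X Y).trace := by
  rw [trace_fieldMatrix]
  exact trace_transpose_mul_self_nonneg _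

theorem trace_fieldMatrix_mul_self_nonneg (X : Matrix k l ℝ) (Y : Matrix m k ℝ) :
    0 ≤ (fieldMatrix X Y * fieldMatrix X Y).trace := by
  have := trace_transpose_mul_self_nonneg (fieldMatrix X Y)
  rwa [fieldMatrix_transpose] at this

theorem trace_fieldMatrix_mul_self_le (X : Matrix k l ℝ) (Y : Matrix m k ℝ) :
    (fieldMatrix X Y * fieldMatrix X Y).trace ≤ (fieldMatrix X Y).trace ^ 2 := by
  have h := trace_mul_transpose_mul_le (pinvMul X Y) (pinvMul X Y)ᵀ
  rw [← fieldMatrix, fieldMatrix_transpose, Matrix.transpose_transpose, ← fieldMatrix,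
    ← trace_fieldMatrix] at h
  rwa [sq]

theorem trace_pinv_mul_fieldMatrix (X : Matrix k l ℝ) (Y : Matrix m k ℝ) :
    ((pinv Y)ᵀ * (pinv Y * fieldMatrix X Y)).trace =
      ((pinv Y * pinvMul X Y)ᵀ * (pinv Y * pinvMul X Y)).trace := by
  rw [fieldMatrix, Matrix.transpose_mul, Matrix.mul_assoc, ← Matrix.mul_assoc (pinv Y),
    ← Matrix.mul_assoc (pinv Y)ᵀ, Matrix.trace_mul_comm]

theorem statF_gram {n p q : ℕ} (X : Matrix (Fin p) (Fin q) ℝ) (Y : Matrix (Fin n) (Fin p) ℝ) :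
    statF X (Yᵀ * Y) = (fieldMatrix X Y).trace := by
  rw [statF, trace_fieldMatrix, transpose_pinvMul_mul_pinvMul]

end FieldMatrixBounds

theorem transpose_eq_of_posDef {m : Type*} {A : Matrix m m ℝ} (hA : A.PosDef) : Aᵀ = A := by
  have := hA.isHermitian
  rwa [Matrix.IsHermitian, Matrix.conjTranspose_eq_transpose_of_trivial] at this

section Divergence

variable {n p q : ℕ}

/-- The function of `(X, S)` whose expectation is `q` times the risk term: the closed form of the
divergence of `Ỹ H`. -/
noncomputable def divStat (n : ℕ) (r : ℝ → ℝ) (X : Matrix (Fin p) (Fin q) ℝ)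
    (S : Matrix (Fin p) (Fin p) ℝ) : ℝ :=
  r (statF X S) ^ 2 / statF X S * ((n : ℝ) * q + p - 2 * (S * pinv S).trace - 1
      + 4 * ((Xᵀ * pinv S * X) ^ 2).trace / statF X S ^ 2)
    - 4 * r (statF X S) * deriv r (statF X S) / statF X S ^ 2 * ((Xᵀ * pinv S * X) ^ 2).trace

variable {r : ℝ → ℝ} {A : Matrix (Fin p) (Fin p) ℝ} {X : Matrix (Fin p) (Fin q) ℝ}

/-- In terms of `M`, the shrinkage field is `Ỹ H = (r(F)² / F²) M Ỹ`. -/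
theorem fieldYH_eq (hq : q ≠ 0) (hA : IsUnit A.det) (Z : Matrix (Fin (n * q)) (Fin p) ℝ) :
    fieldYH r A X Z = (r (fieldMatrix X (untildeY A Z)).trace ^ 2 /
      (fieldMatrix X (untildeY A Z)).trace ^ 2) • (fieldMatrix X (untildeY A Z) * Z) := by
  have hc : Real.sqrt q ≠ 0 := by positivity
  set Y := untildeY A Z with hY
  have hZ : Z * A = Real.sqrt q • Y := by rw [hY, untildeY, smul_smul, mul_inv_cancel₀ hc, one_smul]
  have h1 : Y * pinv (Yᵀ * Y) = (pinv Y)ᵀ := by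
    rw [pinv_gram, ← Matrix.mul_assoc, ← transpose_mul_pinv, ← Matrix.transpose_mul,
      ← Matrix.mul_assoc, pinv_mul_mul_pinv]
  have h2 : Real.sqrt q • (pinv Y * Y * A⁻¹) = pinv Y * Z := by
    rw [← Matrix.smul_mul, ← Matrix.mul_smul, ← hZ, ← Matrix.mul_assoc,
      Matrix.mul_nonsing_inv_cancel_right _ _ hA]
  have h3 : Z * (A * matG r X (Yᵀ * Y) * A⁻¹) = (Z * A) * matG r X (Yᵀ * Y) * A⁻¹ := by
    simp only [Matrix.mul_assoc]
  have h4 : Y * (pinv (Yᵀ * Y) * X * Xᵀ * pinv (Yᵀ * Y) * (Yᵀ * Y)) * A⁻¹ =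
      pinvMul X Y * Xᵀ * (pinv Y * Y * A⁻¹) := by
    rw [Matrix.mul_assoc _ (pinv (Yᵀ * Y)) (Yᵀ * Y), pinv_gram_mul_gram, pinvMul, ← h1]
    simp only [Matrix.mul_assoc]
  rw [fieldYH, h3, hZ, matG, Matrix.mul_smul, Matrix.smul_mul, Matrix.smul_mul, Matrix.smul_mul, h4,
    statF_gram,
    ← Matrix.mul_smul _ (Real.sqrt q), h2, fieldMatrix, pinvMul, Matrix.transpose_mul,
    Matrix.transpose_transpose]
  simp only [Matrix.mul_assoc]

theorem untildeY_add_smul (Z E : Matrix (Fin (n * q)) (Fin p) ℝ) (t : ℝ) :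
    untildeY A (Z + t • E) = untildeY A Z + t • untildeY A E := by
  simp only [untildeY, Matrix.add_mul, Matrix.smul_mul, smul_add, smul_comm t]

/-- The matrices `Ỹ` for which `Y` has full rank and `F ≠ 0`; for given `X`, the shrinkage field is
differentiable there. -/
def regularSet (A : Matrix (Fin p) (Fin p) ℝ) (X : Matrix (Fin p) (Fin q) ℝ) :
    Set (Matrix (Fin (n * q)) (Fin p) ℝ) :=
  {Z | FullRank (untildeY A Z) ∧ (fieldMatrix X (untildeY A Z)).trace ≠ 0}

/-- The derivative of `x ↦ r(x)² / x²`. -/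
theorem hasDerivAt_sq_div_sq (hr : Differentiable ℝ r) {x : ℝ} (hx : x ≠ 0) :
    HasDerivAt (fun x => r x ^ 2 / x ^ 2)
      (2 * r x * deriv r x / x ^ 2 - 2 * r x ^ 2 / x ^ 3) x := by
  refine (((hr x).hasDerivAt.pow 2).div ((hasDerivAt_id x).pow 2)
    (by simpa using hx)).congr_deriv ?_
  simp only [id, Pi.pow_apply]
  field_simp
  push_cast
  ring

theorem hasLineDerivAt_trace_fieldMatrix {Z : Matrix (Fin (n * q)) (Fin p) ℝ}
    (hZ : FullRank (untildeY A Z)) (E : Matrix (Fin (n * q)) (Fin p) ℝ) :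
    HasLineDerivAt ℝ (fun Z => (fieldMatrix X (untildeY A Z)).trace)
      (fieldMatrixDeriv X (untildeY A Z) (untildeY A E)).trace Z E := by
  rw [HasLineDerivAt]
  simp only [untildeY_add_smul]
  exact (hasEntryDeriv_fieldMatrix X hZ _).trace

theorem hasLineDerivAt_fieldYH (hq : q ≠ 0) (hA : IsUnit A.det) (hr : Differentiable ℝ r)
    {Z : Matrix (Fin (n * q)) (Fin p) ℝ} (hZ : Z ∈ regularSet A X)
    (E : Matrix (Fin (n * q)) (Fin p) ℝ) (i : Fin (n * q)) (j : Fin p) :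
    HasLineDerivAt ℝ (fun Z => fieldYH r A X Z i j)
      ((2 * r (fieldMatrix X (untildeY A Z)).trace * deriv r (fieldMatrix X (untildeY A Z)).trace /
            (fieldMatrix X (untildeY A Z)).trace ^ 2
          - 2 * r (fieldMatrix X (untildeY A Z)).trace ^ 2 /
            (fieldMatrix X (untildeY A Z)).trace ^ 3)
          * (fieldMatrixDeriv X (untildeY A Z) (untildeY A E)).trace
          * (fieldMatrix X (untildeY A Z) * Z) i j
        + r (fieldMatrix X (untildeY A Z)).trace ^ 2 / (fieldMatrix X (untildeY A Z)).trace ^ 2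
          * (fieldMatrixDeriv X (untildeY A Z) (untildeY A E) * Z
            + fieldMatrix X (untildeY A Z) * E) i j) Z E := by
  rw [HasLineDerivAt]
  simp only [fieldYH_eq hq hA, Matrix.smul_apply, smul_eq_mul, untildeY_add_smul]
  have hM := hasEntryDeriv_fieldMatrix X hZ.1 (untildeY A E)
  have hF := hM.trace
  have hφ : HasDerivAt (fun x => r x ^ 2 / x ^ 2) _
      (fieldMatrix X (untildeY A Z + (0 : ℝ) • untildeY A E)).trace :=
    hasDerivAt_sq_div_sq hr (by simpa using hZ.2)
  have h := (hφ.comp 0 hF).mul (hM.mul (hasEntryDeriv_line Z E) i j)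
  refine h.congr_deriv ?_
  simp

/-- The closed form of the divergence of the shrinkage field at regular points. -/
theorem matDiv_fieldYH (hq : q ≠ 0) (hA : IsUnit A.det) (hr : Differentiable ℝ r)
    {Z : Matrix (Fin (n * q)) (Fin p) ℝ} (hZ : Z ∈ regularSet A X) :
    matDiv (fieldYH r A X) Z = divStat n r X ((untildeY A Z)ᵀ * untildeY A Z) := by
  simp only [matDiv, partialDeriv, (hasLineDerivAt_fieldYH hq hA hr hZ _ _ _).lineDeriv]
  simp only [Finset.sum_add_distrib, ← Finset.mul_sum, mul_assoc]
  have hF0 := hZ.2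
  rw [divStat, statF_gram, gram_mul_pinv_gram, sq (Xᵀ * _ * _), ← trace_fieldMatrix_mul_self]
  have h1 := sum_fieldMatrixDeriv X (Y := untildeY A Z) (Z := Z) (A := A) rfl
  have h2 := sum_trace_fieldMatrixDeriv X (Y := untildeY A Z) (Z := Z) (A := A) rfl
  have hu : ∀ E, (Real.sqrt q)⁻¹ • (E * A) = untildeY (n := n) A E := fun _ => rfl
  simp only [hu] at h1 h2
  rw [Fintype.card_fin, Fintype.card_fin] at h1
  rw [h1, h2]
  field_simp
  push_cast
  ring

/-- `τ(Z) = |Z|² + |Y⁺|² + 1 / F`, which tends to infinity at the boundary of the regular set. -/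
noncomputable def exhaustion (A : Matrix (Fin p) (Fin p) ℝ) (X : Matrix (Fin p) (Fin q) ℝ)
    (Z : Matrix (Fin (n * q)) (Fin p) ℝ) : ℝ :=
  (Zᵀ * Z).trace + ((pinv (untildeY A Z))ᵀ * pinv (untildeY A Z)).trace
    + (fieldMatrix X (untildeY A Z)).trace⁻¹

/-- The exhaustion grows at most linearly along the shrinkage field, up to integrable factors. -/
theorem abs_lineDeriv_exhaustion_le (hq : q ≠ 0) (hA : IsUnit A.det)
    {Z : Matrix (Fin (n * q)) (Fin p) ℝ} (hZ : Z ∈ regularSet A X) :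
    ∃ d, HasLineDerivAt ℝ (exhaustion A X) d Z (fieldYH r A X Z) ∧
      |d| ≤ 2 * |(Zᵀ * fieldYH r A X Z).trace| +
        2 * (r (fieldMatrix X (untildeY A Z)).trace ^ 2 / (fieldMatrix X (untildeY A Z)).trace) *
          exhaustion A X Z := by
  set V := fieldYH r A X Z with hV
  set Y := untildeY A Z with hY
  set F := (fieldMatrix X Y).trace with hF
  set φ := r F ^ 2 / F ^ 2 with hφ
  have hF0 : 0 < F := lt_of_le_of_ne (trace_fieldMatrix_nonneg X Y) (Ne.symm hZ.2)
  have hVY : untildeY A V = φ • (fieldMatrix X Y * Y) := by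
    rw [hV, fieldYH_eq hq hA, untildeY, ← hY, ← hF, ← hφ, Matrix.smul_mul, smul_comm,
      Matrix.mul_assoc, ← Matrix.mul_smul, hY, untildeY]
  -- the three parts of the exhaustion, differentiated along `V`
  have d1 : HasDerivAt (fun t : ℝ => ((Z + t • V)ᵀ * (Z + t • V)).trace)
      (2 * (Zᵀ * V).trace) 0 := by
    have h := hasEntryDeriv_line Z V
    refine (h.transpose.mul h).trace.congr_deriv ?_
    have : (Vᵀ * Z).trace = (Zᵀ * V).trace := by
      rw [← Matrix.trace_transpose, Matrix.transpose_mul, Matrix.transpose_transpose]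
    simp [Matrix.trace_add, this]
    ring
  have d2 : HasDerivAt
      (fun t : ℝ => ((pinv (untildeY A (Z + t • V)))ᵀ * pinv (untildeY A (Z + t • V))).trace)
      (-2 * φ * ((pinv Y)ᵀ * (pinv Y * fieldMatrix X Y)).trace) 0 := by
    simp only [untildeY_add_smul]
    have h := hasEntryDeriv_pinv hZ.1 (untildeY A V)
    refine (h.transpose.mul h).trace.congr_deriv ?_
    have h0 : pinvDeriv (untildeY A Z) (untildeY A V) = -(φ • (pinv Y * fieldMatrix X Y)) := by
      rw [hVY, pinvDeriv_smul, ← hY, pinvDeriv_fieldMatrix_mul, smul_neg]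
    have : ((pinv Y * fieldMatrix X Y)ᵀ * pinv Y).trace =
        ((pinv Y)ᵀ * (pinv Y * fieldMatrix X Y)).trace := by
      rw [← Matrix.trace_transpose, Matrix.transpose_mul, Matrix.transpose_transpose]
    rw [h0]
    simp [Matrix.trace_add, -Matrix.transpose_mul, this, ← hY]
    ring
  have d3 : HasDerivAt (fun t : ℝ => (fieldMatrix X (untildeY A (Z + t • V))).trace⁻¹)
      (2 * φ * (fieldMatrix X Y * fieldMatrix X Y).trace / F ^ 2) 0 := by
    have h := hasLineDerivAt_trace_fieldMatrix (X := X) hZ.1 V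
    rw [HasLineDerivAt] at h
    refine (h.fun_inv (by simpa using hZ.2)).congr_deriv ?_
    rw [hVY, fieldMatrixDeriv_smul, ← hY, Matrix.trace_smul, trace_fieldMatrixDeriv_fieldMatrix_mul]
    simp [← hY, ← hF]
    ring
  refine ⟨_, (d1.add d2).add d3, ?_⟩
  -- `|Y⁺ N|² ≤ |Y⁺|² F` and `tr (M²) ≤ F²` bound the last two rates by multiples of `r(F)² / F`
  rw [trace_pinv_mul_fieldMatrix]
  have b2 := trace_mul_transpose_mul_le (pinv Y) (pinvMul X Y)
  rw [← trace_fieldMatrix, ← hF] at b2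
  have b2' := trace_transpose_mul_self_nonneg (pinv Y * pinvMul X Y)
  have b3 := trace_fieldMatrix_mul_self_le X Y
  have b3' := trace_fieldMatrix_mul_self_nonneg X Y
  have b1 := trace_transpose_mul_self_nonneg Z
  rw [← hF] at b3
  have hφ0 : 0 ≤ φ := by positivity
  have hφF : r F ^ 2 / F = φ * F := by rw [hφ]; field_simp
  rw [exhaustion, ← hY, ← hF, hφF]
  generalize ((pinv Y * pinvMul X Y)ᵀ * (pinv Y * pinvMul X Y)).trace = u at *
  generalize (fieldMatrix X Y * fieldMatrix X Y).trace = T at *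
  generalize ((pinv Y)ᵀ * pinv Y).trace = b at *
  have hT : T / F ^ 2 ≤ 1 := by rw [div_le_one (by positivity)]; exact b3
  have hT' : 0 ≤ T / F ^ 2 := by positivity
  have e1 : |2 * φ * T / F ^ 2| ≤ 2 * φ := by
    rw [mul_div_assoc, abs_of_nonneg (by positivity)]
    nlinarith
  have e2 : |-2 * φ * u| ≤ 2 * φ * (b * F) := by
    rw [show -2 * φ * u = -(2 * φ * u) by ring, abs_neg, abs_of_nonneg (by positivity)]
    gcongr
  have e3 : |2 * (Zᵀ * V).trace| = 2 * |(Zᵀ * V).trace| := by rw [abs_mul, abs_two]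
  have e4 : 2 * (φ * F) * ((Zᵀ * Z).trace + b + F⁻¹) =
      2 * φ * F * (Zᵀ * Z).trace + 2 * φ * (b * F) + 2 * φ := by
    field_simp
  have e5 : 0 ≤ 2 * φ * F * (Zᵀ * Z).trace := by positivity
  calc _ ≤ |2 * (Zᵀ * V).trace| + |-2 * φ * u| + |2 * φ * T / F ^ 2| := abs_add_three _ _ _
    _ ≤ _ := by rw [e3, e4]; linarith

/-- The risk term is, up to the factor `q`, the inner product of `Ỹ` with the shrinkage field. -/
theorem trace_transpose_mul_fieldYH (hq : q ≠ 0) (hA : A.PosDef)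
    (Z : Matrix (Fin (n * q)) (Fin p) ℝ) {S : Matrix (Fin p) (Fin p) ℝ}
    (hS : S = (untildeY A Z)ᵀ * untildeY A Z) :
    (Zᵀ * fieldYH r A X Z).trace =
      q * ((shrink r X S)ᵀ * (A * A)⁻¹ * shrink r X S).trace := by
  have hdet : IsUnit A.det := isUnit_iff_ne_zero.2 hA.det_pos.ne'
  have hAs : Aᵀ = A := transpose_eq_of_posDef hA
  have hAi : A⁻¹ᵀ = A⁻¹ := by rw [Matrix.transpose_nonsing_inv, hAs]
  have hc : Real.sqrt q ≠ 0 := by positivity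
  rw [fieldYH_eq hq hdet]
  subst hS
  set Y := untildeY A Z with hY
  have hZ : Z = Real.sqrt q • (Y * A⁻¹) := by
    rw [hY, untildeY, Matrix.smul_mul, smul_smul, mul_inv_cancel₀ hc, one_smul,
      Matrix.mul_nonsing_inv_cancel_right _ _ hdet]
  have hN : pinv Y * Y * X = Yᵀ * pinvMul X Y := by
    rw [pinvMul, ← Matrix.mul_assoc, transpose_mul_transpose_pinv]
  have hS : shrink r X (Yᵀ * Y) =
      (r (fieldMatrix X Y).trace / (fieldMatrix X Y).trace) • (Yᵀ * pinvMul X Y) := by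
    rw [shrink, statF_gram, gram_mul_pinv_gram, hN]
  have hqs : Real.sqrt q * Real.sqrt q = q := Real.mul_self_sqrt (Nat.cast_nonneg q)
  rw [hS, Matrix.mul_inv_rev]
  nth_rewrite 1 [hZ]
  rw [hZ]
  simp only [Matrix.transpose_smul, Matrix.transpose_mul, hAi, Matrix.smul_mul, Matrix.mul_smul,
    Matrix.trace_smul, smul_eq_mul, fieldMatrix, Matrix.transpose_transpose]
  have : (A⁻¹ * Yᵀ * (pinvMul X Y * (pinvMul X Y)ᵀ * (Y * A⁻¹))).trace =
      ((pinvMul X Y)ᵀ * Y * (A⁻¹ * A⁻¹) * (Yᵀ * pinvMul X Y)).trace := by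
    rw [← Matrix.mul_assoc, ← Matrix.mul_assoc, Matrix.trace_mul_comm]
    conv_rhs => rw [Matrix.trace_mul_comm]
    conv_lhs => rw [Matrix.trace_mul_comm]
    simp only [← Matrix.mul_assoc]
    conv_rhs => rw [Matrix.trace_mul_comm]
    simp only [← Matrix.mul_assoc]
  rw [this]
  linear_combination (r (pinvMul X Y * (pinvMul X Y)ᵀ).trace ^ 2 /
    (pinvMul X Y * (pinvMul X Y)ᵀ).trace ^ 2 *
    ((pinvMul X Y)ᵀ * Y * (A⁻¹ * A⁻¹) * (Yᵀ * pinvMul X Y)).trace) * hqs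

theorem trace_shrink_le (hA : A.PosDef) {c₁ : ℝ} (hr : ∀ x, r x ∈ Set.Icc 0 c₁)
    {Y : Matrix (Fin n) (Fin p) ℝ} (hF : 0 < statF X (Yᵀ * Y)) :
    |((shrink r X (Yᵀ * Y))ᵀ * (A * A)⁻¹ * shrink r X (Yᵀ * Y)).trace| ≤
      c₁ ^ 2 * (A⁻¹ᵀ * A⁻¹).trace * ((Yᵀ * Y).trace / statF X (Yᵀ * Y)) := by
  have hAs : Aᵀ = A := transpose_eq_of_posDef hA
  have hAi : A⁻¹ᵀ = A⁻¹ := by rw [Matrix.transpose_nonsing_inv, hAs]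
  have h1 : (shrink r X (Yᵀ * Y))ᵀ * (A * A)⁻¹ * shrink r X (Yᵀ * Y) =
      (r (statF X (Yᵀ * Y)) / statF X (Yᵀ * Y)) ^ 2 •
        ((A⁻¹ * (Yᵀ * pinvMul X Y))ᵀ * (A⁻¹ * (Yᵀ * pinvMul X Y))) := by
    have hN : pinv Y * Y * X = Yᵀ * pinvMul X Y := by
      rw [pinvMul, ← Matrix.mul_assoc, transpose_mul_transpose_pinv]
    rw [shrink, gram_mul_pinv_gram, hN, Matrix.mul_inv_rev, Matrix.transpose_mul, hAi,
      Matrix.transpose_smul, Matrix.smul_mul, Matrix.smul_mul, Matrix.mul_smul, smul_smul, sq]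
    simp only [Matrix.mul_assoc]
  have h2 := trace_mul_transpose_mul_le A⁻¹ (Yᵀ * pinvMul X Y)
  have h3 := trace_mul_transpose_mul_le Yᵀ (pinvMul X Y)
  rw [← trace_fieldMatrix, ← statF_gram, Matrix.transpose_transpose, Matrix.trace_mul_comm Y] at h3
  have h4 := trace_transpose_mul_self_nonneg (A⁻¹ * (Yᵀ * pinvMul X Y))
  have h5 := trace_transpose_mul_self_nonneg A⁻¹
  have h6 := trace_transpose_mul_self_nonneg Y
  obtain ⟨hr0, hr1⟩ := hr (statF X (Yᵀ * Y))
  rw [h1, Matrix.trace_smul, smul_eq_mul, abs_of_nonneg (by positivity)]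
  set F := statF X (Yᵀ * Y)
  calc _ ≤ (c₁ / F) ^ 2 * ((A⁻¹ᵀ * A⁻¹).trace * ((Yᵀ * Y).trace * F)) := by
        gcongr
        exact h2.trans (by gcongr)
    _ = _ := by field_simp

theorem trace_pinv_mul_nonneg {m k : Type*} [Fintype m] [Fintype k] (Y : Matrix m k ℝ) :
    0 ≤ (pinv Y * Y).trace := by
  have h := trace_transpose_mul_self_nonneg (pinv Y * Y)
  rwa [transpose_pinv_mul, ← Matrix.mul_assoc, pinv_mul_mul_pinv] at h

theorem trace_pinv_mul_le {m k : Type*} [Fintype m] [Fintype k] [DecidableEq k]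
    (Y : Matrix m k ℝ) : (pinv Y * Y).trace ≤ Fintype.card k := by
  have h := trace_transpose_mul_self_nonneg (1 - pinv Y * Y)
  rw [Matrix.transpose_sub, Matrix.transpose_one, transpose_pinv_mul, Matrix.mul_sub,
    Matrix.sub_mul _ _ (pinv Y * Y), ← Matrix.mul_assoc (pinv Y * Y), pinv_mul_mul_pinv] at h
  simp at h
  exact h

theorem abs_divStat_le {c₁ c₂ : ℝ} (hr : ∀ x, r x ∈ Set.Icc 0 c₁) (hr' : ∀ x, |deriv r x| ≤ c₂)
    {Y : Matrix (Fin (n * q)) (Fin p) ℝ} (hF : 0 < statF X (Yᵀ * Y)) :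
    |divStat n r X (Yᵀ * Y)| ≤
      c₁ ^ 2 * ((n : ℝ) * q + 3 * p + 5) * (statF X (Yᵀ * Y))⁻¹ + 4 * c₁ * c₂ := by
  have hT := trace_fieldMatrix_mul_self_le X Y
  have hT0 := trace_fieldMatrix_mul_self_nonneg X Y
  have hR := trace_pinv_mul_le Y
  have hR0 := trace_pinv_mul_nonneg Y
  rw [Fintype.card_fin] at hR
  rw [← statF_gram] at hT
  rw [divStat, gram_mul_pinv_gram, sq (Xᵀ * _ * _), ← trace_fieldMatrix_mul_self]
  set F := statF X (Yᵀ * Y)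
  set T := (fieldMatrix X Y * fieldMatrix X Y).trace
  obtain ⟨hr0, hr1⟩ := hr F
  have h' := hr' F
  have hT1 : T / F ^ 2 ≤ 1 := by rw [div_le_one (by positivity)]; exact hT
  have hT2 : 0 ≤ T / F ^ 2 := by positivity
  have hn : (0 : ℝ) ≤ n * q := by positivity
  have hp : (0 : ℝ) ≤ p := by positivity
  have e1 : |(n : ℝ) * q + p - 2 * (pinv Y * Y).trace - 1 + 4 * T / F ^ 2| ≤
      (n : ℝ) * q + 3 * p + 5 := by
    rw [abs_le, mul_div_assoc]
    constructor <;> linarith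
  have e2 : |r F ^ 2 / F| ≤ c₁ ^ 2 * F⁻¹ := by
    rw [abs_of_nonneg (by positivity), div_eq_mul_inv]
    gcongr
  have e3 : |4 * r F * deriv r F / F ^ 2 * T| ≤ 4 * c₁ * c₂ := by
    rw [show 4 * r F * deriv r F / F ^ 2 * T = 4 * r F * deriv r F * (T / F ^ 2) by ring,
      abs_mul, abs_mul, abs_of_nonneg hT2, abs_of_nonneg (by positivity : 0 ≤ 4 * r F)]
    have : 0 ≤ c₂ := (abs_nonneg _).trans h'
    have : 0 ≤ c₁ := hr0.trans hr1
    calc 4 * r F * |deriv r F| * (T / F ^ 2) ≤ 4 * c₁ * c₂ * 1 := by gcongr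
      _ = _ := mul_one _
  calc _ ≤ |r F ^ 2 / F| * |(n : ℝ) * q + p - 2 * (pinv Y * Y).trace - 1 + 4 * T / F ^ 2|
        + |4 * r F * deriv r F / F ^ 2 * T| := by
        rw [← abs_mul]; exact abs_sub _ _
    _ ≤ c₁ ^ 2 * F⁻¹ * ((n : ℝ) * q + 3 * p + 5) + 4 * c₁ * c₂ := by gcongr
    _ = _ := by ring

/-- The partial derivatives of `g` with respect to `X`. -/
theorem hasLineDerivAt_shrink (hr : Differentiable ℝ r) {S : Matrix (Fin p) (Fin p) ℝ}
    (hS : Sᵀ = S) (hF : statF X S ≠ 0) (E : Matrix (Fin p) (Fin q) ℝ) (i : Fin p) (j : Fin q) :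
    HasLineDerivAt ℝ (fun W => shrink r W S i j)
      ((deriv r (statF X S) / statF X S - r (statF X S) / statF X S ^ 2)
          * (2 * (Xᵀ * pinv S * E).trace) * (S * pinv S * X) i j
        + r (statF X S) / statF X S * (S * pinv S * E) i j) X E := by
  rw [HasLineDerivAt]
  simp only [shrink, Matrix.smul_apply, smul_eq_mul]
  have hL := hasEntryDeriv_line X E
  have hF' : HasDerivAt (fun t : ℝ => statF (X + t • E) S) (2 * (Xᵀ * pinv S * E).trace) 0 := by
    have hsymm : (Eᵀ * pinv S * X).trace = (Xᵀ * pinv S * E).trace := by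
      rw [← Matrix.trace_transpose, Matrix.transpose_mul, Matrix.transpose_mul,
        Matrix.transpose_transpose, ← pinv_transpose, hS, Matrix.mul_assoc]
    refine ((hL.transpose.mul (hasEntryDeriv_const (pinv S))).mul hL).trace.congr_deriv ?_
    simp [Matrix.trace_add, -Matrix.transpose_mul, hsymm]
    ring
  have hφ : HasDerivAt (fun x => r x / x)
      (deriv r (statF X S) / statF X S - r (statF X S) / statF X S ^ 2)
      (statF (X + (0 : ℝ) • E) S) := by
    rw [zero_smul, add_zero]
    refine ((hr (statF X S)).hasDerivAt.div (hasDerivAt_id (statF X S)) hF).congr_deriv ?_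
    simp only [id]
    field_simp
  have hP : HasEntryDeriv (fun t : ℝ => S * pinv S * (X + t • E)) (S * pinv S * E) := by
    simpa using (hasEntryDeriv_const (S * pinv S)).mul hL
  refine ((hφ.comp 0 hF').mul (hP i j)).congr_deriv ?_
  simp

/-- The closed form of the divergence of `g` with respect to `X`, as a function of `(X, S)`. -/
noncomputable def nablaStat (r : ℝ → ℝ) (X : Matrix (Fin p) (Fin q) ℝ)
    (S : Matrix (Fin p) (Fin p) ℝ) : ℝ :=
  r (statF X S) / statF X S * ((S * pinv S).trace * q - 2) + 2 * deriv r (statF X S)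

theorem trace_matNabla_shrink (hr : Differentiable ℝ r) {S : Matrix (Fin p) (Fin p) ℝ}
    (hS : Sᵀ = S) (hF : statF X S ≠ 0) :
    (matNabla (fun W => (shrink r W S)ᵀ) X).trace = nablaStat r X S := by
  have h0 : (matNabla (fun W => (shrink r W S)ᵀ) X).trace =
      ∑ i, ∑ j, lineDeriv ℝ (fun W => shrink r W S i j) X (Matrix.single i j 1) := rfl
  rw [h0]
  simp only [(hasLineDerivAt_shrink hr hS hF _ _ _).lineDeriv]
  simp only [Finset.sum_add_distrib, ← Finset.mul_sum, mul_assoc]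
  have h1 := sum_mul_single_mul (S * pinv S) (1 : Matrix (Fin q) (Fin q) ℝ)
  rw [Matrix.trace_one, Fintype.card_fin] at h1
  simp only [Matrix.mul_one] at h1
  have h2 : ∑ i, ∑ j, (Xᵀ * pinv S * Matrix.single i j (1 : ℝ)).trace * (S * pinv S * X) i j =
      statF X S := by
    let L : Matrix (Fin p) (Fin q) ℝ →ₗ[ℝ] ℝ :=
      { toFun := fun E => (Xᵀ * pinv S * E).trace
        map_add' := fun E E' => by simp only [Matrix.mul_add, Matrix.trace_add]
        map_smul' := fun a E => by
          simp only [Matrix.mul_smul, Matrix.trace_smul, RingHom.id_apply] }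
    have h3 : L (S * pinv S * X) = statF X S := by
      change (Xᵀ * pinv S * (S * pinv S * X)).trace = statF X S
      rw [statF, ← Matrix.mul_assoc, Matrix.mul_assoc Xᵀ, ← Matrix.mul_assoc (pinv S),
        pinv_mul_mul_pinv]
    rw [← h3]
    conv_rhs => rw [Matrix.matrix_eq_sum_single (S * pinv S * X)]
    simp only [map_sum]
    refine Finset.sum_congr rfl fun i _ => Finset.sum_congr rfl fun j _ => ?_
    have hs : Matrix.single i j ((S * pinv S * X) i j) =
        (S * pinv S * X) i j • Matrix.single i j (1 : ℝ) := by
      rw [Matrix.smul_single, smul_eq_mul, mul_one]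
    rw [hs, map_smul, smul_eq_mul, mul_comm]
    rfl
  simp only [Matrix.mul_assoc] at h1 h2 ⊢
  rw [h1, h2, nablaStat]
  field_simp
  ring

theorem abs_nablaStat_le {c₁ c₂ : ℝ} (hr : ∀ x, r x ∈ Set.Icc 0 c₁)
    (hr' : ∀ x, |deriv r x| ≤ c₂) {Y : Matrix (Fin n) (Fin p) ℝ}
    (hF : 0 < statF X (Yᵀ * Y)) :
    |nablaStat r X (Yᵀ * Y)| ≤ c₁ * (p * q + 2) * (statF X (Yᵀ * Y))⁻¹ + 2 * c₂ := by
  have hR := trace_pinv_mul_le Y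
  have hR0 := trace_pinv_mul_nonneg Y
  rw [Fintype.card_fin] at hR
  rw [nablaStat, gram_mul_pinv_gram]
  set F := statF X (Yᵀ * Y)
  obtain ⟨hr0, hr1⟩ := hr F
  have h' := hr' F
  have hc₁ : 0 ≤ c₁ := hr0.trans hr1
  have h1 : (pinv Y * Y).trace * q ≤ p * q := by gcongr
  have h2 : 0 ≤ (pinv Y * Y).trace * q := by positivity
  have h3 : |(pinv Y * Y).trace * q - 2| ≤ p * q + 2 := by
    rw [abs_le]
    constructor <;> linarith
  calc _ ≤ |r F / F * ((pinv Y * Y).trace * q - 2)| + |2 * deriv r F| := abs_add_le _ _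
    _ = r F * F⁻¹ * |(pinv Y * Y).trace * q - 2| + 2 * |deriv r F| := by
        rw [abs_mul, abs_mul, abs_two, abs_of_nonneg (by positivity : 0 ≤ r F / F), div_eq_mul_inv]
    _ ≤ c₁ * F⁻¹ * (p * q + 2) + 2 * c₂ := by gcongr
    _ = _ := by ring

end Divergence


/-! ### Stein's identity -/

section Stein

variable {ι : Type*} [Fintype ι]

/-- The standard Gaussian measure on `ι → ℝ`. -/
noncomputable def stdGauss (ι : Type*) [Fintype ι] : Measure (ι → ℝ) :=
  Measure.pi fun _ => gaussianReal 0 1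

instance : IsProbabilityMeasure (stdGauss ι) := by unfold stdGauss; infer_instance

/-- The density of the standard Gaussian measure. -/
noncomputable def gaussDensity (x : ι → ℝ) : ℝ :=
  ((Real.sqrt (2 * Real.pi))⁻¹) ^ Fintype.card ι * Real.exp (-(∑ i, x i ^ 2) / 2)

theorem gaussDensity_eq_prod (x : ι → ℝ) : gaussDensity x = ∏ i, gaussianPDFReal 0 1 (x i) := by
  simp [gaussDensity, gaussianPDFReal, Finset.prod_mul_distrib, ← Real.exp_sum, neg_div,
    Finset.sum_div]

theorem gaussDensity_pos (x : ι → ℝ) : 0 < gaussDensity x := by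
  unfold gaussDensity
  positivity

theorem continuous_gaussDensity : Continuous (gaussDensity : (ι → ℝ) → ℝ) := by
  unfold gaussDensity
  fun_prop

theorem stdGauss_eq_withDensity :
    stdGauss ι = volume.withDensity fun x => ENNReal.ofReal (gaussDensity x) := by
  refine Measure.pi_eq fun s hs => ?_
  have hind : ∀ i, Integrable ((s i).indicator (gaussianPDFReal 0 1)) :=
    fun i => (integrable_gaussianPDFReal 0 1).indicator (hs i)
  have h1 : (Set.univ.pi s).indicator (fun x => ENNReal.ofReal (gaussDensity x)) =
      fun x => ENNReal.ofReal (∏ i, (s i).indicator (gaussianPDFReal 0 1) (x i)) := by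
    ext x
    by_cases hx : x ∈ Set.univ.pi s
    · rw [Set.indicator_of_mem hx, gaussDensity_eq_prod]
      congr 1
      exact Finset.prod_congr rfl fun i _ => (Set.indicator_of_mem (hx i trivial) _).symm
    · rw [Set.indicator_of_notMem hx]
      simp only [Set.mem_pi, Set.mem_univ, true_implies, not_forall] at hx
      obtain ⟨i, hi⟩ := hx
      rw [Finset.prod_eq_zero (Finset.mem_univ i) (Set.indicator_of_notMem hi _),
        ENNReal.ofReal_zero]
  have hprod : Integrable (fun x : ι → ℝ => ∏ i, (s i).indicator (gaussianPDFReal 0 1) (x i)) :=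
    Integrable.fintype_prod hind
  rw [withDensity_apply _ (MeasurableSet.univ_pi hs),
    ← lintegral_indicator (MeasurableSet.univ_pi hs), h1,
    ← ofReal_integral_eq_lintegral_ofReal hprod
    (Filter.Eventually.of_forall fun x => Finset.prod_nonneg fun i _ =>
      Set.indicator_nonneg (fun y _ => gaussianPDFReal_nonneg 0 1 y) _),
    integral_fintype_prod_volume_eq_prod, ENNReal.ofReal_prod_of_nonneg]
  · refine Finset.prod_congr rfl fun i _ => ?_
    rw [integral_indicator (hs i), gaussianReal_apply_eq_integral _ one_ne_zero]
  · intro i _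
    exact integral_nonneg fun x => Set.indicator_nonneg (fun y _ => gaussianPDFReal_nonneg 0 1 y) _

theorem integrable_stdGauss_iff {f : (ι → ℝ) → ℝ} :
    Integrable f (stdGauss ι) ↔ Integrable fun x => gaussDensity x * f x := by
  rw [stdGauss_eq_withDensity, integrable_withDensity_iff_integrable_smul' (by
    exact continuous_gaussDensity.measurable.ennreal_ofReal) (by simp)]
  simp only [ENNReal.toReal_ofReal (gaussDensity_pos _).le, smul_eq_mul]

theorem integral_stdGauss (f : (ι → ℝ) → ℝ) :
    ∫ x, f x ∂stdGauss ι = ∫ x, gaussDensity x * f x := by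
  rw [stdGauss_eq_withDensity, integral_withDensity_eq_integral_toReal_smul (by
    exact continuous_gaussDensity.measurable.ennreal_ofReal) (by simp)]
  simp only [ENNReal.toReal_ofReal (gaussDensity_pos _).le, smul_eq_mul]

theorem memLp_eval_stdGauss (i : ι) (p : NNReal) : MemLp (fun x : ι → ℝ => x i) p (stdGauss ι) :=
  (memLp_id_gaussianReal (μ := 0) (v := 1) p).comp_measurePreserving
    (measurePreserving_eval (fun _ : ι => gaussianReal 0 1) i)

theorem integrable_eval_stdGauss (i : ι) : Integrable (fun x : ι → ℝ => x i) (stdGauss ι) :=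
  memLp_one_iff_integrable.1 (by simpa using memLp_eval_stdGauss i 1)

variable [DecidableEq ι]

theorem fderiv_gaussDensity (x : ι → ℝ) (i : ι) :
    fderiv ℝ gaussDensity x (Pi.single i 1) = -(gaussDensity x * x i) := by
  have h : HasFDerivAt (fun x : ι → ℝ => ∑ j, x j ^ 2)
      (∑ j, (2 * x j) • ContinuousLinearMap.proj (R := ℝ) (φ := fun _ : ι => ℝ) j) x := by
    refine HasFDerivAt.fun_sum fun j _ => ?_
    simpa using (hasFDerivAt_apply (𝕜 := ℝ) j x).pow 2
  have h2 : HasFDerivAt (gaussDensity : (ι → ℝ) → ℝ) _ x :=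
    ((h.neg.mul_const (2⁻¹ : ℝ)).exp).const_mul
      (((Real.sqrt (2 * Real.pi))⁻¹) ^ Fintype.card ι)
  rw [h2.fderiv]
  simp [gaussDensity, Pi.single_apply, div_eq_mul_inv]
  ring

/-- Stein's identity for a bounded function with bounded derivative. -/
theorem integral_fderiv_stdGauss {f : (ι → ℝ) → ℝ} (hf : Differentiable ℝ f) {C D : ℝ}
    (hC : ∀ x, |f x| ≤ C) (hD : ∀ x, ‖fderiv ℝ f x‖ ≤ D) (i : ι) :
    Integrable (fun x => fderiv ℝ f x (Pi.single i 1)) (stdGauss ι) ∧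
    Integrable (fun x => f x * x i) (stdGauss ι) ∧
    ∫ x, fderiv ℝ f x (Pi.single i 1) ∂stdGauss ι = ∫ x, f x * x i ∂stdGauss ι := by
  have i1 : Integrable (fun x => fderiv ℝ f x (Pi.single i 1)) (stdGauss ι) := by
    refine Integrable.of_bound (measurable_fderiv_apply_const ℝ f _).aestronglyMeasurable
      (D * ‖(Pi.single i 1 : ι → ℝ)‖) (Filter.Eventually.of_forall fun x => ?_)
    exact (ContinuousLinearMap.le_opNorm _ _).trans (by gcongr; exact hD x)
  have i2 : Integrable (fun x => f x * x i) (stdGauss ι) :=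
    (integrable_eval_stdGauss i).bdd_mul hf.continuous.aestronglyMeasurable
      (Filter.Eventually.of_forall hC)
  have i3 : Integrable f (stdGauss ι) :=
    Integrable.of_bound hf.continuous.aestronglyMeasurable C (Filter.Eventually.of_forall hC)
  refine ⟨i1, i2, ?_⟩
  have hg : Differentiable ℝ (gaussDensity : (ι → ℝ) → ℝ) := by
    unfold gaussDensity
    fun_prop
  have key := integral_mul_fderiv_eq_neg_fderiv_mul_of_integrable (μ := volume) (f := f)
    (g := (gaussDensity : (ι → ℝ) → ℝ)) (v := Pi.single i 1)
    (by simpa only [mul_comm] using integrable_stdGauss_iff.1 i1)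
    (by
      simp only [fderiv_gaussDensity]
      refine (integrable_stdGauss_iff.1 i2).neg.congr (Filter.Eventually.of_forall fun x => ?_)
      simp only [Pi.neg_apply]
      ring)
    (by simpa only [mul_comm] using integrable_stdGauss_iff.1 i3)
    (fun x _ => hf x) (fun x _ => hg x)
  rw [integral_stdGauss, integral_stdGauss]
  have e1 : ∫ x, f x * fderiv ℝ gaussDensity x (Pi.single i 1) =
      -∫ x, gaussDensity x * (f x * x i) := by
    rw [← integral_neg]
    refine integral_congr_ae (Filter.Eventually.of_forall fun x => ?_)
    simp only [fderiv_gaussDensity]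
    ring
  rw [e1, neg_inj] at key
  rw [key]
  simp only [mul_comm]

/-- The function `f` is differentiable on `O`, with derivative bounded on compact subsets. The
derivative need not be continuous, because that of `r` is only assumed bounded. -/
structure LocBddDeriv {E : Type*} [NormedAddCommGroup E] [NormedSpace ℝ E] (f : E → ℝ) (O : Set E) :
    Prop where
  diff : ∀ x ∈ O, DifferentiableAt ℝ f x
  bdd : ∀ K ⊆ O, IsCompact K → ∃ C, ∀ x ∈ K, ‖fderiv ℝ f x‖ ≤ C

section LocBddDeriv

variable {E : Type*} [NormedAddCommGroup E] [NormedSpace ℝ E] {f g : E → ℝ} {O : Set E}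

theorem LocBddDeriv.exists_bound (hf : LocBddDeriv f O) {K : Set E} (hK : IsCompact K)
    (hKO : K ⊆ O) : ∃ C, ∀ x ∈ K, ‖f x‖ ≤ C :=
  hK.exists_bound_of_continuousOn fun x hx =>
    (hf.diff x (hKO hx)).continuousAt.continuousWithinAt

theorem LocBddDeriv.mul (hf : LocBddDeriv f O) (hg : LocBddDeriv g O) :
    LocBddDeriv (fun x => f x * g x) O := by
  refine ⟨fun x hx => (hf.diff x hx).mul (hg.diff x hx), fun K hKO hK => ?_⟩
  obtain ⟨Cf, hCf⟩ := hf.exists_bound hK hKO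
  obtain ⟨Cg, hCg⟩ := hg.exists_bound hK hKO
  obtain ⟨Df, hDf⟩ := hf.bdd K hKO hK
  obtain ⟨Dg, hDg⟩ := hg.bdd K hKO hK
  refine ⟨Cf * Dg + Cg * Df, fun x hx => ?_⟩
  rw [fderiv_fun_mul (hf.diff x (hKO hx)) (hg.diff x (hKO hx))]
  refine (norm_add_le _ _).trans ?_
  rw [norm_smul, norm_smul]
  gcongr
  · exact (norm_nonneg _).trans (hCf x hx)
  · exact hCf x hx
  · exact hDg x hx
  · exact (norm_nonneg _).trans (hCg x hx)
  · exact hCg x hx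
  · exact hDf x hx

theorem LocBddDeriv.of_contDiffAt (hf : ∀ x ∈ O, ContDiffAt ℝ 1 f x) : LocBddDeriv f O := by
  refine ⟨fun x hx => (hf x hx).differentiableAt one_ne_zero, fun K hKO hK => ?_⟩
  refine hK.exists_bound_of_continuousOn fun x hx => ?_
  exact ((hf x (hKO hx)).continuousAt_fderiv one_ne_zero).continuousWithinAt

theorem LocBddDeriv.comp {h : ℝ → ℝ} {C : ℝ} (hh : Differentiable ℝ h) (hC : ∀ x, |deriv h x| ≤ C)
    (hf : LocBddDeriv f O) : LocBddDeriv (fun x => h (f x)) O := by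
  refine ⟨fun x hx => (hh _).comp x (hf.diff x hx), fun K hKO hK => ?_⟩
  obtain ⟨Df, hDf⟩ := hf.bdd K hKO hK
  refine ⟨C * Df, fun x hx => ?_⟩
  have h1 : HasFDerivAt (fun x => h (f x)) (deriv h (f x) • fderiv ℝ f x) x :=
    (hh (f x)).hasDerivAt.comp_hasFDerivAt x (hf.diff x (hKO hx)).hasFDerivAt
  rw [h1.fderiv, norm_smul]
  gcongr
  · exact (abs_nonneg _).trans (hC 0)
  · exact hC _
  · exact hDf x hx

/-- Extension by zero of a function on an open set that vanishes off a compact subset. -/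
theorem LocBddDeriv.indicator (hO : IsOpen O) (hf : LocBddDeriv f O) {K : Set E} (hK : IsCompact K)
    (hKO : K ⊆ O) (h0 : ∀ x ∈ O, x ∉ K → f x = 0) :
    Differentiable ℝ (O.indicator f) ∧ (∃ C, ∀ x, |O.indicator f x| ≤ C) ∧
      (∃ D, ∀ x, ‖fderiv ℝ (O.indicator f) x‖ ≤ D) ∧
      ∀ x ∈ O, fderiv ℝ (O.indicator f) x = fderiv ℝ f x := by
  have hon : ∀ x ∈ O, O.indicator f =ᶠ[nhds x] f := fun x hx =>
    (hO.eventually_mem hx).mono fun y hy => Set.indicator_of_mem hy f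
  have hoff : ∀ x ∉ K, O.indicator f =ᶠ[nhds x] fun _ => 0 := fun x hx =>
    (hK.isClosed.isOpen_compl.eventually_mem hx).mono fun y hy => by
      by_cases hyO : y ∈ O
      · rw [Set.indicator_of_mem hyO, h0 y hyO hy]
      · rw [Set.indicator_of_notMem hyO]
  obtain ⟨C, hC⟩ := hf.exists_bound hK hKO
  obtain ⟨D, hD⟩ := hf.bdd K hKO hK
  refine ⟨fun x => ?_, ⟨max C 0, fun x => ?_⟩, ⟨max D 0, fun x => ?_⟩, fun x hx =>
    (hon x hx).fderiv_eq⟩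
  · by_cases hx : x ∈ K
    · exact (hf.diff x (hKO hx)).congr_of_eventuallyEq (hon x (hKO hx))
    · exact (differentiableAt_const _).congr_of_eventuallyEq (hoff x hx)
  · by_cases hx : x ∈ K
    · rw [(hon x (hKO hx)).eq_of_nhds]
      exact (hC x hx).trans (le_max_left _ _)
    · rw [(hoff x hx).eq_of_nhds, abs_zero]
      exact le_max_right _ _
  · by_cases hx : x ∈ K
    · rw [(hon x (hKO hx)).fderiv_eq]
      exact (hD x hx).trans (le_max_left _ _)
    · rw [(hoff x hx).fderiv_eq, fderiv_fun_const]
      simp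

end LocBddDeriv

/-- A smooth cutoff of the half-line: `1` on `(-∞, 1]` and `0` on `[2, ∞)`. -/
noncomputable def cutoff (s : ℝ) : ℝ := Real.smoothTransition (2 - s)

theorem contDiff_cutoff : ContDiff ℝ 1 cutoff :=
  Real.smoothTransition.contDiff.comp (contDiff_const.sub contDiff_id)

theorem abs_cutoff_le (s : ℝ) : |cutoff s| ≤ 1 := by
  rw [cutoff, abs_of_nonneg (Real.smoothTransition.nonneg _)]
  exact Real.smoothTransition.le_one _

theorem cutoff_of_le {s : ℝ} (h : s ≤ 1) : cutoff s = 1 :=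
  Real.smoothTransition.one_of_one_le (by linarith)

theorem cutoff_of_ge {s : ℝ} (h : 2 ≤ s) : cutoff s = 0 :=
  Real.smoothTransition.zero_of_nonpos (by linarith)

theorem deriv_cutoff_of_lt {s : ℝ} (h : s < 1) : deriv cutoff s = 0 := by
  have : cutoff =ᶠ[nhds s] fun _ => 1 := (eventually_lt_nhds h).mono fun t ht => cutoff_of_le ht.le
  rw [this.deriv_eq, deriv_const]

theorem deriv_cutoff_of_gt {s : ℝ} (h : 2 < s) : deriv cutoff s = 0 := by
  have : cutoff =ᶠ[nhds s] fun _ => 0 := (eventually_gt_nhds h).mono fun t ht => cutoff_of_ge ht.le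
  rw [this.deriv_eq, deriv_const]

theorem exists_abs_deriv_cutoff_le : ∃ C, 0 ≤ C ∧ ∀ s, |deriv cutoff s| ≤ C := by
  obtain ⟨C, hC⟩ := (isCompact_Icc (a := (1 : ℝ)) (b := 2)).exists_bound_of_continuousOn
    (contDiff_cutoff.continuous_deriv le_rfl).continuousOn
  have h0 : 0 ≤ C := (norm_nonneg _).trans (hC 1 (by norm_num))
  refine ⟨C, h0, fun s => ?_⟩
  rcases lt_or_ge s 1 with h | h
  · rwa [deriv_cutoff_of_lt h, abs_zero]
  rcases lt_or_ge 2 s with h' | h'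
  · rwa [deriv_cutoff_of_gt h', abs_zero]
  · exact hC s ⟨h, h'⟩

/-- Stein's identity for a vector field `V` that is singular off an open set `O` of full measure.
The singularities are cut off by means of an exhaustion `τ` of `O`, and they do not contribute
because `τ` grows at most linearly along `V`, up to integrable factors. -/
theorem integral_divergence_stdGauss {O : Set (ι → ℝ)} (hO : IsOpen O)
    {V : ι → (ι → ℝ) → ℝ} (hV : ∀ i, LocBddDeriv (V i) O) {τ : (ι → ℝ) → ℝ} (hτ : LocBddDeriv τ O)
    (hK : ∀ c, IsCompact {x | x ∈ O ∧ τ x ≤ c})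
    (hae : ∀ᵐ x ∂stdGauss ι, x ∈ O) {G₁ G₂ : (ι → ℝ) → ℝ} (hG₁ : Integrable G₁ (stdGauss ι))
    (hG₂ : Integrable G₂ (stdGauss ι)) (hG₁0 : ∀ x ∈ O, 0 ≤ G₁ x) (hG₂0 : ∀ x ∈ O, 0 ≤ G₂ x)
    (hdrift : ∀ x ∈ O, |fderiv ℝ τ x fun i => V i x| ≤ G₁ x + G₂ x * τ x)
    (hVx : Integrable (fun x => ∑ i, V i x * x i) (stdGauss ι))
    (hdiv : Integrable (fun x => ∑ i, fderiv ℝ (V i) x (Pi.single i 1)) (stdGauss ι)) :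
    ∫ x, ∑ i, V i x * x i ∂stdGauss ι =
      ∫ x, ∑ i, fderiv ℝ (V i) x (Pi.single i 1) ∂stdGauss ι := by
  obtain ⟨C, hC0, hC⟩ := exists_abs_deriv_cutoff_le
  -- the truncated fields
  let χ : ℕ → (ι → ℝ) → ℝ := fun L x => cutoff (τ x * (L + 1 : ℝ)⁻¹)
  let f : ℕ → ι → (ι → ℝ) → ℝ := fun L i => O.indicator fun x => χ L x * V i x
  have hτL : ∀ L : ℕ, LocBddDeriv (fun x => τ x * (L + 1 : ℝ)⁻¹) O := fun L =>
    hτ.mul (LocBddDeriv.of_contDiffAt fun x _ => contDiffAt_const)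
  have hχ : ∀ L, LocBddDeriv (χ L) O := fun L =>
    LocBddDeriv.comp (contDiff_cutoff.differentiable one_ne_zero) hC (hτL L)
  have hχd : ∀ L, ∀ x ∈ O, ∀ v, fderiv ℝ (χ L) x v =
      deriv cutoff (τ x * (L + 1 : ℝ)⁻¹) * (L + 1 : ℝ)⁻¹ * fderiv ℝ τ x v := by
    intro L x hx v
    have h1 : HasFDerivAt (χ L) (deriv cutoff (τ x * (L + 1 : ℝ)⁻¹) •
        ((L + 1 : ℝ)⁻¹ • fderiv ℝ τ x)) x :=
      (contDiff_cutoff.differentiable one_ne_zero _).hasDerivAt.comp_hasFDerivAt x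
        ((hτ.diff x hx).hasFDerivAt.mul_const _)
    rw [h1.fderiv]
    simp [mul_assoc]
  have hind := fun L i => ((hχ L).mul (hV i)).indicator hO (hK (2 * (L + 1))) (fun x hx => hx.1)
    (fun x hx hxK => by
      have : 2 * (L + 1 : ℝ) < τ x := lt_of_not_ge fun h => hxK ⟨hx, h⟩
      have hc : χ L x = 0 := cutoff_of_ge (by
        rw [← div_eq_mul_inv, le_div_iff₀ (by positivity)]
        exact this.le)
      rw [hc, zero_mul])
  have hstein : ∀ L i, Integrable (fun x => fderiv ℝ (f L i) x (Pi.single i 1)) (stdGauss ι) ∧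
      Integrable (fun x => f L i x * x i) (stdGauss ι) ∧
      ∫ x, fderiv ℝ (f L i) x (Pi.single i 1) ∂stdGauss ι = ∫ x, f L i x * x i ∂stdGauss ι := by
    intro L i
    obtain ⟨hd, ⟨c, hc⟩, ⟨d, hd'⟩, -⟩ := hind L i
    exact integral_fderiv_stdGauss hd hc hd' i
  have heq : ∀ L, ∫ x, ∑ i, f L i x * x i ∂stdGauss ι =
      ∫ x, ∑ i, fderiv ℝ (f L i) x (Pi.single i 1) ∂stdGauss ι := by
    intro L
    rw [integral_finsetSum _ fun i _ => (hstein L i).2.1,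
      integral_finsetSum _ fun i _ => (hstein L i).1]
    exact Finset.sum_congr rfl fun i _ => (hstein L i).2.2.symm
  have hleft : ∀ L, ∀ x ∈ O, ∑ i, f L i x * x i = χ L x * ∑ i, V i x * x i := by
    intro L x hx
    rw [Finset.mul_sum]
    refine Finset.sum_congr rfl fun i _ => ?_
    simp only [f, Set.indicator_of_mem hx, mul_assoc]
  have hright : ∀ L, ∀ x ∈ O, ∑ i, fderiv ℝ (f L i) x (Pi.single i 1) =
      χ L x * ∑ i, fderiv ℝ (V i) x (Pi.single i 1) +
        deriv cutoff (τ x * (L + 1 : ℝ)⁻¹) * (L + 1 : ℝ)⁻¹ * fderiv ℝ τ x fun i => V i x := by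
    intro L x hx
    have h1 : (fun i => V i x) = ∑ i, V i x • (Pi.single i 1 : ι → ℝ) := by
      ext j
      simp [Finset.sum_apply, Pi.single_apply]
    rw [h1, map_sum, Finset.mul_sum, Finset.mul_sum, ← Finset.sum_add_distrib]
    refine Finset.sum_congr rfl fun i _ => ?_
    rw [(hind L i).2.2.2 x hx, fderiv_fun_mul ((hχ L).diff x hx) ((hV i).diff x hx)]
    simp only [_root_.add_apply, _root_.smul_apply, smul_eq_mul, map_smul,
      hχd L x hx]
    ring
  -- for each point of `O` the truncation is eventually inactive
  have hev : ∀ x, ∀ᶠ L : ℕ in Filter.atTop, τ x * (L + 1 : ℝ)⁻¹ < 1 := by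
    intro x
    filter_upwards [Filter.eventually_gt_atTop ⌈τ x⌉₊] with L hL
    rw [← div_eq_mul_inv, div_lt_one (by positivity)]
    calc τ x ≤ ⌈τ x⌉₊ := Nat.le_ceil _
      _ < L := by exact_mod_cast hL
      _ < L + 1 := by linarith
  have t1 : Filter.Tendsto (fun L => ∫ x, ∑ i, f L i x * x i ∂stdGauss ι) Filter.atTop
      (nhds (∫ x, ∑ i, V i x * x i ∂stdGauss ι)) := by
    refine tendsto_integral_of_dominated_convergence (fun x => |∑ i, V i x * x i|)
      (fun L => (integrable_finsetSum _ fun i _ => (hstein L i).2.1).aestronglyMeasurable)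
      hVx.abs (fun L => ?_) ?_
    · filter_upwards [hae] with x hx
      rw [hleft L x hx, Real.norm_eq_abs, abs_mul]
      exact mul_le_of_le_one_left (abs_nonneg _) (abs_cutoff_le _)
    · filter_upwards [hae] with x hx
      refine tendsto_const_nhds.congr' ?_
      filter_upwards [hev x] with L hL
      rw [hleft L x hx]
      simp only [χ, cutoff_of_le hL.le, one_mul]
  have t2 : Filter.Tendsto (fun L => ∫ x, ∑ i, fderiv ℝ (f L i) x (Pi.single i 1) ∂stdGauss ι)
      Filter.atTop (nhds (∫ x, ∑ i, fderiv ℝ (V i) x (Pi.single i 1) ∂stdGauss ι)) := by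
    refine tendsto_integral_of_dominated_convergence
      (fun x => |∑ i, fderiv ℝ (V i) x (Pi.single i 1)| + (C * G₁ x + C * 2 * G₂ x))
      (fun L => (integrable_finsetSum _ fun i _ => (hstein L i).1).aestronglyMeasurable)
      (hdiv.abs.add ((hG₁.const_mul C).add (hG₂.const_mul (C * 2)))) (fun L => ?_) ?_
    · filter_upwards [hae] with x hx
      rw [hright L x hx, Real.norm_eq_abs]
      refine (abs_add_le _ _).trans (add_le_add ?_ ?_)
      · rw [abs_mul]
        exact mul_le_of_le_one_left (abs_nonneg _) (abs_cutoff_le _)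
      · have hL0 : (0 : ℝ) < (L + 1 : ℝ)⁻¹ := by positivity
        have hL1 : (L + 1 : ℝ)⁻¹ ≤ 1 := inv_le_one_of_one_le₀ (by linarith [L.cast_nonneg (α := ℝ)])
        have b1 := hG₁0 x hx
        have b2 := hG₂0 x hx
        rcases lt_or_ge 2 (τ x * (L + 1 : ℝ)⁻¹) with h2 | h2
        · rw [deriv_cutoff_of_gt h2, zero_mul, zero_mul, abs_zero]
          positivity
        · rw [abs_mul, abs_mul, abs_of_pos hL0, mul_assoc]
          calc |deriv cutoff (τ x * (L + 1 : ℝ)⁻¹)| *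
                ((L + 1 : ℝ)⁻¹ * |fderiv ℝ τ x fun i => V i x|)
              ≤ C * ((L + 1 : ℝ)⁻¹ * (G₁ x + G₂ x * τ x)) := by
                gcongr
                · exact hC _
                · exact hdrift x hx
            _ = C * ((L + 1 : ℝ)⁻¹ * G₁ x + G₂ x * (τ x * (L + 1 : ℝ)⁻¹)) := by ring
            _ ≤ C * (1 * G₁ x + G₂ x * 2) := by gcongr
            _ = _ := by ring
    · filter_upwards [hae] with x hx
      refine tendsto_const_nhds.congr' ?_
      filter_upwards [hev x] with L hL
      rw [hright L x hx, deriv_cutoff_of_lt hL]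
      simp only [χ, cutoff_of_le hL.le, one_mul, zero_mul, add_zero]
  exact tendsto_nhds_unique (t1.congr heq) t2

end Stein

/-! ### The inverse moment of `F` -/

section InverseMoment

theorem integrable_abs_rpow_mul_exp {k s : ℝ} (hk : 0 < k) (hs : -1 < s) :
    Integrable fun x : ℝ => |x| ^ s * Real.exp (-k * x ^ 2) := by
  have hIoi : IntegrableOn (fun x : ℝ => |x| ^ s * Real.exp (-k * x ^ 2)) (Set.Ioi 0) :=
    (integrableOn_rpow_mul_exp_neg_mul_sq hk hs).congr_fun
      (fun x hx => by simp only [abs_of_pos (Set.mem_Ioi.1 hx)]) measurableSet_Ioi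
  rw [← integrableOn_univ, ← Set.Iio_union_Ici (a := (0 : ℝ)), integrableOn_union,
    integrableOn_Ici_iff_integrableOn_Ioi]
  refine ⟨?_, hIoi⟩
  rw [← (Measure.measurePreserving_neg (volume : Measure ℝ)).integrableOn_comp_preimage
      (Homeomorph.neg ℝ).measurableEmbedding]
  simpa only [Function.comp_def, neg_sq, abs_neg, Set.neg_preimage, Set.neg_Iio, neg_zero]
    using hIoi

variable {ι : Type*} [Fintype ι] [DecidableEq ι]

/-- In three coordinates the inverse square is dominated by the product of the inverse two-thirds
powers, so that it is integrable against a Gaussian weight by Fubini's theorem. -/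
theorem exists_lintegral_inv_sum_sq_le {k : ℝ} (hk : 0 < k) :
    ∃ C : ENNReal, C ≠ ⊤ ∧ ∀ I : Finset ι, I.card = 3 →
      ∫⁻ y : ι → ℝ, (ENNReal.ofReal (∑ i ∈ I, y i ^ 2))⁻¹ *
        ENNReal.ofReal (Real.exp (-k * ∑ i, y i ^ 2)) ≤ C := by
  let s : Finset ι → ι → ℝ := fun I i => if i ∈ I then -(2 / 3) else 0
  have hs : ∀ I i, -1 < s I i := by
    intro I i
    simp only [s]
    split_ifs <;> norm_num
  let φ : Finset ι → ι → ℝ → ℝ := fun I i t => |t| ^ s I i * Real.exp (-k * t ^ 2)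
  have hφ0 : ∀ I i t, 0 ≤ φ I i t := fun I i t => by positivity
  refine ⟨∑ I : Finset ι, ENNReal.ofReal (∫ y : ι → ℝ, ∏ i, φ I i (y i)), ?_, fun I hI => ?_⟩
  · exact ENNReal.sum_ne_top.2 fun I _ => ENNReal.ofReal_ne_top
  have hint : Integrable (fun y : ι → ℝ => ∏ i, φ I i (y i)) :=
    Integrable.fintype_prod fun i => integrable_abs_rpow_mul_exp hk (hs I i)
  refine le_trans ?_ (Finset.single_le_sum (f := fun I => ENNReal.ofReal
    (∫ y : ι → ℝ, ∏ i, φ I i (y i))) (fun _ _ => zero_le) (Finset.mem_univ I))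
  rw [ofReal_integral_eq_lintegral_ofReal hint
    (Filter.Eventually.of_forall fun y => Finset.prod_nonneg fun i _ => hφ0 I i _)]
  have hne : ∀ᵐ y : ι → ℝ, ∀ i, y i ≠ 0 :=
    ae_all_iff.2 fun i => Measure.ae_eval_ne (fun _ : ι => (volume : Measure ℝ)) i 0
  refine lintegral_mono_ae (hne.mono fun y hy => ?_)
  have hIne : I.Nonempty := Finset.card_pos.1 (by omega)
  have hpos : 0 < ∑ i ∈ I, y i ^ 2 := Finset.sum_pos (fun i _ => by
    have := hy i
    positivity) hIne
  rw [← ENNReal.ofReal_inv_of_pos hpos, ← ENNReal.ofReal_mul (by positivity)]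
  refine ENNReal.ofReal_le_ofReal ?_
  simp only [φ, Finset.prod_mul_distrib, ← Real.exp_sum, ← Finset.mul_sum]
  gcongr
  have h1 : ∏ i, |y i| ^ s I i = (∏ i ∈ I, |y i| ^ (2 / 3 : ℝ))⁻¹ := by
    rw [← Finset.prod_inv_distrib, ← Finset.prod_subset (Finset.subset_univ I)]
    · refine Finset.prod_congr rfl fun i hi => ?_
      simp only [s, if_pos hi]
      rw [Real.rpow_neg (abs_nonneg _)]
    · intro i _ hi
      simp only [s, if_neg hi, Real.rpow_zero]
  rw [h1]
  have h2 : 0 < ∏ i ∈ I, |y i| ^ (2 / 3 : ℝ) := Finset.prod_pos fun i _ => by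
    have := abs_pos.2 (hy i)
    positivity
  refine inv_anti₀ h2 ?_
  calc ∏ i ∈ I, |y i| ^ (2 / 3 : ℝ) ≤ ∏ _i ∈ I, (∑ i ∈ I, y i ^ 2) ^ (1 / 3 : ℝ) := by
        refine Finset.prod_le_prod (fun i _ => by positivity) fun i hi => ?_
        have e : |y i| ^ (2 / 3 : ℝ) = (y i ^ 2) ^ (1 / 3 : ℝ) := by
          rw [← sq_abs, ← Real.rpow_natCast, ← Real.rpow_mul (abs_nonneg _)]
          norm_num
        rw [e]
        gcongr
        exact Finset.single_le_sum (f := fun i => y i ^ 2) (fun i _ => sq_nonneg _) hi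
    _ = ∑ i ∈ I, y i ^ 2 := by
        rw [Finset.prod_const, hI, ← Real.rpow_natCast, ← Real.rpow_mul hpos.le]
        norm_num

/-- An affine image of the standard Gaussian measure whose density is dominated by a multiple of
`exp (-k |y|²)`. -/
theorem lintegral_affine_stdGauss_le {B : Matrix ι ι ℝ} (hB : B.det ≠ 0) (b : ι → ℝ) {k K : ℝ}
    (hK : ∀ w : ι → ℝ, gaussDensity w ≤ K * Real.exp (-k * ∑ i, (B *ᵥ w + b) i ^ 2))
    {f : (ι → ℝ) → ENNReal} (hf : Measurable f) :
    ∫⁻ w, f (B *ᵥ w + b) ∂stdGauss ι ≤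
      ENNReal.ofReal |B.det⁻¹| * (ENNReal.ofReal K *
        ∫⁻ y, f y * ENNReal.ofReal (Real.exp (-k * ∑ i, y i ^ 2))) := by
  have hK0 : 0 ≤ K := by
    have h := (gaussDensity_pos (0 : ι → ℝ)).le.trans (hK 0)
    exact nonneg_of_mul_nonneg_left h (Real.exp_pos _)
  let h : (ι → ℝ) → ENNReal := fun y =>
    ENNReal.ofReal K * (f y * ENNReal.ofReal (Real.exp (-k * ∑ i, y i ^ 2)))
  have hm : Measurable h := by
    refine measurable_const.mul (hf.mul (Measurable.ennreal_ofReal ?_))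
    fun_prop
  have hBm : Measurable (Matrix.toLin' B) :=
    (Matrix.toLin' B).continuous_of_finiteDimensional.measurable
  rw [stdGauss_eq_withDensity, lintegral_withDensity_eq_lintegral_mul _
    (continuous_gaussDensity.measurable.ennreal_ofReal) (by
      exact hf.comp ((hBm.add_const b) : Measurable fun w => Matrix.toLin' B w + b))]
  calc ∫⁻ w, ENNReal.ofReal (gaussDensity w) * f (B *ᵥ w + b)
      ≤ ∫⁻ w, h (Matrix.toLin' B w + b) := by
        refine lintegral_mono fun w => ?_
        simp only [h, Matrix.toLin'_apply]
        rw [mul_comm (f _), ← mul_assoc, ← ENNReal.ofReal_mul hK0]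
        gcongr
        exact hK w
    _ = ∫⁻ y, h (y + b) ∂(Measure.map (Matrix.toLin' B) volume) :=
        (lintegral_map (hm.comp (measurable_add_const b)) hBm).symm
    _ = ENNReal.ofReal |B.det⁻¹| * ∫⁻ y, h y := by
        rw [Real.map_matrix_volume_pi_eq_smul_volume_pi hB, lintegral_smul_measure,
          lintegral_add_right_eq_self, smul_eq_mul]
    _ = _ := by
        simp only [h]
        rw [lintegral_const_mul' _ _ ENNReal.ofReal_ne_top]

end InverseMoment

section Spectral

variable {p q : ℕ}

/-- Spectral lower bound for `F`: in the eigenbasis `U` of `S`, the statistic `F` dominates the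
squares of the coordinates of `X` in the range of `S`, and at least three are available. -/
theorem exists_sum_sq_le_trace_mul_statF {S : Matrix (Fin p) (Fin p) ℝ} (hS : S.PosSemidef)
    (hrank : 2 < q * S.rank) :
    ∃ U : Matrix (Fin p) (Fin p) ℝ, Uᵀ * U = 1 ∧ ∃ I : Finset (Fin q × Fin p), I.card = 3 ∧
      0 < S.trace ∧ ∀ X : Matrix (Fin p) (Fin q) ℝ,
        ∑ x ∈ I, (Uᵀ * X).vec x ^ 2 ≤ S.trace * statF X S := by
  classical
  have hH : S.IsHermitian := hS.isHermitian
  set U : Matrix (Fin p) (Fin p) ℝ := (hH.eigenvectorUnitary : Matrix (Fin p) (Fin p) ℝ) with hU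
  set l := hH.eigenvalues with hl
  have hl0 : ∀ i, 0 ≤ l i := hS.eigenvalues_nonneg
  have hUU : Uᵀ * U = 1 := by
    have := Unitary.coe_star_mul_self hH.eigenvectorUnitary
    rwa [Matrix.star_eq_conjTranspose, Matrix.conjTranspose_eq_transpose_of_trivial] at this
  have hsp : S = U * Matrix.diagonal l * Uᵀ := by
    have := hH.spectral_theorem
    rw [Unitary.conjStarAlgAut_apply, Matrix.star_eq_conjTranspose,
      Matrix.conjTranspose_eq_transpose_of_trivial] at this
    exact this
  have hmul : ∀ v w : Fin p → ℝ, (U * Matrix.diagonal v * Uᵀ) * (U * Matrix.diagonal w * Uᵀ)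
      = U * Matrix.diagonal (fun i => v i * w i) * Uᵀ := by
    intro v w
    calc _ = U * Matrix.diagonal v * (Uᵀ * U) * Matrix.diagonal w * Uᵀ := by
          simp only [Matrix.mul_assoc]
      _ = _ := by rw [hUU, Matrix.mul_one, Matrix.mul_assoc U, Matrix.diagonal_mul_diagonal]
  have hsymm : ∀ v : Fin p → ℝ, (U * Matrix.diagonal v * Uᵀ)ᵀ = U * Matrix.diagonal v * Uᵀ := by
    intro v
    simp [Matrix.transpose_mul, Matrix.mul_assoc]
  have hpinv : pinv S = U * Matrix.diagonal (fun i => (l i)⁻¹) * Uᵀ := by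
    refine IsMoorePenrose.pinv_eq ⟨?_, ?_, ?_, ?_⟩
    · rw [hsp, hmul, hmul]; congr; ext i; by_cases h : l i = 0 <;> simp [h]
    · rw [hsp, hmul, hmul]; congr; ext i; by_cases h : l i = 0 <;> simp [h]
    · rw [hsp, hmul, hsymm]
    · rw [hsp, hmul, hsymm]
  have htr : S.trace = ∑ i, l i := by
    rw [hsp, Matrix.trace_mul_comm, ← Matrix.mul_assoc, hUU, Matrix.one_mul, Matrix.trace_diagonal]
  have hF : ∀ X : Matrix (Fin p) (Fin q) ℝ,
      statF X S = ∑ x : Fin q × Fin p, (l x.2)⁻¹ * (Uᵀ * X).vec x ^ 2 := by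
    intro X
    have : Xᵀ * pinv S * X =
        (Uᵀ * X)ᵀ * (Matrix.diagonal (fun i => (l i)⁻¹) * (Uᵀ * X)) := by
      rw [hpinv, Matrix.transpose_mul, Matrix.transpose_transpose]
      simp only [Matrix.mul_assoc]
    rw [statF, this, Matrix.trace, Fintype.sum_prod_type]
    refine Finset.sum_congr rfl fun j _ => ?_
    rw [Matrix.diag_apply, Matrix.mul_apply]
    refine Finset.sum_congr rfl fun i _ => ?_
    rw [Matrix.diagonal_mul, Matrix.transpose_apply, Matrix.vec]
    ring
  have hcard : 3 ≤ ((Finset.univ : Finset (Fin q)) ×ˢ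
      Finset.univ.filter fun i : Fin p => l i ≠ 0).card := by
    rw [Finset.card_product, Finset.card_univ, Fintype.card_fin]
    rw [hH.rank_eq_card_non_zero_eigs, Fintype.card_subtype] at hrank
    exact hrank
  obtain ⟨I, hI, hI3⟩ := Finset.exists_subset_card_eq hcard
  have hIl : ∀ x ∈ I, l x.2 ≠ 0 := fun x hx => by
    have := hI hx
    simpa using this
  have hpos : 0 < S.trace := by
    obtain ⟨x, hx⟩ : I.Nonempty := Finset.card_pos.1 (by omega)
    rw [htr]
    exact Finset.sum_pos' (fun i _ => hl0 i)
      ⟨x.2, Finset.mem_univ _, lt_of_le_of_ne (hl0 _) (hIl x hx).symm⟩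
  refine ⟨U, hUU, I, hI3, hpos, fun X => ?_⟩
  rw [hF, Finset.mul_sum]
  refine le_trans ?_ (Finset.sum_le_sum_of_subset_of_nonneg (Finset.subset_univ I) fun x _ _ => ?_)
  · refine Finset.sum_le_sum fun x hx => ?_
    have hlx : 0 < l x.2 := lt_of_le_of_ne (hl0 _) (hIl x hx).symm
    have : 1 ≤ S.trace * (l x.2)⁻¹ := by
      rw [← div_eq_mul_inv, one_le_div hlx, htr]
      exact Finset.single_le_sum (fun i _ => hl0 i) (Finset.mem_univ x.2)
    rw [← mul_assoc]
    exact le_mul_of_one_le_left (sq_nonneg _) this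
  · have := inv_nonneg.2 (hl0 x.2)
    positivity

/-- The inverse moment of `F` over `X`, for fixed `S`. The bound depends on `S` only through its
trace, so that it can be integrated over `S`. -/
theorem exists_lintegral_inv_statF_le (θ : Matrix (Fin p) (Fin q) ℝ) {A : Matrix (Fin p) (Fin p) ℝ}
    (hA : A.det ≠ 0) :
    ∃ C : ENNReal, C ≠ ⊤ ∧ ∀ S : Matrix (Fin p) (Fin p) ℝ, S.PosSemidef → 2 < q * S.rank →
      ∫⁻ w, (ENNReal.ofReal (statF (θ + A * unvec w) S))⁻¹ ∂stdGauss (Fin q × Fin p) ≤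
        ENNReal.ofReal S.trace * C := by
  set a := (Aᵀ * A).trace with ha
  have ha0 : 0 ≤ a := trace_transpose_mul_self_nonneg A
  set t := (θᵀ * θ).trace with ht
  set k : ℝ := (4 * (a + 1))⁻¹ with hk
  have hk0 : 0 < k := by positivity
  obtain ⟨C, hC, hCI⟩ := exists_lintegral_inv_sum_sq_le (ι := Fin q × Fin p) hk0
  set c : ℝ := ((Real.sqrt (2 * Real.pi))⁻¹) ^ Fintype.card (Fin q × Fin p) with hc
  have hc0 : 0 ≤ c := by positivity
  set K : ℝ := c * Real.exp (k * (2 * t)) with hKdef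
  refine ⟨ENNReal.ofReal |(A.det ^ q)⁻¹| * (ENNReal.ofReal K * C),
    ENNReal.mul_ne_top ENNReal.ofReal_ne_top (ENNReal.mul_ne_top ENNReal.ofReal_ne_top hC), ?_⟩
  intro S hS hrank
  obtain ⟨U, hUU, I, hI, htr, hle⟩ := exists_sum_sq_le_trace_mul_statF hS hrank
  set B : Matrix (Fin q × Fin p) (Fin q × Fin p) ℝ := (1 : Matrix (Fin q) (Fin q) ℝ) ⊗ₖ (Uᵀ * A)
    with hB
  set b := (Uᵀ * θ).vec with hb
  have hBw : ∀ w : Fin q × Fin p → ℝ, B *ᵥ w + b = (Uᵀ * (θ + A * unvec w)).vec := by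
    intro w
    rw [hB, ← vec_unvec w, Matrix.kronecker_mulVec_vec, unvec_vec, Matrix.transpose_one,
      Matrix.mul_one, hb, ← Matrix.vec_add, add_comm, Matrix.mul_add, Matrix.mul_assoc]
  have hdetU : |U.det| = 1 := by
    have := congrArg Matrix.det hUU
    rw [Matrix.det_mul, Matrix.det_transpose, Matrix.det_one] at this
    rcases mul_self_eq_one_iff.1 this with h | h <;> simp [h]
  have hBdet : |B.det⁻¹| = |(A.det ^ q)⁻¹| := by
    rw [hB, Matrix.det_kronecker, Matrix.det_one, one_pow, one_mul, Fintype.card_fin,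
      Matrix.det_mul, Matrix.det_transpose, abs_inv, abs_inv, abs_pow, abs_mul, hdetU, one_mul,
      abs_pow]
  have hBne : B.det ≠ 0 := by
    have : |(A.det ^ q)⁻¹| ≠ 0 := by positivity
    rw [← hBdet] at this
    simpa using this
  have hsq : ∀ M : Matrix (Fin p) (Fin q) ℝ, ∑ x, M.vec x ^ 2 = (Mᵀ * M).trace := by
    intro M
    rw [trace_transpose_mul_self, Fintype.sum_prod_type]
    rfl
  -- `|B w + b|² ≤ 2 t + 2 a |w|²`, and `4 (a + 1) k = 1`
  have hdom : ∀ w : Fin q × Fin p → ℝ,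
      gaussDensity w ≤ K * Real.exp (-k * ∑ i, (B *ᵥ w + b) i ^ 2) := by
    intro w
    have e1 : ∑ i, (B *ᵥ w + b) i ^ 2 ≤ 2 * t + 2 * (a * ∑ i, w i ^ 2) := by
      rw [hBw, hsq]
      have h1 : (Uᵀ * (θ + A * unvec w))ᵀ * (Uᵀ * (θ + A * unvec w)) =
          (θ + A * unvec w)ᵀ * (θ + A * unvec w) := by
        rw [Matrix.transpose_mul, Matrix.transpose_transpose, Matrix.mul_assoc,
          ← Matrix.mul_assoc U, mul_eq_one_comm.1 hUU, Matrix.one_mul]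
      have h2 := trace_mul_transpose_mul_le A (unvec w)
      rw [← hsq (unvec w), vec_unvec] at h2
      rw [h1]
      have h3 : ((θ + A * unvec w)ᵀ * (θ + A * unvec w)).trace ≤
          2 * t + 2 * ((A * unvec w)ᵀ * (A * unvec w)).trace := by
        rw [ht, ← hsq, ← hsq, ← hsq, Finset.mul_sum, Finset.mul_sum, ← Finset.sum_add_distrib]
        refine Finset.sum_le_sum fun x _ => ?_
        rw [Matrix.vec_add, Pi.add_apply]
        nlinarith [sq_nonneg (θ.vec x - (A * unvec w).vec x)]
      linarith
    rw [gaussDensity, ← hc, hKdef, mul_assoc, ← Real.exp_add]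
    gcongr
    have hs0 : 0 ≤ ∑ i, w i ^ 2 := by positivity
    have e2 : k * (2 * (a * ∑ i, w i ^ 2)) ≤ (∑ i, w i ^ 2) / 2 := by
      have : k * (4 * (a + 1)) = 1 := inv_mul_cancel₀ (by positivity)
      nlinarith [mul_nonneg hk0.le hs0]
    have e3 := mul_le_mul_of_nonneg_left e1 hk0.le
    linarith
  have hf : Measurable fun y : Fin q × Fin p → ℝ => (ENNReal.ofReal (∑ i ∈ I, y i ^ 2))⁻¹ := by
    fun_prop
  calc ∫⁻ w, (ENNReal.ofReal (statF (θ + A * unvec w) S))⁻¹ ∂stdGauss (Fin q × Fin p)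
      ≤ ∫⁻ w, ENNReal.ofReal S.trace *
          (ENNReal.ofReal (∑ i ∈ I, (B *ᵥ w + b) i ^ 2))⁻¹ ∂stdGauss (Fin q × Fin p) := by
        refine lintegral_mono fun w => ?_
        simp only
        rw [hBw]
        have h := ENNReal.ofReal_le_ofReal (hle (θ + A * unvec w))
        rw [ENNReal.ofReal_mul htr.le] at h
        have h0 : ENNReal.ofReal S.trace ≠ 0 := by simpa using htr
        have h' := ENNReal.inv_le_inv.2 h
        rw [ENNReal.mul_inv (Or.inl h0) (Or.inl ENNReal.ofReal_ne_top)] at h'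
        calc _ = ENNReal.ofReal S.trace * ((ENNReal.ofReal S.trace)⁻¹ *
              (ENNReal.ofReal (statF (θ + A * unvec w) S))⁻¹) := by
              rw [← mul_assoc, ENNReal.mul_inv_cancel h0 ENNReal.ofReal_ne_top, one_mul]
          _ ≤ _ := by gcongr
    _ = ENNReal.ofReal S.trace * ∫⁻ w, (ENNReal.ofReal (∑ i ∈ I, (B *ᵥ w + b) i ^ 2))⁻¹
          ∂stdGauss (Fin q × Fin p) := lintegral_const_mul' _ _ ENNReal.ofReal_ne_top
    _ ≤ ENNReal.ofReal S.trace * (ENNReal.ofReal |(A.det ^ q)⁻¹| * (ENNReal.ofReal K * C)) := by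
        gcongr
        refine (lintegral_affine_stdGauss_le hBne b hdom hf).trans ?_
        rw [hBdet]
        gcongr
        exact hCI I hI

end Spectral

/-! ### Stein's identity for the shrinkage field -/

section SteinField

variable {n p q : ℕ} {r : ℝ → ℝ} {A : Matrix (Fin p) (Fin p) ℝ} {X : Matrix (Fin p) (Fin q) ℝ}

/-- The vector `z` of all entries of `Ỹ` gives the matrix `Y`. -/
noncomputable def vecY (A : Matrix (Fin p) (Fin p) ℝ) (z : Fin p × Fin (n * q) → ℝ) :
    Matrix (Fin (n * q)) (Fin p) ℝ :=
  untildeY A (unvec z)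

/-- The regular set in terms of the vector of all entries. -/
def vecRegular (n : ℕ) (A : Matrix (Fin p) (Fin p) ℝ) (X : Matrix (Fin p) (Fin q) ℝ) :
    Set (Fin p × Fin (n * q) → ℝ) :=
  {z | unvec z ∈ regularSet A X}

@[fun_prop] theorem continuous_vecY : Continuous (vecY (n := n) (q := q) A) := by
  unfold vecY untildeY
  fun_prop

theorem contDiff_unvec_apply {m k : Type*} [Fintype m] [Fintype k] (i : m) (j : k) :
    ContDiff ℝ 1 fun z : k × m → ℝ => unvec z i j :=
  contDiff_apply ℝ ℝ (j, i)

theorem contDiff_vecY_apply (i : Fin (n * q)) (j : Fin p) :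
    ContDiff ℝ 1 fun z : Fin p × Fin (n * q) → ℝ => vecY A z i j := by
  simp only [vecY, untildeY, Matrix.smul_apply, Matrix.mul_apply, smul_eq_mul]
  exact contDiff_const.mul (ContDiff.sum fun x _ => (contDiff_unvec_apply i x).mul contDiff_const)

theorem contDiffAt_pinv_vecY {z : Fin p × Fin (n * q) → ℝ} (hz : FullRank (vecY A z)) (i : Fin p)
    (j : Fin (n * q)) : ContDiffAt ℝ 1 (fun z => pinv (vecY A z) i j) z :=
  contDiffAt_pinv_apply (fun i j => (contDiff_vecY_apply i j).contDiffAt) hz i j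

theorem contDiffAt_fieldMatrix_vecY {z : Fin p × Fin (n * q) → ℝ} (hz : FullRank (vecY A z))
    (i j : Fin (n * q)) : ContDiffAt ℝ 1 (fun z => fieldMatrix X (vecY A z) i j) z := by
  have h1 : ∀ i j, ContDiffAt ℝ 1 (fun z => pinvMul X (vecY A z) i j) z :=
    contDiffAt_mul_apply (f := fun z => (pinv (vecY A z))ᵀ) (g := fun _ => X)
      (fun i j => contDiffAt_pinv_vecY hz j i) fun _ _ => contDiffAt_const
  exact contDiffAt_mul_apply h1 (g := fun z => (pinvMul X (vecY A z))ᵀ) (fun i j => h1 j i) i j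

theorem contDiffAt_trace_fieldMatrix_vecY {z : Fin p × Fin (n * q) → ℝ}
    (hz : FullRank (vecY A z)) :
    ContDiffAt ℝ 1 (fun z => (fieldMatrix X (vecY A z)).trace) z :=
  ContDiffAt.sum fun i _ => contDiffAt_fieldMatrix_vecY hz i i

theorem isOpen_vecRegular : IsOpen (vecRegular n A X) := by
  rw [isOpen_iff_eventually]
  intro z hz
  have h1 : ∀ᶠ z in nhds z, FullRank (vecY (n := n) (q := q) A z) :=
    (isOpen_fullRank.preimage continuous_vecY).eventually_mem hz.1
  have h2 : ∀ᶠ z in nhds z, (fieldMatrix X (vecY (n := n) (q := q) A z)).trace ≠ 0 :=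
    (contDiffAt_trace_fieldMatrix_vecY hz.1).continuousAt.eventually_ne hz.2
  exact h1.and h2

theorem contDiffAt_exhaustion {z : Fin p × Fin (n * q) → ℝ} (hz : z ∈ vecRegular n A X) :
    ContDiffAt ℝ 1 (fun z => exhaustion A X (unvec z)) z := by
  refine ContDiffAt.add (ContDiffAt.add ?_ ?_) ?_
  · simp only [trace_transpose_mul_self]
    exact ContDiffAt.sum fun j _ => ContDiffAt.sum fun i _ =>
      (contDiff_unvec_apply i j).contDiffAt.pow 2
  · simp only [trace_transpose_mul_self]
    exact ContDiffAt.sum fun j _ => ContDiffAt.sum fun i _ => (contDiffAt_pinv_vecY hz.1 i j).pow 2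
  · exact (contDiffAt_trace_fieldMatrix_vecY hz.1).inv hz.2

theorem locBddDeriv_fieldYH (hq : q ≠ 0) (hA : IsUnit A.det) {c₂ : ℝ} (hr : Differentiable ℝ r)
    (hr' : ∀ x, |deriv r x| ≤ c₂) (i : Fin (n * q)) (j : Fin p) :
    LocBddDeriv (fun z => fieldYH r A X (unvec z) i j) (vecRegular n A X) := by
  have hF : LocBddDeriv (fun z => (fieldMatrix X (vecY (n := n) (q := q) A z)).trace)
      (vecRegular n A X) :=
    LocBddDeriv.of_contDiffAt fun z hz => contDiffAt_trace_fieldMatrix_vecY hz.1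
  have hrF := hF.comp hr hr'
  have hk : LocBddDeriv (fun z => ((fieldMatrix X (vecY (n := n) (q := q) A z)).trace ^ 2)⁻¹ *
      (fieldMatrix X (vecY A z) * unvec z) i j) (vecRegular n A X) := by
    refine LocBddDeriv.of_contDiffAt fun z hz => ContDiffAt.mul ?_ ?_
    · exact ((contDiffAt_trace_fieldMatrix_vecY hz.1).pow 2).inv (pow_ne_zero 2 hz.2)
    · exact contDiffAt_mul_apply (fun i j => contDiffAt_fieldMatrix_vecY hz.1 i j)
        (fun i j => (contDiff_unvec_apply i j).contDiffAt) i j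
  have h := (hrF.mul hrF).mul hk
  convert h using 2 with z
  rw [fieldYH_eq hq hA, Matrix.smul_apply, smul_eq_mul, vecY]
  ring

theorem exhaustion_eq (z : Fin p × Fin (n * q) → ℝ) :
    exhaustion A X (unvec z) = ((unvec z)ᵀ * unvec z).trace
      + ((pinv (vecY A z))ᵀ * pinv (vecY A z)).trace + (fieldMatrix X (vecY A z)).trace⁻¹ := rfl

/-- Compactness of the sublevel sets. Together with `Y`, its Moore-Penrose inverse `B` stays
bounded on a sublevel set, and the conditions defining the sublevel set are closed in `(Y, B)`. -/
theorem isCompact_sublevel_exhaustion (c : ℝ) :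
    IsCompact {z | z ∈ vecRegular n A X ∧ exhaustion A X (unvec z) ≤ c} := by
  let K : Set ((Fin p × Fin (n * q) → ℝ) × (Fin (n * q) × Fin p → ℝ)) :=
    {x | IsMoorePenrose (vecY A x.1) (unvec x.2)} ∩
    ({x | vecY A x.1 * unvec x.2 = 1} ∪ {x | unvec x.2 * vecY A x.1 = 1}) ∩
    {x | ((unvec x.1 : Matrix (Fin (n * q)) (Fin p) ℝ)ᵀ * unvec x.1).trace +
      ((unvec x.2 : Matrix (Fin p) (Fin (n * q)) ℝ)ᵀ * unvec x.2).trace ≤ c} ∩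
    {x | 1 ≤ (c - ((unvec x.1 : Matrix (Fin (n * q)) (Fin p) ℝ)ᵀ * unvec x.1).trace -
      ((unvec x.2 : Matrix (Fin p) (Fin (n * q)) ℝ)ᵀ * unvec x.2).trace) *
      ((unvec x.2)ᵀ * X * ((unvec x.2)ᵀ * X)ᵀ).trace}
  have hKclosed : IsClosed K := by
    refine ((IsClosed.inter ?_ ((isClosed_eq ?_ ?_).union (isClosed_eq ?_ ?_))).inter
      (isClosed_le ?_ ?_)).inter (isClosed_le ?_ ?_)
    · exact isClosed_isMoorePenrose.preimage
        (f := fun x : (Fin p × Fin (n * q) → ℝ) × (Fin (n * q) × Fin p → ℝ) =>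
          (vecY A x.1, unvec x.2)) (by fun_prop)
    all_goals fun_prop
  have hKbdd : Bornology.IsBounded K := by
    refine (Metric.isBounded_closedBall (x := 0) (r := Real.sqrt c)).subset fun x hx => ?_
    have h := hx.1.2
    simp only [Set.mem_ofPred_eq] at h
    have h1 := trace_transpose_mul_self_nonneg (unvec x.1)
    have h2 := trace_transpose_mul_self_nonneg (unvec x.2)
    have e1 : ∀ {m k : Type} [Fintype m] [Fintype k] (y : k × m → ℝ) (s : k × m),
        y s ^ 2 ≤ ((unvec y)ᵀ * unvec y).trace := by
      intro m k _ _ y s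
      rw [trace_transpose_mul_self, ← Fintype.sum_prod_type']
      exact Finset.single_le_sum (f := fun s : k × m => y s ^ 2) (fun _ _ => sq_nonneg _)
        (Finset.mem_univ s)
    rw [mem_closedBall_zero_iff, Prod.norm_def, max_le_iff, pi_norm_le_iff_of_nonneg
      (Real.sqrt_nonneg _), pi_norm_le_iff_of_nonneg (Real.sqrt_nonneg _)]
    exact ⟨fun s => Real.abs_le_sqrt ((e1 x.1 s).trans (by linarith)),
      fun s => Real.abs_le_sqrt ((e1 x.2 s).trans (by linarith))⟩
  have himg : {z | z ∈ vecRegular n A X ∧ exhaustion A X (unvec z) ≤ c} = Prod.fst '' K := by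
    ext z
    constructor
    · rintro ⟨⟨hfull, hF⟩, hτ⟩
      change FullRank (vecY A z) at hfull
      change (fieldMatrix X (vecY A z)).trace ≠ 0 at hF
      have hF0 : 0 < (fieldMatrix X (vecY A z)).trace :=
        lt_of_le_of_ne (trace_fieldMatrix_nonneg _ _) (Ne.symm hF)
      rw [exhaustion_eq] at hτ
      have hFi := inv_pos.2 hF0
      refine ⟨(z, (pinv (vecY A z)).vec), ⟨⟨⟨pinv_spec _, hfull⟩, ?_⟩, ?_⟩, rfl⟩
      · simp only [Set.mem_ofPred_eq, unvec_vec]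
        linarith
      · simp only [Set.mem_ofPred_eq, unvec_vec]
        change 1 ≤ _ * (fieldMatrix X (vecY A z)).trace
        rw [← div_le_iff₀ hF0, one_div]
        linarith
    · rintro ⟨⟨z', b⟩, ⟨⟨⟨h1, h2⟩, h3⟩, h4⟩, rfl⟩
      have h1 : IsMoorePenrose (vecY A z') (unvec b) := h1
      have hb : unvec b = pinv (vecY A z') := h1.pinv_eq.symm
      simp only [Set.mem_union, Set.mem_ofPred_eq, hb] at h2 h3 h4
      change 1 ≤ _ * (fieldMatrix X (vecY A z')).trace at h4
      have hF0 : 0 < (fieldMatrix X (vecY A z')).trace := by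
        refine lt_of_le_of_ne (trace_fieldMatrix_nonneg _ _) fun h => ?_
        rw [← h] at h4
        linarith
      refine ⟨⟨h2, hF0.ne'⟩, ?_⟩
      rw [← div_le_iff₀ hF0, one_div] at h4
      rw [exhaustion_eq]
      linarith
  rw [himg]
  exact (Metric.isCompact_of_isClosed_isBounded hKclosed hKbdd).image continuous_fst

theorem sum_vec_mul_vec {m k : Type*} [Fintype m] [Fintype k] (V : Matrix m k ℝ) (z : k × m → ℝ) :
    ∑ s, V.vec s * z s = ((unvec z)ᵀ * V).trace := by
  rw [Fintype.sum_prod_type, Matrix.trace]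
  refine Finset.sum_congr rfl fun j _ => ?_
  rw [Matrix.diag_apply, Matrix.mul_apply]
  exact Finset.sum_congr rfl fun i _ => mul_comm _ _

theorem fderiv_comp_unvec {m k : Type*} [Fintype m] [Fintype k] {f : Matrix m k ℝ → ℝ}
    {z v : k × m → ℝ} {d : ℝ} (hd : DifferentiableAt ℝ (fun z => f (unvec z)) z)
    (h : HasLineDerivAt ℝ f d (unvec z) (unvec v)) : fderiv ℝ (fun z => f (unvec z)) z v = d :=
  (hd.hasFDerivAt.hasLineDerivAt v).unique h

/-- For fixed `X`, the expectations over `Ỹ` of `tr (Ỹᵀ (Ỹ H))` and of the divergence of `Ỹ H`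
agree. -/
theorem integral_trace_fieldYH (hq : q ≠ 0) (hA : IsUnit A.det) {c₂ : ℝ}
    (hr : Differentiable ℝ r) (hr' : ∀ x, |deriv r x| ≤ c₂)
    (hae : ∀ᵐ z ∂stdGauss (Fin p × Fin (n * q)), z ∈ vecRegular n A X)
    (hF : Integrable (fun z => r (fieldMatrix X (vecY (n := n) A z)).trace ^ 2 /
      (fieldMatrix X (vecY A z)).trace) (stdGauss (Fin p × Fin (n * q))))
    (hV : Integrable (fun z => ((unvec z)ᵀ * fieldYH r A X (unvec z)).trace)
      (stdGauss (Fin p × Fin (n * q))))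
    (hdiv : Integrable (fun z => divStat n r X ((vecY A z)ᵀ * vecY A z))
      (stdGauss (Fin p × Fin (n * q)))) :
    ∫ z, ((unvec z)ᵀ * fieldYH r A X (unvec z)).trace ∂stdGauss (Fin p × Fin (n * q)) =
      ∫ z, divStat n r X ((vecY A z)ᵀ * vecY A z) ∂stdGauss (Fin p × Fin (n * q)) := by
  have hloc := fun i j => locBddDeriv_fieldYH (n := n) (X := X) hq hA hr hr' i j
  have hdivEq : ∀ z ∈ vecRegular n A X,
      ∑ s, fderiv ℝ (fun z => (fieldYH r A X (unvec z)).vec s) z (Pi.single s 1) =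
        divStat n r X ((vecY A z)ᵀ * vecY A z) := by
    intro z hz
    rw [vecY, ← matDiv_fieldYH hq hA hr hz, matDiv, Finset.sum_comm, Fintype.sum_prod_type]
    refine Finset.sum_congr rfl fun j _ => Finset.sum_congr rfl fun i _ => ?_
    have hs : Matrix.single i j (1 : ℝ) = unvec (Pi.single (j, i) 1) := by
      ext i' j'
      simp [Matrix.single_apply, Pi.single_apply, and_comm, eq_comm]
    have hl := (hasLineDerivAt_fieldYH hq hA hr hz (Matrix.single i j 1) i
      j).lineDifferentiableAt.hasLineDerivAt
    have hd := fderiv_comp_unvec (f := fun Z => fieldYH r A X Z i j) (v := Pi.single (j, i) 1)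
      ((hloc i j).diff z hz) (by rw [← hs]; exact hl)
    exact hd
  have key := integral_divergence_stdGauss (isOpen_vecRegular (n := n) (A := A) (X := X))
    (V := fun s z => (fieldYH r A X (unvec z)).vec s) (fun s => hloc s.2 s.1)
    (τ := fun z => exhaustion A X (unvec z))
    (LocBddDeriv.of_contDiffAt fun z hz => contDiffAt_exhaustion hz)
    isCompact_sublevel_exhaustion hae (hV.abs.const_mul 2) (hF.const_mul 2)
    (fun z _ => by positivity)
    (fun z _ => by
      have := trace_fieldMatrix_nonneg X (vecY A z)
      positivity)
    (fun z hz => by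
      obtain ⟨d, hd, hle⟩ := abs_lineDeriv_exhaustion_le (r := r) hq hA hz
      have := fderiv_comp_unvec (v := (fieldYH r A X (unvec z)).vec)
        ((contDiffAt_exhaustion hz).differentiableAt one_ne_zero) hd
      change |fderiv ℝ _ z (fieldYH r A X (unvec z)).vec| ≤ _
      rw [this]
      exact hle)
    (by simpa only [sum_vec_mul_vec] using hV)
    (hdiv.congr (hae.mono fun z hz => (hdivEq z hz).symm))
  simp only [sum_vec_mul_vec] at key
  rw [key]
  exact integral_congr_ae (hae.mono hdivEq)

end SteinField

/-! ### Full rank almost surely -/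

section FullRankAE

theorem mul_pinv_eq_one_of_det_ne_zero {m k : Type*} [Fintype m] [Fintype k] [DecidableEq m]
    {Y : Matrix m k ℝ} {C : Matrix k m ℝ} (h : (Y * C).det ≠ 0) : Y * pinv Y = 1 := by
  have h1 : Y * pinv Y * (Y * C) = 1 * (Y * C) := by
    rw [← Matrix.mul_assoc, mul_pinv_mul, Matrix.one_mul]
  have hu : IsUnit (Y * C) := (Matrix.isUnit_iff_isUnit_det _).2 (isUnit_iff_ne_zero.2 h)
  exact hu.mul_right_cancel h1

theorem pinv_mul_eq_one_of_det_ne_zero {m k : Type*} [Fintype m] [Fintype k] [DecidableEq k]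
    {Y : Matrix m k ℝ} {C : Matrix k m ℝ} (h : (C * Y).det ≠ 0) : pinv Y * Y = 1 := by
  have h1 : C * Y * (pinv Y * Y) = C * Y * 1 := by
    rw [Matrix.mul_assoc, ← Matrix.mul_assoc Y, mul_pinv_mul, Matrix.mul_one]
  have hu : IsUnit (C * Y) := (Matrix.isUnit_iff_isUnit_det _).2 (isUnit_iff_ne_zero.2 h)
  exact hu.mul_left_cancel h1

/-- A linear image in the square matrices is almost surely invertible if it contains the identity:
on each line in the direction of a preimage of the identity, the determinant is a characteristic
polynomial. -/
theorem ae_det_linearMap_ne_zero {ι k : Type*} [Fintype ι] [Fintype k] [DecidableEq k]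
    (Φ : (ι → ℝ) →ₗ[ℝ] Matrix k k ℝ) {v : ι → ℝ} (hv : Φ v = 1) :
    ∀ᵐ z ∂stdGauss ι, (Φ z).det ≠ 0 := by
  have hΦ : Continuous Φ := by
    refine continuous_matrix fun i j => ?_
    exact ((LinearMap.proj j ∘ₗ LinearMap.proj i ∘ₗ
      (Matrix.ofLinearEquiv ℝ).symm.toLinearMap ∘ₗ Φ :
        (ι → ℝ) →ₗ[ℝ] ℝ)).continuous_of_finiteDimensional
  have hopen : MeasurableSet {z : ι → ℝ | (Φ z).det ≠ 0} :=
    (isOpen_ne_fun (by fun_prop) continuous_const).measurableSet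
  have hvol : ∀ᵐ z : ι → ℝ, z ∈ {z : ι → ℝ | (Φ z).det ≠ 0} := by
    refine ae_mem_of_ae_add_linearMap_mem (𝕜 := ℝ) (LinearMap.toSpanSingleton ℝ (ι → ℝ) v) volume
      volume hopen fun z => ?_
    have hfin : {t : ℝ | (-Φ z).charpoly.IsRoot t}.Finite :=
      Polynomial.finite_setOfPred_isRoot (Matrix.charpoly_monic _).ne_zero
    have : ∀ᵐ t : ℝ, t ∉ {t : ℝ | (-Φ z).charpoly.IsRoot t} :=
      (hfin.countable.ae_notMem volume)
    filter_upwards [this] with t ht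
    intro h
    apply ht
    rw [Polynomial.IsRoot, Matrix.eval_charpoly, sub_neg_eq_add, ← h]
    rw [LinearMap.toSpanSingleton_apply, map_add, map_smul, hv, add_comm, Matrix.scalar_apply,
      Matrix.smul_one_eq_diagonal]
  rw [stdGauss_eq_withDensity]
  exact (withDensity_absolutelyContinuous _ _).ae_le hvol

variable {n p q : ℕ} {A : Matrix (Fin p) (Fin p) ℝ}

theorem FullRank.rank_gram {m p : ℕ} {Y : Matrix (Fin m) (Fin p) ℝ} (h : FullRank Y) :
    (Yᵀ * Y).rank = min m p := by
  rw [Matrix.rank_transpose_mul_self]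
  have hm : Y.rank ≤ m := by simpa using Y.rank_le_card_height
  have hp : Y.rank ≤ p := by simpa using Y.rank_le_card_width
  rcases h with h | h
  · have := Matrix.rank_mul_le_left Y (pinv Y)
    rw [h, Matrix.rank_one, Fintype.card_fin] at this
    omega
  · have := Matrix.rank_mul_le_right (pinv Y) Y
    rw [h, Matrix.rank_one, Fintype.card_fin] at this
    omega

theorem ae_fullRank_vecY (hq : q ≠ 0) (hA : IsUnit A.det) :
    ∀ᵐ z ∂stdGauss (Fin p × Fin (n * q)), FullRank (vecY A z) := by
  have hs : Real.sqrt q ≠ 0 := by positivity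
  have hc : (Real.sqrt q)⁻¹ ≠ 0 := inv_ne_zero hs
  have hZ : ∀ z : Fin p × Fin (n * q) → ℝ, (Real.sqrt q) • (vecY A z * A⁻¹) = unvec z := by
    intro z
    rw [vecY, untildeY, Matrix.smul_mul, smul_smul, mul_inv_cancel₀ hs,
      one_smul, Matrix.mul_nonsing_inv_cancel_right _ _ hA]
  rcases le_total (n * q) p with h | h
  · let J : Matrix (Fin (n * q)) (Fin p) ℝ :=
      Matrix.of fun i j => if Fin.castLE h i = j then 1 else 0
    have hJ : J * Jᵀ = 1 := by
      ext i j
      simp [J, Matrix.mul_apply, Matrix.one_apply, (Fin.castLE_injective h).eq_iff, eq_comm]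
    let Φ : (Fin p × Fin (n * q) → ℝ) →ₗ[ℝ] Matrix (Fin (n * q)) (Fin (n * q)) ℝ :=
      { toFun := fun z => unvec z * Jᵀ
        map_add' := fun z z' => Matrix.add_mul (unvec z) (unvec z') Jᵀ
        map_smul' := fun a z => Matrix.smul_mul a (unvec z) Jᵀ }
    filter_upwards [ae_det_linearMap_ne_zero Φ (v := J.vec) hJ] with z hz
    refine Or.inl (mul_pinv_eq_one_of_det_ne_zero (C := Real.sqrt q • (A⁻¹ * Jᵀ)) ?_)
    rwa [Matrix.mul_smul, ← Matrix.mul_assoc, ← Matrix.smul_mul, hZ]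
  · let J : Matrix (Fin p) (Fin (n * q)) ℝ :=
      Matrix.of fun i j => if Fin.castLE h i = j then 1 else 0
    have hJ : J * Jᵀ = 1 := by
      ext i j
      simp [J, Matrix.mul_apply, Matrix.one_apply, (Fin.castLE_injective h).eq_iff, eq_comm]
    let Φ : (Fin p × Fin (n * q) → ℝ) →ₗ[ℝ] Matrix (Fin p) (Fin p) ℝ :=
      { toFun := fun z => J * unvec z
        map_add' := fun z z' => Matrix.mul_add J (unvec z) (unvec z')
        map_smul' := fun a z => Matrix.mul_smul J a (unvec z) }
    filter_upwards [ae_det_linearMap_ne_zero Φ (v := Jᵀ.vec) hJ] with z hz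
    refine Or.inr (pinv_mul_eq_one_of_det_ne_zero (C := J) ?_)
    have h1 : J * vecY A z = J * unvec z * ((Real.sqrt q)⁻¹ • A) := by
      rw [vecY, untildeY, Matrix.mul_smul, Matrix.mul_smul, Matrix.mul_assoc]
    rw [h1, Matrix.det_mul, Matrix.det_smul]
    exact mul_ne_zero hz (mul_ne_zero (pow_ne_zero _ hc) hA.ne_zero)

end FullRankAE

/-! ### Integrability of the statistics -/

section Measurability

variable {α : Type*} [MeasurableSpace α] {n p q : ℕ} {r : ℝ → ℝ} {X : α → Matrix (Fin p) (Fin q) ℝ}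
  {S : α → Matrix (Fin p) (Fin p) ℝ}

theorem measurable_trace {m : Type*} [Fintype m] {f : α → Matrix m m ℝ}
    (hf : ∀ i j, Measurable fun a => f a i j) : Measurable fun a => (f a).trace :=
  Finset.measurable_sum _ fun i _ => hf i i

theorem measurable_quad_apply (hX : ∀ i j, Measurable fun a => X a i j)
    (hS : ∀ i j, Measurable fun a => S a i j) (i j : Fin q) :
    Measurable fun a => ((X a)ᵀ * pinv (S a) * X a) i j :=
  measurable_mul_apply (f := fun a => (X a)ᵀ * pinv (S a))
    (measurable_mul_apply (f := fun a => (X a)ᵀ) (fun i j => hX j i) (measurable_pinv_apply hS))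
    hX i j

theorem measurable_statF (hX : ∀ i j, Measurable fun a => X a i j)
    (hS : ∀ i j, Measurable fun a => S a i j) : Measurable fun a => statF (X a) (S a) :=
  measurable_trace (measurable_quad_apply hX hS)

theorem measurable_divStat (hr : Measurable r) (hX : ∀ i j, Measurable fun a => X a i j)
    (hS : ∀ i j, Measurable fun a => S a i j) : Measurable fun a => divStat n r (X a) (S a) := by
  have hF := measurable_statF hX hS
  have hrF : Measurable fun a => r (statF (X a) (S a)) := hr.comp hF
  have hdF : Measurable fun a => deriv r (statF (X a) (S a)) := (measurable_deriv r).comp hF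
  have hT : Measurable fun a => (((X a)ᵀ * pinv (S a) * X a) ^ 2).trace := by
    simp only [sq]
    exact measurable_trace (measurable_mul_apply (measurable_quad_apply hX hS)
      (measurable_quad_apply hX hS))
  have hR : Measurable fun a => (S a * pinv (S a)).trace :=
    measurable_trace (measurable_mul_apply hS (measurable_pinv_apply hS))
  unfold divStat
  fun_prop

theorem measurable_shrink_apply (hr : Measurable r) (hX : ∀ i j, Measurable fun a => X a i j)
    (hS : ∀ i j, Measurable fun a => S a i j) (i : Fin p) (j : Fin q) :
    Measurable fun a => shrink r (X a) (S a) i j := by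
  have hF := measurable_statF hX hS
  simp only [shrink, Matrix.smul_apply, smul_eq_mul]
  exact ((hr.comp hF).div hF).mul (measurable_mul_apply
    (measurable_mul_apply hS (measurable_pinv_apply hS)) hX i j)

theorem measurable_trace_shrink (hr : Measurable r) (hX : ∀ i j, Measurable fun a => X a i j)
    (hS : ∀ i j, Measurable fun a => S a i j) (W : Matrix (Fin p) (Fin p) ℝ) :
    Measurable fun a => ((shrink r (X a) (S a))ᵀ * W * shrink r (X a) (S a)).trace :=
  measurable_trace (measurable_mul_apply (f := fun a => (shrink r (X a) (S a))ᵀ * W)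
    (measurable_mul_apply (f := fun a => (shrink r (X a) (S a))ᵀ)
      (fun i j => measurable_shrink_apply hr hX hS j i) fun _ _ => measurable_const)
    (measurable_shrink_apply hr hX hS))

theorem measurable_nablaStat (hr : Measurable r)
    (hX : ∀ i j, Measurable fun a => X a i j) (hS : ∀ i j, Measurable fun a => S a i j) :
    Measurable fun a => nablaStat r (X a) (S a) := by
  have hF := measurable_statF hX hS
  have hrF : Measurable fun a => r (statF (X a) (S a)) := hr.comp hF
  have hdF : Measurable fun a => deriv r (statF (X a) (S a)) := (measurable_deriv r).comp hF
  have hR : Measurable fun a => (S a * pinv (S a)).trace :=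
    measurable_trace (measurable_mul_apply hS (measurable_pinv_apply hS))
  unfold nablaStat
  fun_prop

end Measurability

section ProductIntegrability

variable {n p q : ℕ} {r : ℝ → ℝ} {A : Matrix (Fin p) (Fin p) ℝ} {θ : Matrix (Fin p) (Fin q) ℝ}

/-- The product of the laws of the standardized `X` and of `Ỹ`, as vectors of entries. -/
noncomputable def gaussProd (n p q : ℕ) :
    Measure ((Fin q × Fin p → ℝ) × (Fin p × Fin (n * q) → ℝ)) :=
  (stdGauss (Fin q × Fin p)).prod (stdGauss (Fin p × Fin (n * q)))

instance : IsProbabilityMeasure (gaussProd n p q) := by unfold gaussProd; infer_instance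

/-- `X` in terms of its standardized entries. -/
noncomputable def vecX (θ : Matrix (Fin p) (Fin q) ℝ) (A : Matrix (Fin p) (Fin p) ℝ)
    (w : Fin q × Fin p → ℝ) : Matrix (Fin p) (Fin q) ℝ :=
  θ + A * unvec w

/-- `S = Yᵀ Y` in terms of the entries of `Ỹ`. -/
noncomputable def vecS (A : Matrix (Fin p) (Fin p) ℝ) (z : Fin p × Fin (n * q) → ℝ) :
    Matrix (Fin p) (Fin p) ℝ :=
  (vecY A z)ᵀ * vecY A z

@[fun_prop] theorem continuous_vecX : Continuous (vecX θ A) := by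
  unfold vecX
  fun_prop

@[fun_prop] theorem continuous_vecS : Continuous (vecS (n := n) (q := q) A) := by
  unfold vecS
  fun_prop

theorem measurable_vecX_apply (i : Fin p) (j : Fin q) :
    Measurable fun x : (Fin q × Fin p → ℝ) × (Fin p × Fin (n * q) → ℝ) => vecX θ A x.1 i j := by
  refine Continuous.measurable ?_
  fun_prop

theorem measurable_vecS_apply (i j : Fin p) :
    Measurable fun x : (Fin q × Fin p → ℝ) × (Fin p × Fin (n * q) → ℝ) => vecS A x.2 i j := by
  refine Continuous.measurable ?_
  fun_prop

theorem posSemidef_vecS (z : Fin p × Fin (n * q) → ℝ) : (vecS A z).PosSemidef := by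
  have := Matrix.posSemidef_conjTranspose_mul_self (vecY A z)
  rwa [Matrix.conjTranspose_eq_transpose_of_trivial] at this

theorem integrable_trace_vecS_sq :
    Integrable (fun z => (vecS A z).trace ^ 2) (stdGauss (Fin p × Fin (n * q))) := by
  have h4 : ∀ s, Integrable (fun z : Fin p × Fin (n * q) → ℝ => ‖z s‖ ^ 4)
      (stdGauss (Fin p × Fin (n * q))) := fun s =>
    (memLp_eval_stdGauss s 4).integrable_norm_pow (by norm_num)
  have hsum := (integrable_finsetSum Finset.univ fun s _ => h4 s).const_mul
    ((((Real.sqrt q)⁻¹ ^ 2) * (A * Aᵀ).trace) ^ 2 * (Fintype.card (Fin p × Fin (n * q)) : ℝ))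
  refine hsum.mono' ?_ (Filter.Eventually.of_forall fun z => ?_)
  · refine Continuous.aestronglyMeasurable ?_
    have : Continuous fun z => (vecS (n := n) (q := q) A z).trace := by fun_prop
    exact this.pow 2
  · have h0 := trace_transpose_mul_self_nonneg (vecY A z)
    have h1 : (vecS A z).trace ≤ ((Real.sqrt q)⁻¹ ^ 2) * (A * Aᵀ).trace * ∑ s, z s ^ 2 := by
      have h2 := trace_mul_transpose_mul_le (unvec z) A
      rw [Matrix.trace_mul_comm Aᵀ] at h2
      have h3 : ((unvec z)ᵀ * unvec z).trace = ∑ s, z s ^ 2 := by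
        rw [trace_transpose_mul_self, Fintype.sum_prod_type]
        rfl
      rw [h3] at h2
      rw [vecS, vecY, untildeY, Matrix.transpose_smul, Matrix.smul_mul, Matrix.mul_smul, smul_smul,
        Matrix.trace_smul, smul_eq_mul, ← sq, mul_assoc]
      gcongr
      linarith
    have h5 : (∑ s, z s ^ 2) ^ 2 ≤ (Fintype.card (Fin p × Fin (n * q)) : ℝ) * ∑ s, ‖z s‖ ^ 4 := by
      have := sq_sum_le_card_mul_sum_sq (s := Finset.univ) (f := fun s => z s ^ 2)
      refine this.trans (le_of_eq ?_)
      rw [Finset.card_univ]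
      congr 1
      refine Finset.sum_congr rfl fun s _ => ?_
      rw [Real.norm_eq_abs, ← pow_mul, ← abs_pow, abs_of_nonneg (by positivity)]
    rw [Real.norm_eq_abs, abs_of_nonneg (sq_nonneg _)]
    calc (vecS A z).trace ^ 2 ≤ (((Real.sqrt q)⁻¹ ^ 2) * (A * Aᵀ).trace * ∑ s, z s ^ 2) ^ 2 := by
          gcongr
      _ = (((Real.sqrt q)⁻¹ ^ 2) * (A * Aᵀ).trace) ^ 2 * (∑ s, z s ^ 2) ^ 2 := by ring
      _ ≤ (((Real.sqrt q)⁻¹ ^ 2) * (A * Aᵀ).trace) ^ 2 *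
          ((Fintype.card (Fin p × Fin (n * q)) : ℝ) * ∑ s, ‖z s‖ ^ 4) := by gcongr
      _ = _ := by ring

/-- Finiteness of the inverse moments of `F`, and positivity of `F`. -/
theorem integrable_inv_statF (hq : q ≠ 0) (hA : IsUnit A.det) (hrank : 2 < q * min (n * q) p) :
    (∀ᵐ x ∂gaussProd n p q, 0 < statF (vecX θ A x.1) (vecS A x.2)) ∧
    Integrable (fun x => (statF (vecX θ A x.1) (vecS A x.2))⁻¹) (gaussProd n p q) ∧
    Integrable (fun x => (vecS A x.2).trace / statF (vecX θ A x.1) (vecS A x.2))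
      (gaussProd n p q) := by
  obtain ⟨C, hC, hle⟩ := exists_lintegral_inv_statF_le θ hA.ne_zero
  have hFm : Measurable fun x : (Fin q × Fin p → ℝ) × (Fin p × Fin (n * q) → ℝ) =>
      statF (vecX θ A x.1) (vecS A x.2) :=
    measurable_statF measurable_vecX_apply measurable_vecS_apply
  have hSm : Measurable fun z => (vecS (n := n) (q := q) A z).trace := by
    refine Continuous.measurable ?_
    fun_prop
  have htr0 : ∀ z, 0 ≤ (vecS (n := n) (q := q) A z).trace := fun z =>
    trace_transpose_mul_self_nonneg (vecY A z)
  -- integrate first over `X`, for fixed `S`, with a weight depending on `S`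
  have key : ∀ g : (Fin p × Fin (n * q) → ℝ) → ENNReal, Measurable g →
      ∫⁻ z, g z * ENNReal.ofReal (vecS A z).trace ∂stdGauss (Fin p × Fin (n * q)) ≠ ⊤ →
      ∫⁻ x, g x.2 * (ENNReal.ofReal (statF (vecX θ A x.1) (vecS A x.2)))⁻¹
        ∂gaussProd n p q ≠ ⊤ := by
    intro g hg hfin
    have hm : Measurable fun x : (Fin q × Fin p → ℝ) × (Fin p × Fin (n * q) → ℝ) =>
        g x.2 * (ENNReal.ofReal (statF (vecX θ A x.1) (vecS A x.2)))⁻¹ :=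
      (hg.comp measurable_snd).mul hFm.ennreal_ofReal.inv
    rw [gaussProd, lintegral_prod_symm _ hm.aemeasurable]
    refine ne_top_of_le_ne_top (ENNReal.mul_ne_top hfin hC) ?_
    rw [← lintegral_mul_const' _ _ hC]
    refine lintegral_mono_ae ?_
    filter_upwards [ae_fullRank_vecY (n := n) (A := A) hq hA] with z hz
    rw [lintegral_const_mul _ (by
      exact (hFm.comp (measurable_id.prodMk measurable_const)).ennreal_ofReal.inv), mul_assoc]
    gcongr
    exact hle _ (posSemidef_vecS z) (by rw [vecS, hz.rank_gram]; exact hrank)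
  have hsq := (integrable_trace_vecS_sq (n := n) (q := q) (A := A)).lintegral_lt_top
  have h1 := key (fun _ => 1) measurable_const (by
    refine ne_top_of_le_ne_top (b := ∫⁻ z, 1 + ENNReal.ofReal ((vecS A z).trace ^ 2)
      ∂stdGauss (Fin p × Fin (n * q))) ?_ (lintegral_mono fun z => ?_)
    · rw [lintegral_add_left measurable_const]
      simp [hsq.ne]
    · simp only [one_mul]
      rw [← ENNReal.ofReal_one, ← ENNReal.ofReal_add zero_le_one (sq_nonneg _)]
      exact ENNReal.ofReal_le_ofReal (by nlinarith [sq_nonneg ((vecS A z).trace - 1), htr0 z]))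
  have h2 := key (fun z => ENNReal.ofReal (vecS A z).trace) hSm.ennreal_ofReal (by
    refine ne_top_of_le_ne_top hsq.ne (lintegral_mono fun z => ?_)
    simp only
    rw [← ENNReal.ofReal_mul (htr0 z), sq])
  simp only [one_mul] at h1
  have hpos : ∀ᵐ x ∂gaussProd n p q, 0 < statF (vecX θ A x.1) (vecS A x.2) := by
    filter_upwards [ae_lt_top hFm.ennreal_ofReal.inv h1] with x hx
    simpa [ENNReal.inv_lt_top] using hx
  refine ⟨hpos, ?_, ?_⟩
  · have hm : Measurable fun x : (Fin q × Fin p → ℝ) × (Fin p × Fin (n * q) → ℝ) =>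
        (statF (vecX θ A x.1) (vecS A x.2))⁻¹ := hFm.inv
    refine (lintegral_ofReal_ne_top_iff_integrable hm.aestronglyMeasurable
      (hpos.mono fun x hx => inv_nonneg.2 hx.le)).1 ?_
    rw [lintegral_congr_ae (hpos.mono fun x hx => ENNReal.ofReal_inv_of_pos hx)]
    exact h1
  · have hm : Measurable fun x : (Fin q × Fin p → ℝ) × (Fin p × Fin (n * q) → ℝ) =>
        (vecS A x.2).trace / statF (vecX θ A x.1) (vecS A x.2) := (hSm.comp measurable_snd).div hFm
    refine (lintegral_ofReal_ne_top_iff_integrable hm.aestronglyMeasurable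
      (hpos.mono fun x hx => div_nonneg (htr0 _) hx.le)).1 ?_
    rw [lintegral_congr_ae (hpos.mono fun x hx => ENNReal.ofReal_div_of_pos hx)]
    simpa only [div_eq_mul_inv] using h2

end ProductIntegrability

/-! ### Gaussian laws -/

section Laws

variable {Ω : Type*} [MeasurableSpace Ω] {P : Measure Ω}

open scoped MatrixOrder in
/-- A Gaussian matrix with covariance `(U * U) ⊗ (V * V)` has the law of `M + U W Vᵀ` with `W`
standard: `V ⊗ U` is the positive square root of the covariance. -/
theorem IsGaussianMatrix.identDistrib {m k : Type*} [Fintype m] [DecidableEq m] [Fintype k]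
    [DecidableEq k] {Z : Ω → Matrix m k ℝ} {M : Matrix m k ℝ} {U : Matrix m m ℝ}
    {V : Matrix k k ℝ} (hU : U.PosSemidef) (hV : V.PosSemidef)
    (h : IsGaussianMatrix Z M (U * U) (V * V) P) :
    IdentDistrib (fun ω => (Z ω).vec) (fun w => (M + U * unvec w * Vᵀ).vec) P
      (stdGauss (k × m)) := by
  have hsqrt : CFC.sqrt ((V * V) ⊗ₖ (U * U)) = V ⊗ₖ U := by
    refine CFC.sqrt_unique ?_ (hV.kronecker hU).nonneg
    rw [Matrix.mul_kronecker_mul]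
  have hcont : Continuous fun w : k × m → ℝ => (M + U * unvec w * Vᵀ).vec :=
    continuous_vec.comp (by fun_prop)
  have hofLp : Measurable (WithLp.ofLp : EuclideanSpace ℝ (k × m) → k × m → ℝ) :=
    WithLp.measurable_ofLp 2 _
  refine ⟨hofLp.comp_aemeasurable h.aemeasurable, hcont.aemeasurable, ?_⟩
  have h1 : P.map (fun ω => (Z ω).vec) = (gaussianMatrixLaw M (U * U) (V * V)).map WithLp.ofLp := by
    rw [← h.map_eq, AEMeasurable.map_map_of_aemeasurable hofLp.aemeasurable h.aemeasurable]
    rfl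
  rw [h1, gaussianMatrixLaw, multivariateGaussian, hsqrt, ← map_pi_eq_stdGaussian,
    Measure.map_map hofLp (by fun_prop),
    Measure.map_map (hofLp.comp (by fun_prop)) (by fun_prop)]
  congr 1
  funext w
  change M.vec + (V ⊗ₖ U) *ᵥ w = _
  rw [← vec_unvec w, Matrix.kronecker_mulVec_vec, Matrix.vec_add]
  rfl

variable {n p q : ℕ} {θ : Matrix (Fin p) (Fin q) ℝ}
  {Sig A : Matrix (Fin p) (Fin p) ℝ} {X : Ω → Matrix (Fin p) (Fin q) ℝ}
  {Y : Ω → Matrix (Fin (n * q)) (Fin p) ℝ}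

theorem Model.identDistrib_Y (h : Model n p q θ Sig X Y P) (hA : A.PosDef) (hAsq : A * A = Sig) :
    IdentDistrib (fun ω => (Y ω).vec) (fun z => (vecY A z).vec) P
      (stdGauss (Fin p × Fin (n * q))) := by
  have hV : (((Real.sqrt q)⁻¹ : ℝ) • A) * (((Real.sqrt q)⁻¹ : ℝ) • A) = (q : ℝ)⁻¹ • Sig := by
    rw [Matrix.smul_mul, Matrix.mul_smul, smul_smul, hAsq, ← mul_inv,
      Real.mul_self_sqrt (Nat.cast_nonneg q)]
  have hlaw := h.law_Y
  rw [← hV, ← Matrix.one_mul (1 : Matrix (Fin (n * q)) (Fin (n * q)) ℝ)] at hlaw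
  have := IsGaussianMatrix.identDistrib Matrix.PosSemidef.one
    (hA.posSemidef.smul (inv_nonneg.2 (Real.sqrt_nonneg q))) hlaw
  have hAs : Aᵀ = A := transpose_eq_of_posDef hA
  simpa only [Matrix.one_mul, zero_add, Matrix.transpose_smul, hAs, Matrix.mul_smul, vecY,
    untildeY] using this

theorem Model.identDistrib_X (h : Model n p q θ Sig X Y P) (hA : A.PosDef) (hAsq : A * A = Sig) :
    IdentDistrib (fun ω => (X ω).vec) (fun w => (vecX θ A w).vec) P
      (stdGauss (Fin q × Fin p)) := by
  have hlaw := h.law_X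
  rw [← hAsq, ← Matrix.one_mul (1 : Matrix (Fin q) (Fin q) ℝ)] at hlaw
  have := IsGaussianMatrix.identDistrib hA.posSemidef Matrix.PosSemidef.one hlaw
  simpa only [Matrix.transpose_one, Matrix.mul_one, vecX] using this

/-- The joint law of `(X, S)`, as the image of a product of standard Gaussian measures. -/
theorem Model.identDistrib [IsProbabilityMeasure P] (h : Model n p q θ Sig X Y P) (hA : A.PosDef)
    (hAsq : A * A = Sig) :
    IdentDistrib (fun ω => ((X ω).vec, ((Y ω)ᵀ * Y ω).vec))
      (fun x => ((vecX θ A x.1).vec, (vecS A x.2).vec)) P (gaussProd n p q) := by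
  have hX := h.identDistrib_X hA hAsq
  have hgram : Measurable fun y : Fin p × Fin (n * q) → ℝ =>
      ((unvec y : Matrix (Fin (n * q)) (Fin p) ℝ)ᵀ * unvec y).vec :=
    (continuous_vec.comp (by fun_prop)).measurable
  have hS : IdentDistrib (fun ω => ((Y ω)ᵀ * Y ω).vec) (fun z => (vecS A z).vec) P
      (stdGauss (Fin p × Fin (n * q))) := (h.identDistrib_Y hA hAsq).comp hgram
  have hXm : Measurable fun w => (vecX θ A w).vec :=
    (continuous_vec.comp continuous_vecX).measurable
  have hSm : Measurable fun z => (vecS (n := n) (q := q) A z).vec :=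
    (continuous_vec.comp continuous_vecS).measurable
  refine ⟨hX.aemeasurable_fst.prodMk hS.aemeasurable_fst,
    ((hXm.comp measurable_fst).prodMk (hSm.comp measurable_snd)).aemeasurable, ?_⟩
  rw [(indepFun_iff_map_prod_eq_prod_map_map hX.aemeasurable_fst hS.aemeasurable_fst).1 h.indep,
    hX.map_eq, hS.map_eq, Measure.map_prod_map _ _ hXm hSm]
  rfl

theorem Model.ae_fullRank (h : Model n p q θ Sig X Y P) (hq : q ≠ 0) (hA : A.PosDef)
    (hAsq : A * A = Sig) : ∀ᵐ ω ∂P, FullRank (Y ω) :=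
  (h.identDistrib_Y hA hAsq).symm.ae_snd (p := fun y => FullRank (unvec y))
    (isOpen_fullRank.preimage continuous_unvec).measurableSet
    (ae_fullRank_vecY hq (isUnit_iff_ne_zero.2 hA.det_pos.ne'))

end Laws

/-! ### The identity for the standardized variables -/

section ProductIdentity

variable {n p q : ℕ} {r : ℝ → ℝ} {c₁ c₂ : ℝ} {A : Matrix (Fin p) (Fin p) ℝ}
  {θ : Matrix (Fin p) (Fin q) ℝ}

theorem integrable_divStat_gaussProd (hq : q ≠ 0) (hA : IsUnit A.det)
    (hrank : 2 < q * min (n * q) p) (hr : Measurable r) (hr_range : ∀ x, r x ∈ Set.Icc 0 c₁)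
    (hr_deriv : ∀ x, |deriv r x| ≤ c₂) :
    Integrable (fun x => divStat n r (vecX θ A x.1) (vecS A x.2)) (gaussProd n p q) := by
  obtain ⟨hpos, hinv, -⟩ := integrable_inv_statF (θ := θ) hq hA hrank
  refine ((hinv.const_mul (c₁ ^ 2 * ((n : ℝ) * q + 3 * p + 5))).add
    (integrable_const (4 * c₁ * c₂))).mono'
    (measurable_divStat hr measurable_vecX_apply measurable_vecS_apply).aestronglyMeasurable ?_
  filter_upwards [hpos] with x hx
  exact abs_divStat_le hr_range hr_deriv hx

theorem integrable_risk_gaussProd (hq : q ≠ 0) (hA : A.PosDef)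
    (hrank : 2 < q * min (n * q) p) (hr : Measurable r) (hr_range : ∀ x, r x ∈ Set.Icc 0 c₁) :
    Integrable (fun x => ((shrink r (vecX θ A x.1) (vecS A x.2))ᵀ * (A * A)⁻¹ *
      shrink r (vecX θ A x.1) (vecS A x.2)).trace) (gaussProd n p q) := by
  obtain ⟨hpos, -, hdiv⟩ :=
    integrable_inv_statF (θ := θ) hq (isUnit_iff_ne_zero.2 hA.det_pos.ne') hrank
  refine (hdiv.const_mul (c₁ ^ 2 * (A⁻¹ᵀ * A⁻¹).trace)).mono'
    (measurable_trace_shrink hr measurable_vecX_apply measurable_vecS_apply _).aestronglyMeasurable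
    ?_
  filter_upwards [hpos] with x hx
  exact trace_shrink_le hA hr_range hx

/-- Integration over `X` of the identity obtained from Stein's identity in `Ỹ`. -/
theorem integral_risk_gaussProd (hq : q ≠ 0) (hA : A.PosDef) (hrank : 2 < q * min (n * q) p)
    (hr : Differentiable ℝ r) (hr_range : ∀ x, r x ∈ Set.Icc 0 c₁)
    (hr_deriv : ∀ x, |deriv r x| ≤ c₂) :
    q * ∫ x, ((shrink r (vecX θ A x.1) (vecS A x.2))ᵀ * (A * A)⁻¹ *
      shrink r (vecX θ A x.1) (vecS A x.2)).trace ∂gaussProd n p q =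
      ∫ x, divStat n r (vecX θ A x.1) (vecS A x.2) ∂gaussProd n p q := by
  have hdet : IsUnit A.det := isUnit_iff_ne_zero.2 hA.det_pos.ne'
  have hrm := hr.continuous.measurable
  obtain ⟨hpos, hinv, -⟩ := integrable_inv_statF (θ := θ) hq hdet hrank
  have hD := integrable_divStat_gaussProd (θ := θ) hq hdet hrank hrm hr_range hr_deriv
  have hR := integrable_risk_gaussProd (θ := θ) hq hA hrank hrm hr_range
  have hsq : Integrable (fun x => r (statF (vecX θ A x.1) (vecS A x.2)) ^ 2 /
      statF (vecX θ A x.1) (vecS A x.2)) (gaussProd n p q) := by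
    have hFm : Measurable fun x : (Fin q × Fin p → ℝ) × (Fin p × Fin (n * q) → ℝ) =>
        statF (vecX θ A x.1) (vecS A x.2) :=
      measurable_statF measurable_vecX_apply measurable_vecS_apply
    refine (hinv.const_mul (c₁ ^ 2)).mono'
      (((hrm.comp hFm).pow_const 2).div hFm).aestronglyMeasurable ?_
    filter_upwards [hpos] with x hx
    obtain ⟨h0, h1⟩ := hr_range (statF (vecX θ A x.1) (vecS A x.2))
    change |r (statF (vecX θ A x.1) (vecS A x.2)) ^ 2 / statF (vecX θ A x.1) (vecS A x.2)| ≤ _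
    rw [abs_of_nonneg (by positivity), div_eq_mul_inv]
    gcongr
  rw [← integral_const_mul, gaussProd] at *
  rw [integral_prod _ (hR.const_mul _), integral_prod _ hD]
  refine integral_congr_ae ?_
  filter_upwards [Measure.ae_ae_of_ae_prod hpos, hD.prod_right_ae, hR.prod_right_ae,
    hsq.prod_right_ae] with w hw hDw hRw hsqw
  have hrisk : ∀ z : Fin p × Fin (n * q) → ℝ,
      ((unvec z)ᵀ * fieldYH r A (vecX θ A w) (unvec z)).trace =
      q * ((shrink r (vecX θ A w) (vecS A z))ᵀ * (A * A)⁻¹ *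
        shrink r (vecX θ A w) (vecS A z)).trace := fun z =>
    trace_transpose_mul_fieldYH hq hA (unvec z) rfl
  simp only [← hrisk]
  refine integral_trace_fieldYH hq hdet hr hr_deriv ?_ ?_ ?_ hDw
  · filter_upwards [hw, ae_fullRank_vecY (n := n) hq hdet] with z hz hz'
    refine ⟨hz', ?_⟩
    rw [vecS, statF_gram] at hz
    exact hz.ne'
  · simpa only [vecS, statF_gram] using hsqw
  · simpa only [hrisk] using hRw.const_mul (q : ℝ)

end ProductIdentity

/-! ### Transfer to the statistical model -/

section Transfer

variable {Ω : Type*} [MeasurableSpace Ω] {P : Measure Ω} [IsProbabilityMeasure P] {n p q : ℕ}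
  {θ : Matrix (Fin p) (Fin q) ℝ} {Sig A : Matrix (Fin p) (Fin p) ℝ}
  {X : Ω → Matrix (Fin p) (Fin q) ℝ} {Y : Ω → Matrix (Fin (n * q)) (Fin p) ℝ}

/-- Expectations of functions of `(X, S)` may be computed with standardized variables. -/
theorem Model.identDistrib_comp (h : Model n p q θ Sig X Y P) (hA : A.PosDef)
    (hAsq : A * A = Sig) {Φ : Matrix (Fin p) (Fin q) ℝ → Matrix (Fin p) (Fin p) ℝ → ℝ}
    (hΦ : Measurable fun y : (Fin q × Fin p → ℝ) × (Fin p × Fin p → ℝ) =>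
      Φ (unvec y.1) (unvec y.2)) :
    IdentDistrib (fun ω => Φ (X ω) ((Y ω)ᵀ * Y ω)) (fun x => Φ (vecX θ A x.1) (vecS A x.2)) P
      (gaussProd n p q) :=
  (h.identDistrib hA hAsq).comp hΦ

end Transfer

theorem untildeY_tildeY {n p q : ℕ} {A : Matrix (Fin p) (Fin p) ℝ} (hq : q ≠ 0)
    (hA : IsUnit A.det) (Y : Matrix (Fin (n * q)) (Fin p) ℝ) : untildeY A (tildeY A Y) = Y := by
  have hs : Real.sqrt q ≠ 0 := by positivity
  rw [untildeY, tildeY, Matrix.smul_mul, smul_smul, inv_mul_cancel₀ hs, one_smul,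
    Matrix.nonsing_inv_mul_cancel_right _ _ hA]

/-- The random matrix `S` has almost surely the same rank, hence the hypothesis on its rank is a
condition on the dimensions. -/
theorem Model.lt_mul_min {Ω : Type*} [MeasurableSpace Ω] {P : Measure Ω} [IsProbabilityMeasure P]
    {n p q : ℕ} {θ : Matrix (Fin p) (Fin q) ℝ} {Sig A : Matrix (Fin p) (Fin p) ℝ}
    {X : Ω → Matrix (Fin p) (Fin q) ℝ} {Y : Ω → Matrix (Fin (n * q)) (Fin p) ℝ}
    (h : Model n p q θ Sig X Y P) (hA : A.PosDef) (hAsq : A * A = Sig)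
    (hrank : ∀ᵐ ω ∂P, 2 < q * ((Y ω)ᵀ * Y ω).rank) : q ≠ 0 ∧ 2 < q * min (n * q) p := by
  have hq : q ≠ 0 := by
    obtain ⟨ω, hω⟩ := hrank.exists
    rintro rfl
    simp at hω
  obtain ⟨ω, hω, hm⟩ := (hrank.and (h.ae_fullRank hq hA hAsq)).exists
  rw [hm.rank_gram] at hω
  exact ⟨hq, hω⟩

end MatrixMean

theorem mainTheorem2 {Ω : Type*} [MeasurableSpace Ω] (P : Measure Ω) [IsProbabilityMeasure P]
    (n p q : ℕ) (θ : Matrix (Fin p) (Fin q) ℝ) (Sig A : Matrix (Fin p) (Fin p) ℝ)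
    (X : Ω → Matrix (Fin p) (Fin q) ℝ) (Y : Ω → Matrix (Fin (n * q)) (Fin p) ℝ)
    (S : Ω → Matrix (Fin p) (Fin p) ℝ) (hS : ∀ ω, S ω = (Y ω)ᵀ * Y ω)
    (hmodel : Model n p q θ Sig X Y P)
    (hrank : ∀ᵐ ω ∂P, 2 < q * (S ω).rank)
    (hA : A.PosDef) (hAsq : A * A = Sig)
    (r : ℝ → ℝ) (c₁ c₂ : ℝ) (hr : Differentiable ℝ r) (hr_range : ∀ x, r x ∈ Set.Icc 0 c₁)
    (hr_deriv : ∀ x, |deriv r x| ≤ c₂)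
    (F : Ω → ℝ) (hF : ∀ ω, F ω = statF (X ω) (S ω)) :
    ((∀ᵐ ω ∂P, ∀ i j, HasPartial (fun Z => fieldYH r A (X ω) Z i j) (tildeY A (Y ω)) i j) ∧
      Integrable (fun ω => matDiv (fieldYH r A (X ω)) (tildeY A (Y ω))) P) ∧
    ((∀ᵐ ω ∂P, ∀ i j, HasPartial (fun W => shrink r W (S ω) i j) (X ω) i j) ∧
      Integrable (fun ω => (matNabla (fun W => (shrink r W (S ω))ᵀ) (X ω)).trace) P) ∧
    (Integrable (fun ω => ((shrink r (X ω) (S ω))ᵀ * Sig⁻¹ * shrink r (X ω) (S ω)).trace) P ∧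
      Integrable (fun ω =>
        r (F ω) ^ 2 / F ω * ((n : ℝ) * q + p - 2 * (S ω * pinv (S ω)).trace - 1
            + 4 * (((X ω)ᵀ * pinv (S ω) * X ω) ^ 2).trace / F ω ^ 2)
          - 4 * r (F ω) * deriv r (F ω) / F ω ^ 2
            * (((X ω)ᵀ * pinv (S ω) * X ω) ^ 2).trace) P ∧
      ∫ ω, ((shrink r (X ω) (S ω))ᵀ * Sig⁻¹ * shrink r (X ω) (S ω)).trace ∂P =
        1 / (q : ℝ) * ∫ ω,
          (r (F ω) ^ 2 / F ω * ((n : ℝ) * q + p - 2 * (S ω * pinv (S ω)).trace - 1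
              + 4 * (((X ω)ᵀ * pinv (S ω) * X ω) ^ 2).trace / F ω ^ 2)
            - 4 * r (F ω) * deriv r (F ω) / F ω ^ 2
              * (((X ω)ᵀ * pinv (S ω) * X ω) ^ 2).trace) ∂P) := by
  obtain rfl : S = fun ω => (Y ω)ᵀ * Y ω := funext hS
  obtain rfl : F = fun ω => statF (X ω) ((Y ω)ᵀ * Y ω) := funext hF
  have hdet : IsUnit A.det := isUnit_iff_ne_zero.2 hA.det_pos.ne'
  have hrm := hr.continuous.measurable
  obtain ⟨hq, hrk⟩ := hmodel.lt_mul_min hA hAsq hrank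
  obtain ⟨hpos, hinv, -⟩ := integrable_inv_statF (θ := θ) hq hdet hrk
  have hX : ∀ i j, Measurable fun y : (Fin q × Fin p → ℝ) × (Fin p × Fin p → ℝ) =>
      (unvec y.1 : Matrix (Fin p) (Fin q) ℝ) i j := fun i j =>
    (measurable_pi_apply (j, i)).comp measurable_fst
  have hS : ∀ i j, Measurable fun y : (Fin q × Fin p → ℝ) × (Fin p × Fin p → ℝ) =>
      (unvec y.2 : Matrix (Fin p) (Fin p) ℝ) i j := fun i j =>
    (measurable_pi_apply (j, i)).comp measurable_snd
  have idF := hmodel.identDistrib_comp hA hAsq (Φ := statF) (measurable_statF hX hS)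
  have idD := hmodel.identDistrib_comp hA hAsq (Φ := divStat n r) (measurable_divStat hrm hX hS)
  have idR := hmodel.identDistrib_comp hA hAsq
    (Φ := fun X S => ((shrink r X S)ᵀ * Sig⁻¹ * shrink r X S).trace)
    (measurable_trace_shrink hrm hX hS _)
  have hF0 : ∀ᵐ ω ∂P, 0 < statF (X ω) ((Y ω)ᵀ * Y ω) :=
    idF.symm.ae_snd (p := fun t => 0 < t) measurableSet_Ioi hpos
  have hFinv : Integrable (fun ω => (statF (X ω) ((Y ω)ᵀ * Y ω))⁻¹) P :=
    (idF.comp measurable_inv).integrable_iff.2 hinv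
  have hreg : ∀ᵐ ω ∂P, tildeY A (Y ω) ∈ regularSet A (X ω) := by
    filter_upwards [hF0, hmodel.ae_fullRank hq hA hAsq] with ω h0 hm
    rw [regularSet, Set.mem_ofPred_eq, untildeY_tildeY hq hdet, ← statF_gram]
    exact ⟨hm, h0.ne'⟩
  have hD : Integrable (fun ω => divStat n r (X ω) ((Y ω)ᵀ * Y ω)) P :=
    idD.integrable_iff.2 (integrable_divStat_gaussProd hq hdet hrk hrm hr_range hr_deriv)
  have hsymm : ∀ ω, ((Y ω)ᵀ * Y ω)ᵀ = (Y ω)ᵀ * Y ω := fun ω => by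
    rw [Matrix.transpose_mul, Matrix.transpose_transpose]
  refine ⟨⟨?_, ?_⟩, ⟨?_, ?_⟩, ?_, hD, ?_⟩
  · filter_upwards [hreg] with ω hω i j
    exact (hasLineDerivAt_fieldYH hq hdet hr hω _ i j).lineDifferentiableAt
  · refine hD.congr ?_
    filter_upwards [hreg] with ω hω
    rw [matDiv_fieldYH hq hdet hr hω, untildeY_tildeY hq hdet]
  · filter_upwards [hF0] with ω h0 i j
    exact (hasLineDerivAt_shrink hr (hsymm ω) h0.ne' _ i j).lineDifferentiableAt
  · have hΦ : Integrable (fun ω => nablaStat r (X ω) ((Y ω)ᵀ * Y ω)) P := by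
      refine ((hFinv.const_mul (c₁ * (p * q + 2))).add (integrable_const (2 * c₂))).mono'
        (hmodel.identDistrib_comp hA hAsq (Φ := nablaStat r)
          (measurable_nablaStat hrm hX hS)).aemeasurable_fst.aestronglyMeasurable ?_
      filter_upwards [hF0] with ω h0
      exact abs_nablaStat_le hr_range hr_deriv h0
    refine hΦ.congr ?_
    filter_upwards [hF0] with ω h0
    exact (trace_matNabla_shrink hr (hsymm ω) h0.ne').symm
  · refine idR.integrable_iff.2 ?_
    rw [← hAsq]
    exact integrable_risk_gaussProd hq hA hrk hrm hr_range
  · have h1 := idR.integral_eq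
    have h2 := idD.integral_eq
    have h3 := integral_risk_gaussProd (θ := θ) hq hA hrk hr hr_range hr_deriv
    rw [hAsq, ← h1, ← h2] at h3
    have hq' : (q : ℝ) ≠ 0 := Nat.cast_ne_zero.2 hq
    refine Eq.trans ?_ (congrArg (fun t => 1 / (q : ℝ) * t) h3)
    field_simp
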